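/- Let $K$ be an algebraically closed field. A triangulation quiver $(Q,f)$ is a finite connected quiver $Q=(Q_0,Q_1,s,t)$ in which every vertex is the source of exactly two arrows and the target of exactly two arrows, together with a permutation $f$ of $Q_1$ such that $s(f(\alpha))=t(\alpha)$ for all $\alpha$ and $f^3=\mathrm{id}$. For an arrow $\alpha$ let $\bar\alpha\neq\alpha$ be the other arrow with source $s(\alpha)$, let $g$ be the permutation $g(\alpha)=\overline{f(\alpha)}$ of $Q_1$, $\mathcal O(g)$ the set of its orbits, and $n_\alpha$ the number of elements of the $g$-orbit of $\alpha$. Let $m_\bullet:\mathcal O(g)\to\{1,2,\dots\}$ and $c_\bullet:\mathcal O(g)\to K\setminus\{0\}$ be functions, write $m_\alpha,c_\alpha$ for their values at the orbit of $\alpha$, and assume $m_\alpha n_\alpha\ge 3$ for all $\alpha\in Q_1$. Let $A_\alpha=\alpha\, g(\alpha)\, g^2(\alpha)\cdots$ be the path of length $m_\alpha n_\alpha-1$ along the $g$-orbit of $\alpha$ (paths are read from left to right). The weighted triangulation algebra is $\Lambda=KQ/I$, where $I$ is the ideal of the path algebra $KQ$ generated by $\alpha f(\alpha)-c_{\bar\alpha}A_{\bar\alpha}$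 and $\alpha f(\alpha)g(f(\alpha))$ for all $\alpha\in Q_1$. For a vertex $i$ let $e_i$ be the corresponding idempotent of $\Lambda$, and put $P_i=e_i\Lambda$ and $S_i=e_i\Lambda/e_i\operatorname{rad}\Lambda$ (right $\Lambda$-modules). The tetrahedral triangulation quiver has vertices $1,\dots,6$, arrows $\gamma:4\to1$, $\delta:1\to5$, $\eta:5\to4$, $\beta:4\to2$, $\varrho:2\to6$, $\omega:6\to4$, $\sigma:3\to2$, $\varepsilon:2\to5$, $\xi:5\to3$, $\alpha:3\to1$, $\nu:1\to6$, $\mu:6\to3$, and $f$ has the orbits $(\gamma\,\delta\,\eta)$, $(\beta\,\varrho\,\omega)$, $(\sigma\,\varepsilon\,\xi)$, $(\alpha\,\nu\,\mu)$. The algebra $\Lambda$ is called tetrahedral if $(Q,f)$ is isomorphic to this triangulation quiver and $m_\bullet$ is constant with value $1$ ($c_\bullet$ being arbitrary). **Proposition.** Assume that $Q$ has at least three vertices and that $\Lambda$ is not tetrahedral. Let $i$ be a vertex of $Q$ and $\alpha,\bar\alpha$ the two arrows with source $i$. Then there is an exact sequence of right $\Lambda$-modules $$0\to S_i\to P_i\xrightarrow{\pi_3}P_{t(f(\alpha))}\oplus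 P_{t(f(\bar\alpha))}\xrightarrow{\pi_2}P_{t(\alpha)}\oplus P_{t(\bar\alpha)}\xrightarrow{\pi_1}P_i\to S_i\to0,$$ and the sequence obtained by splicing infinitely many copies of it, via the composites $P_i\to S_i\to P_i$, is a minimal projective resolution of $S_i$. The module $S_i$ is simple and periodic of period $4$: $\Omega_\Lambda^4(S_i)\cong S_i$ and $\Omega_\Lambda^j(S_i)\not\cong S_i$ for $j=1,2,3$, where $\Omega_\Lambda(M)$ is the kernel of a projective cover of $M$. Consequently, every simple right $\Lambda$-module is periodic of period $4$. -/

import Mathlib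

universe uK uV uA

/-! ### Quivers and path algebras -/

/-- A quiver `(Q₀, Q₁, s, t)` with vertex set `V = Q₀` and arrow set `A = Q₁`. -/
structure QuiverData (V A : Type*) where
  /-- source of an arrow -/
  s : A → V
  /-- target of an arrow -/
  t : A → V

namespace QuiverData

variable {V A : Type*} (Q : QuiverData V A)

/-- The list of arrows `l` can be walked along from left to right, starting at the vertex `i`. -/
def IsWalk : V → List A → Prop
  | _, [] => True
  | i, a :: l => Q.s a = i ∧ IsWalk (Q.t a) l

/-- The vertex reached from `i` after walking along the list of arrows `l`. -/
def endpoint : V → List A → V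
  | i, [] => i
  | _, a :: l => endpoint (Q.t a) l

theorem isWalk_append (i : V) (l l' : List A) (h : Q.IsWalk i l)
    (h' : Q.IsWalk (Q.endpoint i l) l') : Q.IsWalk i (l ++ l') := by
  induction l generalizing i with
  | nil => exact h'
  | cons a l ih => exact ⟨h.1, ih _ h.2 h'⟩

theorem endpoint_append (i : V) (l l' : List A) :
    Q.endpoint i (l ++ l') = Q.endpoint (Q.endpoint i l) l' := by
  induction l generalizing i with
  | nil => rfl
  | cons a l ih => exact ih _

/-- A path in `Q` (of length `≥ 0`): a starting vertex and a composable list of arrows, read from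
left to right.  The empty list at `i` is the trivial path at `i`. -/
@[ext]
structure QPath where
  /-- the starting vertex -/
  src : V
  /-- the arrows of the path, in the order in which they are walked along -/
  arrows : List A
  isWalk : Q.IsWalk src arrows

variable {Q}

/-- The end vertex of a path. -/
def QPath.tgt (p : Q.QPath) : V := Q.endpoint p.src p.arrows

/-- Concatenation `p q` of paths: first `p`, then `q`. -/
def QPath.comp (p q : Q.QPath) (h : p.tgt = q.src) : Q.QPath where
  src := p.src
  arrows := p.arrows ++ q.arrows
  isWalk := Q.isWalk_append _ _ _ p.isWalk (by
    have h' : Q.endpoint p.src p.arrows = q.src := h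
    rw [h']; exact q.isWalk)

theorem QPath.tgt_comp (p q : Q.QPath) (h : p.tgt = q.src) : (p.comp q h).tgt = q.tgt := by
  have h' : Q.endpoint p.src p.arrows = q.src := h
  simp only [QPath.tgt, QPath.comp, endpoint_append, h']

variable (Q)

/-- The trivial path at the vertex `i`. -/
def trivialPath (i : V) : Q.QPath := ⟨i, [], trivial⟩

/-- An arrow as a path of length one. -/
def arrowPath (a : A) : Q.QPath := ⟨Q.s a, [a], rfl, trivial⟩

end QuiverData

/-- The path algebra `KQ`: the `K`-vector space with basis the set of all paths of `Q`. -/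
def PathAlgebra (K : Type*) [Field K] {V A : Type*} (Q : QuiverData V A) : Type _ := Q.QPath →₀ K

namespace PathAlgebra

variable (K : Type*) [Field K] {V A : Type*} (Q : QuiverData V A)

noncomputable instance : AddCommGroup (PathAlgebra K Q) := inferInstanceAs (AddCommGroup (Q.QPath →₀ K))

noncomputable instance : Module K (PathAlgebra K Q) := inferInstanceAs (Module K (Q.QPath →₀ K))

/-- The basis element of `KQ` given by a path. -/
noncomputable def ofPath (p : Q.QPath) : PathAlgebra K Q := Finsupp.single p (1 : K)

open Classical in
/-- The product of two paths in `KQ`: their concatenation if it exists, and zero otherwise. -/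
noncomputable def pathMul (p q : Q.QPath) : PathAlgebra K Q :=
  if h : p.tgt = q.src then ofPath K Q (p.comp q h) else 0

/-- The linear map out of `KQ` with prescribed values on the paths. -/
noncomputable def extend {M : Type*} [AddCommGroup M] [Module K M] (φ : Q.QPath → M) :
    PathAlgebra K Q →ₗ[K] M :=
  Finsupp.lift M K Q.QPath φ

/-- The multiplication of `KQ`: the bilinear extension of `pathMul`. -/
noncomputable def mulHom : PathAlgebra K Q →ₗ[K] PathAlgebra K Q →ₗ[K] PathAlgebra K Q :=
  extend K Q fun p => extend K Q fun q => pathMul K Q p q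

noncomputable instance : Mul (PathAlgebra K Q) := ⟨fun x y => mulHom K Q x y⟩

/-- The identity of `KQ`: the sum of the trivial paths. -/
noncomputable instance [Fintype V] : One (PathAlgebra K Q) :=
  ⟨∑ i, ofPath K Q (Q.trivialPath i)⟩

theorem mul_def (x y : PathAlgebra K Q) : x * y = mulHom K Q x y := rfl

theorem extend_ofPath {M : Type*} [AddCommGroup M] [Module K M] (φ : Q.QPath → M) (p : Q.QPath) :
    extend K Q φ (ofPath K Q p) = φ p := by
  have h := Finsupp.sum_single_index (a := p) (b := (1 : K)) (h := fun x r => r • φ x)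
    (zero_smul K _)
  rw [one_smul] at h
  exact h

theorem ofPath_mul (p q : Q.QPath) : ofPath K Q p * ofPath K Q q = pathMul K Q p q := by
  rw [mul_def, mulHom, extend_ofPath, extend_ofPath]

theorem ofPath_mul_of_eq (p q : Q.QPath) (h : p.tgt = q.src) :
    ofPath K Q p * ofPath K Q q = ofPath K Q (p.comp q h) := by
  rw [ofPath_mul, pathMul, dif_pos h]

theorem ofPath_mul_of_ne (p q : Q.QPath) (h : p.tgt ≠ q.src) :
    ofPath K Q p * ofPath K Q q = 0 := by
  rw [ofPath_mul, pathMul, dif_neg h]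

/-- Linear maps out of `KQ` that agree on paths are equal. -/
theorem hom_ext {M : Type*} [AddCommGroup M] [Module K M] {φ ψ : PathAlgebra K Q →ₗ[K] M}
    (h : ∀ p, φ (ofPath K Q p) = ψ (ofPath K Q p)) : φ = ψ := by
  refine Finsupp.lhom_ext' fun p => LinearMap.ext_ring ?_
  exact h p

theorem ofPath_assoc (p q r : Q.QPath) :
    ofPath K Q p * ofPath K Q q * ofPath K Q r = ofPath K Q p * (ofPath K Q q * ofPath K Q r) := by
  have z1 (x : PathAlgebra K Q) : 0 * x = 0 := by rw [mul_def, map_zero]; rfl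
  have z2 (x : PathAlgebra K Q) : x * 0 = 0 := by rw [mul_def, map_zero]
  by_cases h1 : p.tgt = q.src
  · by_cases h2 : q.tgt = r.src
    · rw [ofPath_mul_of_eq K Q p q h1, ofPath_mul_of_eq K Q q r h2,
        ofPath_mul_of_eq K Q _ r ((p.tgt_comp q h1).trans h2),
        ofPath_mul_of_eq K Q p (q.comp r h2) h1]
      congr 1
      exact QuiverData.QPath.ext rfl (List.append_assoc _ _ _)
    · rw [ofPath_mul_of_eq K Q p q h1, ofPath_mul_of_ne K Q q r h2,
        ofPath_mul_of_ne K Q _ r (fun h => h2 ((p.tgt_comp q h1).symm.trans h)), z2]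
  · by_cases h2 : q.tgt = r.src
    · rw [ofPath_mul_of_ne K Q p q h1, ofPath_mul_of_eq K Q q r h2,
        ofPath_mul_of_ne K Q p (q.comp r h2) h1, z1]
    · rw [ofPath_mul_of_ne K Q p q h1, ofPath_mul_of_ne K Q q r h2, z1, z2]

/-- To prove a property of all elements of `KQ` that is stable under sums and multiples, it is
enough to prove it for the paths. -/
theorem path_induction {motive : PathAlgebra K Q → Prop} (x : PathAlgebra K Q)
    (zero : motive 0) (add : ∀ x y, motive x → motive y → motive (x + y))
    (smul : ∀ (r : K) x, motive x → motive (r • x))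
    (ofPath : ∀ p, motive (PathAlgebra.ofPath K Q p)) : motive x := by
  refine Finsupp.induction_linear (motive := motive) x zero (fun f g hf hg => add f g hf hg)
    (fun p r => ?_)
  have h : (Finsupp.single p r : Q.QPath →₀ K) = r • Finsupp.single p (1 : K) := by
    rw [Finsupp.smul_single, smul_eq_mul, mul_one]
  have h2 := smul r _ (ofPath p)
  exact h.symm ▸ h2

theorem add_mul' (x y z : PathAlgebra K Q) : (x + y) * z = x * z + y * z := by
  simp only [mul_def, map_add, LinearMap.add_apply]

theorem mul_add' (x y z : PathAlgebra K Q) : x * (y + z) = x * y + x * z := by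
  simp only [mul_def, map_add]

theorem zero_mul' (x : PathAlgebra K Q) : 0 * x = 0 := by
  simp only [mul_def, map_zero, LinearMap.zero_apply]

theorem mul_zero' (x : PathAlgebra K Q) : x * 0 = 0 := by
  simp only [mul_def, map_zero]

theorem smul_mul' (r : K) (x y : PathAlgebra K Q) : (r • x) * y = r • (x * y) := by
  simp only [mul_def, map_smul, LinearMap.smul_apply]

theorem mul_smul' (r : K) (x y : PathAlgebra K Q) : x * (r • y) = r • (x * y) := by
  simp only [mul_def, map_smul]

theorem mul_assoc' (x y z : PathAlgebra K Q) : x * y * z = x * (y * z) := by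
  induction x using path_induction with
  | zero => simp only [zero_mul']
  | add a b ha hb => simp only [add_mul', ha, hb]
  | smul r a ha => simp only [smul_mul', ha]
  | ofPath p =>
    induction y using path_induction with
    | zero => simp only [zero_mul', mul_zero']
    | add a b ha hb => simp only [add_mul', mul_add', ha, hb]
    | smul r a ha => simp only [smul_mul', mul_smul', ha]
    | ofPath q =>
      induction z using path_induction with
      | zero => simp only [mul_zero']
      | add a b ha hb => simp only [mul_add', ha, hb]
      | smul r a ha => simp only [mul_smul', ha]
      | ofPath r => exact ofPath_assoc K Q p q r

theorem sum_mul' {ι : Type*} (s : Finset ι) (u : ι → PathAlgebra K Q) (x : PathAlgebra K Q) :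
    (∑ i ∈ s, u i) * x = ∑ i ∈ s, u i * x := by
  simp only [mul_def, map_sum, LinearMap.sum_apply]

theorem mul_sum' {ι : Type*} (s : Finset ι) (u : ι → PathAlgebra K Q) (x : PathAlgebra K Q) :
    x * (∑ i ∈ s, u i) = ∑ i ∈ s, x * u i := by
  simp only [mul_def, map_sum]

theorem one_mul' [Fintype V] (x : PathAlgebra K Q) : 1 * x = x := by
  induction x using path_induction with
  | zero => exact mul_zero' K Q 1
  | add a b ha hb => rw [mul_add', ha, hb]
  | smul r a ha => rw [mul_smul', ha]
  | ofPath p =>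
    change (∑ i, ofPath K Q (Q.trivialPath i)) * ofPath K Q p = ofPath K Q p
    rw [sum_mul', Finset.sum_eq_single p.src]
    · rw [ofPath_mul_of_eq K Q (Q.trivialPath p.src) p rfl]
      rfl
    · intro i _ hi
      exact ofPath_mul_of_ne K Q (Q.trivialPath i) p hi
    · intro h
      exact absurd (Finset.mem_univ _) h

theorem mul_one' [Fintype V] (x : PathAlgebra K Q) : x * 1 = x := by
  induction x using path_induction with
  | zero => exact zero_mul' K Q 1
  | add a b ha hb => rw [add_mul', ha, hb]
  | smul r a ha => rw [smul_mul', ha]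
  | ofPath p =>
    change ofPath K Q p * (∑ i, ofPath K Q (Q.trivialPath i)) = ofPath K Q p
    rw [mul_sum', Finset.sum_eq_single p.tgt]
    · rw [ofPath_mul_of_eq K Q p (Q.trivialPath p.tgt) rfl]
      congr 1
      exact QuiverData.QPath.ext rfl (List.append_nil _)
    · intro i _ hi
      exact ofPath_mul_of_ne K Q p (Q.trivialPath i) (fun h => hi h.symm)
    · intro h
      exact absurd (Finset.mem_univ _) h

noncomputable instance [Fintype V] : Ring (PathAlgebra K Q) :=
  { (inferInstance : AddCommGroup (PathAlgebra K Q)) with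
    mul := (· * ·)
    one := 1
    left_distrib := mul_add' K Q
    right_distrib := add_mul' K Q
    zero_mul := zero_mul' K Q
    mul_zero := mul_zero' K Q
    mul_assoc := mul_assoc' K Q
    one_mul := one_mul' K Q
    mul_one := mul_one' K Q }

noncomputable instance [Fintype V] : Algebra K (PathAlgebra K Q) :=
  Algebra.ofModule (smul_mul' K Q) (fun r x y => mul_smul' K Q r x y)

/-- The idempotent of `KQ` at the vertex `i`. -/
noncomputable def vertex (i : V) : PathAlgebra K Q := ofPath K Q (Q.trivialPath i)

/-- An arrow as an element of `KQ`. -/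
noncomputable def arrow (a : A) : PathAlgebra K Q := ofPath K Q (Q.arrowPath a)

end PathAlgebra

/-! ### Triangulation quivers -/

/-- A triangulation quiver `(Q, f)` with vertex set `V` and arrow set `A`.  (As `V` is finite in all
uses below, `A` is then finite by `two_out`.) -/
structure TriangulationQuiver (V A : Type*) extends QuiverData V A where
  /-- the permutation `f` of the arrows -/
  f : Equiv.Perm A
  /-- the underlying graph of the quiver is connected -/
  connected : ∀ i j : V, Relation.EqvGen (fun x y => ∃ a, s a = x ∧ t a = y) i j
  two_out : ∀ i, {a | s a = i}.ncard = 2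
  two_in : ∀ i, {a | t a = i}.ncard = 2
  s_f : ∀ a, s (f a) = t a
  f_cube : ∀ a, f (f (f a)) = a

namespace TriangulationQuiver

variable {V A : Type*} (Q : TriangulationQuiver V A)

theorem exists_other (a : A) : ∃ b, b ≠ a ∧ Q.s b = Q.s a := by
  obtain ⟨x, y, hxy, h⟩ := Set.ncard_eq_two.1 (Q.two_out (Q.s a))
  have hx : Q.s x = Q.s a := by
    have : x ∈ {c | Q.s c = Q.s a} := h ▸ Set.mem_insert x {y}
    exact this
  have hy : Q.s y = Q.s a := by
    have : y ∈ {c | Q.s c = Q.s a} := h ▸ Set.mem_insert_of_mem x rfl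
    exact this
  by_cases e : x = a
  · exact ⟨y, fun h' => hxy (e.trans h'.symm), hy⟩
  · exact ⟨x, e, hx⟩

/-- The other arrow with the same source as `a`. -/
noncomputable def barFun (a : A) : A := (Q.exists_other a).choose

theorem barFun_ne (a : A) : Q.barFun a ≠ a := (Q.exists_other a).choose_spec.1

theorem s_barFun (a : A) : Q.s (Q.barFun a) = Q.s a := (Q.exists_other a).choose_spec.2

theorem eq_or_eq_barFun {a b : A} (h : Q.s b = Q.s a) : b = a ∨ b = Q.barFun a := by
  obtain ⟨x, y, -, hS⟩ := Set.ncard_eq_two.1 (Q.two_out (Q.s a))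
  have key : ∀ c, Q.s c = Q.s a → c = x ∨ c = y := fun c hc => by
    have : c ∈ {c | Q.s c = Q.s a} := hc
    rw [hS] at this
    exact this
  have h1 := key a rfl
  have h2 := key _ (Q.s_barFun a)
  have h3 := key b h
  have h4 := Q.barFun_ne a
  grind

theorem barFun_involutive : Function.Involutive Q.barFun := fun a => by
  rcases Q.eq_or_eq_barFun
    ((Q.s_barFun (Q.barFun a)).trans (Q.s_barFun a)) with h | h
  · exact h
  · exact absurd h (Q.barFun_ne _)

/-- The involution `a ↦ ā` of the arrows: `ā` is the arrow with the same source as `a` and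
`ā ≠ a`. -/
noncomputable def bar : Equiv.Perm A := Q.barFun_involutive.toPerm

/-- The permutation `g` of the arrows, `g a` being the other arrow starting where `f a` starts. -/
noncomputable def g : Equiv.Perm A := Q.f.trans Q.bar

/-- The set `𝒪(g)` of `g`-orbits in the set of arrows. -/
abbrev Orbits : Type _ := Quotient (Equiv.Perm.SameCycle.setoid Q.g)

/-- The `g`-orbit of an arrow. -/
noncomputable def orbit (a : A) : Q.Orbits := Quotient.mk _ a

/-- The length `n_a` of the `g`-orbit of `a`. -/
noncomputable def n (a : A) : ℕ := {b | Q.g.SameCycle a b}.ncard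

end TriangulationQuiver

/-! ### Weighted triangulation algebras -/

section Algebras

variable (K : Type*) [Field K] {V A : Type*} [Fintype V] (Q : TriangulationQuiver V A)
  (m : Q.Orbits → ℕ+) (c : Q.Orbits → Kˣ)

/-- The path `A_a` in `Q`, as an element of `KQ`: it is
`(a g(a) ⋯ g^{n_a-1}(a))^{m_a-1} a g(a) ⋯ g^{n_a-2}(a)` (and `a^{m_a-1}` if `n_a = 1`), that is, the
path `a g(a) g²(a) ⋯` of length `m_a n_a - 1`. -/
noncomputable def pathA (a : A) : PathAlgebra K Q.toQuiverData :=
  ((List.iterate Q.g a (m (Q.orbit a) * Q.n a - 1)).map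
    (PathAlgebra.arrow K Q.toQuiverData)).prod

variable {K}

/-- The generators of the ideal `I(Q, f, m, c)` of `KQ`. -/
def relations : Set (PathAlgebra K Q.toQuiverData) :=
  {x | ∃ a, x = PathAlgebra.arrow K _ a * PathAlgebra.arrow K _ (Q.f a)
      - (c (Q.orbit (Q.bar a)) : K) • pathA K Q m (Q.bar a)} ∪
  {x | ∃ b, x = PathAlgebra.arrow K _ b * PathAlgebra.arrow K _ (Q.f b)
      * PathAlgebra.arrow K _ (Q.g (Q.f b))}

/-- The weighted triangulation algebra `Λ(Q, f, m, c) = KQ / I(Q, f, m, c)`. -/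
def WTAlgebra : Type _ := (TwoSidedIdeal.span (relations Q m c)).ringCon.Quotient

namespace WTAlgebra

noncomputable instance : Ring (WTAlgebra Q m c) :=
  inferInstanceAs (Ring (TwoSidedIdeal.span (relations Q m c)).ringCon.Quotient)

noncomputable instance : Algebra K (WTAlgebra Q m c) :=
  inferInstanceAs (Algebra K (TwoSidedIdeal.span (relations Q m c)).ringCon.Quotient)

/-- The residue class map `KQ → Λ`. -/
noncomputable def mk : PathAlgebra K Q.toQuiverData →ₐ[K] WTAlgebra Q m c :=
  RingCon.mkₐ K (TwoSidedIdeal.span (relations Q m c)).ringCon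

/-- The idempotent `e_i` of `Λ`. -/
noncomputable def e (i : V) : WTAlgebra Q m c := mk Q m c (PathAlgebra.vertex K _ i)

/-- The indecomposable projective right `Λ`-module `P_i = e_i Λ`.  Right `Λ`-modules are
modules over the opposite ring of `Λ`. -/
noncomputable def P (i : V) : Submodule (WTAlgebra Q m c)ᵐᵒᵖ (WTAlgebra Q m c) :=
  Submodule.span (WTAlgebra Q m c)ᵐᵒᵖ {e Q m c i}

/-- The submodule `e_i rad Λ` of `P_i`. -/
noncomputable def radP (i : V) : Submodule (WTAlgebra Q m c)ᵐᵒᵖ (P Q m c i) :=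
  ((Module.jacobson (WTAlgebra Q m c)ᵐᵒᵖ (WTAlgebra Q m c)).map
    (LinearMap.mulLeft (WTAlgebra Q m c)ᵐᵒᵖ (e Q m c i))).comap (P Q m c i).subtype

/-- The simple right `Λ`-module `S_i = e_i Λ / e_i rad Λ`. -/
abbrev S (i : V) : Type _ := P Q m c i ⧸ radP Q m c i

end WTAlgebra

end Algebras

/-! ### The tetrahedral triangulation quiver

The vertices `1, …, 6` are numbered `0, …, 5`.  The arrows `0, …, 11` are, in this order,
`γ : 4 → 1`, `δ : 1 → 5`, `η : 5 → 4`, `β : 4 → 2`, `ϱ : 2 → 6`, `ω : 6 → 4`,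
`σ : 3 → 2`, `ε : 2 → 5`, `ξ : 5 → 3`, `α : 3 → 1`, `ν : 1 → 6`, `μ : 6 → 3`, and the orbits of `f`
are `(γ δ η)`, `(β ϱ ω)`, `(σ ε ξ)`, `(α ν μ)`. -/

/-- sources of the arrows of the tetrahedral triangulation quiver -/
def tetrahedralSource : Fin 12 → Fin 6 := ![3, 0, 4, 3, 1, 5, 2, 1, 4, 2, 0, 5]

/-- targets of the arrows of the tetrahedral triangulation quiver -/
def tetrahedralTarget : Fin 12 → Fin 6 := ![0, 4, 3, 1, 5, 3, 1, 4, 2, 0, 5, 2]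

/-- the permutation `f` of the tetrahedral triangulation quiver -/
def tetrahedralF : Fin 12 → Fin 12 := ![1, 2, 0, 4, 5, 3, 7, 8, 6, 10, 11, 9]

/-- `(Q, f)` is (isomorphic to) the tetrahedral triangulation quiver. -/
def TriangulationQuiver.IsTetrahedral {V A : Type*} (Q : TriangulationQuiver V A) : Prop :=
  ∃ (u : V ≃ Fin 6) (v : A ≃ Fin 12), ∀ a,
    u (Q.s a) = tetrahedralSource (v a) ∧ u (Q.t a) = tetrahedralTarget (v a) ∧
      v (Q.f a) = tetrahedralF (v a)

/-- The data `(Q, f, m, c)` define a tetrahedral algebra: `(Q, f)` is the tetrahedral triangulation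
quiver, and the weight function is `1` on each `g`-orbit (the parameter function is arbitrary). -/
def IsTetrahedralData {V A : Type*} (Q : TriangulationQuiver V A) (m : Q.Orbits → ℕ+) : Prop :=
  Q.IsTetrahedral ∧ ∀ o, m o = 1

/-! ### Projective covers, minimal projective resolutions, syzygies, periodicity -/

section Homological

universe u v

variable {R : Type u} [Ring R]

/-- A submodule `N` of `M` is superfluous if `N + L = M` only for `L = M`. -/
def IsSuperfluous {M : Type*} [AddCommGroup M] [Module R M] (N : Submodule R M) : Prop :=
  ∀ L : Submodule R M, N ⊔ L = ⊤ → L = ⊤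

/-- `p : P → M` is a projective cover of `M`. -/
structure IsProjectiveCover {P M : Type*} [AddCommGroup P] [Module R P] [AddCommGroup M]
    [Module R M] (p : P →ₗ[R] M) : Prop where
  projective : Module.Projective R P
  surjective : Function.Surjective p
  superfluous : IsSuperfluous (LinearMap.ker p)

/-- `⋯ → X 2 → X 1 → X 0 → M → 0` is a minimal projective resolution of `M`: it is an exact sequence,
the modules `X n` are projective, and each `X n` is a projective cover of its image under the
next map. -/
structure IsMinimalProjectiveResolution {M : Type*} [AddCommGroup M] [Module R M]
    (X : ℕ → ModuleCat.{v} R) (d : ∀ n, X (n + 1) →ₗ[R] X n) (ε : X 0 →ₗ[R] M) : Prop where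
  cover_zero : IsProjectiveCover ε
  cover_succ : ∀ n, IsProjectiveCover (d n).rangeRestrict
  exact_zero : Function.Exact (d 0) ε
  exact_succ : ∀ n, Function.Exact (d (n + 1)) (d n)

/-- The `4`-periodic sequence of modules `P₀, P₁, P₂, P₃, P₀, P₁, P₂, P₃, …`. -/
def spliceObj (P₀ P₁ P₂ P₃ : ModuleCat.{v} R) : ℕ → ModuleCat.{v} R
  | 0 => P₀
  | 1 => P₁
  | 2 => P₂
  | 3 => P₃
  | n + 4 => spliceObj P₀ P₁ P₂ P₃ n

/-- The maps of the sequence obtained by splicing infinitely many copies of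
`0 → S → P₃ → P₂ → P₁ → P₀ → S → 0` along the composites `P₀ → S → P₃`. -/
def spliceMap {P₀ P₁ P₂ P₃ : ModuleCat.{v} R} {S : Type*} [AddCommGroup S] [Module R S]
    (ι : S →ₗ[R] P₃) (π₃ : P₃ →ₗ[R] P₂) (π₂ : P₂ →ₗ[R] P₁) (π₁ : P₁ →ₗ[R] P₀) (ε : P₀ →ₗ[R] S) :
    ∀ n, spliceObj P₀ P₁ P₂ P₃ (n + 1) →ₗ[R] spliceObj P₀ P₁ P₂ P₃ n
  | 0 => π₁
  | 1 => π₂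
  | 2 => π₃
  | 3 => ι ∘ₗ ε
  | n + 4 => spliceMap ι π₃ π₂ π₁ ε n

/-- `N` is (isomorphic to) the `n`-th syzygy `Ωⁿ(M)`, where `Ω⁰(M) = M` and `Ωⁿ⁺¹(M) = Ωⁿ(Ω(M))`, with
`Ω(M)` the kernel of a projective cover of `M`. -/
def IsSyzygy : ℕ → ModuleCat.{v} R → ModuleCat.{v} R → Prop
  | 0, M, N => Nonempty (M ≃ₗ[R] N)
  | n + 1, M, N => ∃ (P : ModuleCat.{v} R) (p : P →ₗ[R] M),
      IsProjectiveCover p ∧ IsSyzygy n (ModuleCat.of R (LinearMap.ker p)) N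

/-- `M` is periodic of period `n`: `n ≥ 1` is the least positive integer with `Ωⁿ(M) ≅ M`. -/
def IsPeriodicOfPeriod (M : ModuleCat.{v} R) (n : ℕ) : Prop :=
  0 < n ∧ IsSyzygy n M M ∧ ∀ j, 0 < j → j < n → ¬ IsSyzygy j M M

end Homological

-- The working objects are the runs `a g(a) g²(a) ⋯` along `g`-orbits. The relation `a f(a) = c_ā
-- A_ā` replaces an `f`-step by a run, an `f`-step after a run of length at least two gives zero,
-- and the full closed runs `B_a`, `B_ā` of lengths `m_a n_a`, `m_ā n_ā` are proportional; longer
-- runs vanish. Hence `P_i` is spanned by the runs starting at `i`, with `B_a` redundant.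
--
-- Independence comes from a symmetrizing form. On words of arrows it is `c_a⁻¹` on `B_a`, `1` on
-- triangles `a f(a) f²(a)`, and `0` otherwise. It is invariant under rotation and respects the
-- relations (`formWord_commutativity`, `formWord_zero_relation`), so it descends to `Λ`. There
-- complementary runs inside `B_a` are dual to each other (`form_comb_mul_left`,
-- `form_comb_mul_right`). It follows that `dim P_i = m_a n_a + m_ā n_ā`, that the radical is the
-- span of the runs of positive length, and that `B_ā` spans the socle of `P_i`.
--
-- In the sequence, `π₁` multiplies by the arrows `a`, `ā`. The columns of `π₂` are the two
-- relations starting at `i`, stripped of their first arrows; `π₃` multiplies by the arrows `f²(a)`,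
-- `f²(ā)` ending at `i`; `S_i → P_i` is multiplication by `B_ā`. The form gives exactness at the
-- last `P_i` (`eq_smul_run_wt`). The heart is exactness at `P_{t(a)} ⊕ P_{t(ā)}`
-- (`mem_range_middle`), and the remaining place follows by counting dimensions.
--
-- The heart reduces to showing that `(f(a) g(f(a)), 0)` lies in the image of `π₂`
-- (`run_two_mem_range_middle`). This is shown unless the orbits of `a`, `ā`, `f(a)`, `f(ā)` all
-- have `m n = 3`. In that case `f` and the bar satisfy the identities of the tetrahedral quiver,
-- which therefore maps onto `Q`. With at least three vertices the map is an isomorphism and all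
-- weights are `1` (`isTetrahedralData_of_wt_eq_three`), which is excluded.
--
-- Periodicity is read off from the resolution, because projective covers are unique. The fourth
-- syzygy is the image of `S_i → P_i`. The first three are not simple, because some arrow acts on
-- them nontrivially.

universe u v

/-! ### Combinatorics of triangulation quivers -/

namespace TriangulationQuiver

variable {V : Type uV} {A : Type uA} (Q : TriangulationQuiver V A)

theorem bar_ne (a : A) : Q.bar a ≠ a := Q.barFun_ne a

theorem s_bar (a : A) : Q.s (Q.bar a) = Q.s a := Q.s_barFun a

@[simp] theorem bar_bar (a : A) : Q.bar (Q.bar a) = a := Q.barFun_involutive a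

theorem eq_or_eq_bar {a b : A} (h : Q.s b = Q.s a) : b = a ∨ b = Q.bar a := Q.eq_or_eq_barFun h

theorem g_apply (a : A) : Q.g a = Q.bar (Q.f a) := rfl

theorem bar_g (a : A) : Q.bar (Q.g a) = Q.f a := Q.bar_bar _

theorem g_ne_f (a : A) : Q.g a ≠ Q.f a := Q.bar_ne _

theorem s_g (a : A) : Q.s (Q.g a) = Q.t a := (Q.s_bar _).trans (Q.s_f a)

theorem g_f_f (a : A) : Q.g (Q.f (Q.f a)) = Q.bar a := by rw [g_apply, Q.f_cube]

theorem t_f_f (a : A) : Q.t (Q.f (Q.f a)) = Q.s a := by rw [← Q.s_f, Q.f_cube]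

theorem bar_f_f (a : A) : Q.bar (Q.f (Q.f a)) = Q.g (Q.f a) := rfl

theorem eq_g_or_eq_f {a b : A} (h : Q.s b = Q.t a) : b = Q.g a ∨ b = Q.f a := by
  rcases Q.eq_or_eq_bar (h.trans (Q.s_g a).symm) with h | h
  · exact Or.inl h
  · exact Or.inr (h.trans (Q.bar_g a))

theorem exists_source (i : V) : ∃ a, Q.s a = i := by
  obtain ⟨x, y, -, h⟩ := Set.ncard_eq_two.1 (Q.two_out i)
  exact ⟨x, (h ▸ Set.mem_insert x {y} : x ∈ {a | Q.s a = i})⟩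

theorem finite_arrows {V : Type uV} {A : Type uA} [Finite V] (Q : TriangulationQuiver V A) :
    Finite A := by
  have h : (Set.univ : Set A) = ⋃ i : V, {a | Q.s a = i} := by ext; simp
  rw [← Set.finite_univ_iff, h]
  exact Set.finite_iUnion fun i => Set.finite_of_ncard_ne_zero (by rw [Q.two_out]; norm_num)

@[simp] theorem orbit_g (a : A) : Q.orbit (Q.g a) = Q.orbit a :=
  Quotient.sound (Equiv.Perm.sameCycle_apply_left.2 (Equiv.Perm.SameCycle.refl _ _))

@[simp] theorem orbit_iterate (k : ℕ) (a : A) : Q.orbit (Q.g^[k] a) = Q.orbit a := by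
  induction k with
  | zero => rfl
  | succ k ih => rw [Function.iterate_succ_apply', orbit_g, ih]

theorem n_eq_of_orbit_eq {a b : A} (h : Q.orbit a = Q.orbit b) : Q.n a = Q.n b := by
  have h : Q.g.SameCycle a b := Quotient.exact h
  unfold n
  congr 1
  ext x
  exact ⟨fun hx => h.symm.trans hx, fun hx => h.trans hx⟩

theorem minimalPeriod_g [Finite A] (a : A) : Function.minimalPeriod Q.g a = Q.n a := by
  classical
  have := Fintype.ofFinite A
  have h := MulAction.minimalPeriod_eq_card Q.g a
  have h2 : MulAction.orbit (Subgroup.zpowers Q.g) a = {b | Q.g.SameCycle a b} := by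
    ext b
    constructor
    · rintro ⟨⟨_, k, rfl⟩, rfl⟩
      exact ⟨k, rfl⟩
    · rintro ⟨k, rfl⟩
      exact ⟨⟨_, k, rfl⟩, rfl⟩
  rw [← Nat.card_eq_fintype_card, h2] at h
  exact h

theorem g_eq_self_of_n_eq_one [Finite A] {a : A} (h : Q.n a = 1) : Q.g a = a := by
  rw [← minimalPeriod_g] at h
  exact Function.minimalPeriod_eq_one_iff_isFixedPt.1 h

/-- The length `m_a n_a` of the closed path `B_a`. -/
noncomputable def wt (m : Q.Orbits → ℕ+) (a : A) : ℕ := m (Q.orbit a) * Q.n a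

variable {Q} (m : Q.Orbits → ℕ+)

theorem wt_eq_of_orbit_eq {a b : A} (h : Q.orbit a = Q.orbit b) : Q.wt m a = Q.wt m b := by
  rw [wt, wt, h, Q.n_eq_of_orbit_eq h]

@[simp] theorem wt_g (a : A) : Q.wt m (Q.g a) = Q.wt m a := wt_eq_of_orbit_eq m (Q.orbit_g a)

@[simp] theorem wt_iterate (k : ℕ) (a : A) : Q.wt m (Q.g^[k] a) = Q.wt m a :=
  wt_eq_of_orbit_eq m (Q.orbit_iterate k a)

theorem orbit_f_f (a : A) : Q.orbit (Q.f (Q.f a)) = Q.orbit (Q.bar a) := by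
  rw [← Q.g_f_f, orbit_g]

@[simp] theorem wt_f_f (a : A) : Q.wt m (Q.f (Q.f a)) = Q.wt m (Q.bar a) :=
  wt_eq_of_orbit_eq m (orbit_f_f a)

theorem iterate_wt [Finite A] (a : A) : Q.g^[Q.wt m a] a = a := by
  refine Function.IsPeriodicPt.iterate (f := Q.g) (n := Q.wt m a) (m := 1) (x := a) ?_ |>.eq
  rw [Function.isPeriodicPt_iff_minimalPeriod_dvd, minimalPeriod_g]
  exact dvd_mul_left _ _

/-- Since `g(f²(ā)) = a`, the arrow `f²(ā)` is the `g`-predecessor of `a`, that is, the last arrow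
of `B_a`. This links the ends of runs with the triangles of `f`. -/
theorem iterate_wt_sub_one [Finite A] (a : A) (h : 3 ≤ Q.wt m a) :
    Q.g^[Q.wt m a - 1] a = Q.f (Q.f (Q.bar a)) := by
  apply Q.g.injective
  rw [← Function.iterate_succ_apply' (f := Q.g), g_f_f, bar_bar]
  conv_rhs => rw [← iterate_wt m a]
  congr 2
  omega

theorem iterate_g_eq [Finite A] (h : ∀ a, 3 ≤ Q.wt m a) (a : A) :
    Q.g^[Q.wt m a - 2] (Q.g a) = Q.f (Q.f (Q.bar a)) := by
  rw [← iterate_wt_sub_one m a (h a), ← Function.iterate_succ_apply]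
  congr 2
  have := h a
  omega

/-- For weight three, `g²(a)` is already the predecessor `f²(ā)` of `a`; apply the bar to both. This
coincidence is what makes weight three exceptional. -/
theorem g_f_bar_eq [Finite A] {a : A} (ha : Q.wt m a = 3) :
    Q.g (Q.f (Q.bar a)) = Q.f (Q.g a) := by
  have h1 := iterate_wt_sub_one m a ha.ge
  rw [ha] at h1
  rw [← Q.bar_f_f, ← h1]
  exact Q.bar_g (Q.g a)

end TriangulationQuiver

/-! ### The symmetrizing form on lists of arrows -/

namespace TriangulationQuiver

variable {K : Type uK} [Field K] {V : Type uV} {A : Type uA} {Q : TriangulationQuiver V A}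
  (m : Q.Orbits → ℕ+) (c : Q.Orbits → Kˣ)

/-- The list of arrows of a closed path `B_a`. -/
def IsGWord (l : List A) : Prop := ∃ a, l = List.iterate Q.g a (Q.wt m a)

variable (Q) in
/-- The list of arrows of a triangle `a f(a) f²(a)`. -/
def IsFWord (l : List A) : Prop := ∃ a, l = [a, Q.f a, Q.f (Q.f a)]

open Classical in
/-- The value of the symmetrizing form on a list of arrows. -/
noncomputable def formWord (l : List A) : K :=
  -- The two values are tied by the relations: `a f(a) f²(a) = c_ā A_ā f²(a) = c_ā B_ā`, so value
  -- `1` on triangles goes with `c_ā⁻¹` on `B_ā`.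
  if h : IsGWord m l then (((c (Q.orbit h.choose))⁻¹ : Kˣ) : K) else if IsFWord Q l then 1 else 0

theorem head_eq_of_iterate_eq {a b : A} {j k : ℕ} (hj : j ≠ 0)
    (h : List.iterate Q.g a j = List.iterate Q.g b k) : a = b ∧ j = k := by
  have hl := congrArg List.length h
  simp only [List.length_iterate] at hl
  subst hl
  obtain ⟨j, rfl⟩ := Nat.exists_eq_succ_of_ne_zero hj
  exact ⟨(List.cons.inj h).1, rfl⟩

theorem formWord_iterate (a : A) (ha : Q.wt m a ≠ 0) :
    formWord m c (List.iterate Q.g a (Q.wt m a)) = (((c (Q.orbit a))⁻¹ : Kˣ) : K) := by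
  have h : IsGWord m (List.iterate Q.g a (Q.wt m a)) := ⟨a, rfl⟩
  rw [formWord, dif_pos h]
  rw [← (head_eq_of_iterate_eq ha h.choose_spec).1]

theorem formWord_triangle (a : A) (h : ∀ a, 3 ≤ Q.wt m a) :
    formWord m c [a, Q.f a, Q.f (Q.f a)] = 1 := by
  rw [formWord, dif_neg, if_pos ⟨a, rfl⟩]
  rintro ⟨b, hb⟩
  obtain ⟨k, hk⟩ := Nat.exists_eq_add_of_le (h b)
  rw [hk, add_comm] at hb
  obtain ⟨rfl, h2⟩ := List.cons.inj hb
  exact Q.g_ne_f _ (List.cons.inj h2).1.symm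

theorem formWord_eq_zero {l : List A} (h1 : ¬ IsGWord m l) (h2 : ¬ IsFWord Q l) :
    formWord m c l = 0 := by
  rw [formWord, dif_neg h1, if_neg h2]

theorem iterate_ne_step {l₁ l₂ : List A} {x y b : A} {k : ℕ} (h : y ≠ Q.g x) :
    List.iterate Q.g b k ≠ l₁ ++ x :: y :: l₂ := by
  induction l₁ generalizing b k with
  | nil =>
    intro h'
    match k, h' with
    | 1, h' => simp at h'
    | k + 2, h' =>
      simp only [List.iterate, List.nil_append, List.cons.injEq] at h'
      exact h (by rw [← h'.1, ← h'.2.1])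
  | cons z l₁ ih =>
    intro h'
    match k, h' with
    | k + 1, h' => exact ih (List.cons.inj h').2

theorem not_isGWord_of_step (l₁ l₂ : List A) {x y : A} (h : y ≠ Q.g x) :
    ¬ IsGWord m (l₁ ++ x :: y :: l₂) := by
  rintro ⟨b, hb⟩
  exact iterate_ne_step h hb.symm

theorem not_isFWord_of_step (l₁ l₂ : List A) {x y : A} (h : y ≠ Q.f x) :
    ¬ IsFWord Q (l₁ ++ x :: y :: l₂) := by
  rintro ⟨b, hb⟩
  match l₁, hb with
  | [], hb =>
    simp only [List.nil_append, List.cons.injEq] at hb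
    exact h (by rw [hb.1, hb.2.1])
  | [_], hb =>
    simp only [List.cons_append, List.nil_append, List.cons.injEq] at hb
    exact h (by rw [hb.2.1, hb.2.2.1])
  | _ :: _ :: l, hb =>
    have := congrArg List.length hb
    simp at this
    omega

theorem isFWord_rotate {x : A} {l : List A} : IsFWord Q (x :: l) ↔ IsFWord Q (l ++ [x]) := by
  constructor
  · rintro ⟨a, h⟩
    obtain ⟨rfl, rfl⟩ := List.cons.inj h
    exact ⟨Q.f x, by simp [Q.f_cube]⟩
  · rintro ⟨a, h⟩
    have h' : l ++ [x] = [a, Q.f a] ++ [Q.f (Q.f a)] := h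
    obtain ⟨rfl, h3⟩ := List.append_inj' h' rfl
    obtain rfl := (List.cons.inj h3).1
    exact ⟨Q.f (Q.f a), by simp [Q.f_cube]⟩

/-- A word with an `f`-step followed by a `g`-step is neither a run nor a triangle. -/
theorem formWord_zero_relation (a : A) (l₁ l₂ : List A) :
    formWord m c (l₁ ++ [a, Q.f a, Q.g (Q.f a)] ++ l₂) = 0 := by
  rw [List.append_assoc]
  refine formWord_eq_zero m c (not_isGWord_of_step m l₁ _ (Q.g_ne_f a).symm) ?_
  have := not_isFWord_of_step (l₁ ++ [a]) l₂ (Q.g_ne_f (Q.f a))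
  simpa using this

/-- Pairing of runs along `g`-orbits: the diagonal terms. -/
theorem formWord_run_self (a : A) (h : ∀ a, 3 ≤ Q.wt m a) {k : ℕ} (hk : k ≤ Q.wt m a) :
    formWord m c (List.iterate Q.g a k ++ List.iterate Q.g (Q.g^[k] a) (Q.wt m a - k)) =
      (((c (Q.orbit a))⁻¹ : Kˣ) : K) := by
  rw [← List.iterate_add, Nat.add_sub_cancel' hk, formWord_iterate _ _ _ (by linarith [h a])]

theorem not_isFWord_run (a b : A) (j k : ℕ) :
    ¬ IsFWord Q (List.iterate Q.g b j ++ List.iterate Q.g a k) := by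
  intro h'
  have hlen : j + k = 3 := by
    obtain ⟨x, hx⟩ := h'
    have := congrArg List.length hx
    simpa using this
  by_cases hj : 2 ≤ j
  · obtain ⟨j, rfl⟩ := Nat.exists_eq_add_of_le' hj
    exact not_isFWord_of_step [] _ (Q.g_ne_f b) h'
  · obtain ⟨k, rfl⟩ := Nat.exists_eq_add_of_le' (show 2 ≤ k by omega)
    exact not_isFWord_of_step _ _ (Q.g_ne_f _) h'

/-- Pairing of runs along `g`-orbits: the off-diagonal terms. -/
theorem formWord_run_eq_zero (a b : A) (h : ∀ a, 3 ≤ Q.wt m a) {j k : ℕ}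
    (hk : k ≤ Q.wt m a) (hne : ¬ (a = b ∧ j = k)) (h0 : ¬ (j = 0 ∧ k = 0))
    (hjk : j < Q.wt m b ∨ k < Q.wt m a) :
    formWord m c (List.iterate Q.g b j ++ List.iterate Q.g (Q.g^[k] a) (Q.wt m a - k)) = 0 := by
  -- `h0` and `hjk` exclude the words that are all of `B_a` or all of `B_b`, where the form is
  -- nonzero even for `a ≠ b`.
  refine formWord_eq_zero m c ?_ (not_isFWord_run _ _ _ _)
  rintro ⟨d, hd⟩
  have hlen := congrArg List.length hd
  simp only [List.length_append, List.length_iterate] at hlen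
  have hd0 := h d
  rcases Nat.eq_zero_or_pos j with rfl | hj
  · have h1 := head_eq_of_iterate_eq (a := Q.g^[k] a) (b := d) (j := Q.wt m a - k)
      (k := Q.wt m d) (by omega) hd
    have h2 := h1.2
    rw [← h1.1, wt_iterate] at h2
    omega
  · have hbd : b = d := by
      obtain ⟨j, rfl⟩ := Nat.exists_eq_add_of_le' hj
      obtain ⟨i, hi⟩ := Nat.exists_eq_add_of_le' hd0
      rw [hi] at hd
      exact (List.cons.inj hd).1
    subst hbd
    have hka : k < Q.wt m a := by omega
    rw [← hlen, List.iterate_add] at hd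
    have h1 := head_eq_of_iterate_eq (by omega) (List.append_cancel_left hd)
    have h2 := congrArg (Q.wt m) h1.1
    rw [wt_iterate, wt_iterate] at h2
    have hjk : j = k := by omega
    subst hjk
    exact hne ⟨(Q.g.injective.iterate j) h1.1, rfl⟩

variable [Finite A]

theorem iterate_rotate {x : A} (hx : 3 ≤ Q.wt m x) {l : List A}
    (h : x :: l = List.iterate Q.g x (Q.wt m x)) :
    l ++ [x] = List.iterate Q.g (Q.g x) (Q.wt m (Q.g x)) := by
  obtain ⟨k, hk⟩ := Nat.exists_eq_add_of_le' (show 1 ≤ Q.wt m x by omega)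
  rw [wt_g, hk, List.iterate_add]
  rw [hk] at h
  rw [(List.cons.inj h).2]
  congr 1
  have := iterate_wt m x
  rw [hk] at this
  simpa [List.iterate] using this.symm

theorem iterate_rotate_symm {x y : A} (hx : 3 ≤ Q.wt m x) {l : List A}
    (h : l ++ [y] = List.iterate Q.g x (Q.wt m x)) :
    x = Q.g y ∧ y :: l = List.iterate Q.g y (Q.wt m y) := by
  obtain ⟨k, hk⟩ := Nat.exists_eq_add_of_le' (show 1 ≤ Q.wt m x by omega)
  rw [hk, List.iterate_add] at h
  obtain ⟨rfl, h2⟩ := List.append_inj' h rfl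
  have h3 : y = Q.g^[k] x := by simpa [List.iterate] using h2
  have h4 : Q.g y = x := by
    have := iterate_wt m x
    rwa [hk, Function.iterate_succ_apply', ← h3] at this
  refine ⟨h4.symm, ?_⟩
  rw [← h4, wt_g] at hk
  rw [hk, List.iterate, h4]

/-- Both the closed runs and the triangles are stable under rotation, and `c` is constant on
`g`-orbits. This is the source of the symmetry of the form. -/
theorem formWord_rotate (h : ∀ a, 3 ≤ Q.wt m a) (x : A) (l : List A) :
    formWord m c (x :: l) = formWord m c (l ++ [x]) := by
  by_cases h1 : IsGWord m (x :: l)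
  · obtain ⟨a, ha⟩ := h1
    have hxa : a = x := by
      obtain ⟨k, hk⟩ := Nat.exists_eq_add_of_le' (show 1 ≤ Q.wt m a from by linarith [h a])
      rw [hk] at ha
      exact (List.cons.inj ha).1.symm
    subst hxa
    rw [iterate_rotate m (h a) ha, formWord_iterate _ _ _ (by linarith [h (Q.g a)]), ha,
      formWord_iterate _ _ _ (by linarith [h a]), orbit_g]
  · have h2 : ¬ IsGWord m (l ++ [x]) := by
      rintro ⟨a, ha⟩
      exact h1 ⟨x, (iterate_rotate_symm m (h a) ha).2⟩
    by_cases h3 : IsFWord Q (x :: l)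
    · rw [formWord, formWord, dif_neg h1, dif_neg h2, if_pos h3, if_pos (isFWord_rotate.1 h3)]
    · rw [formWord_eq_zero m c h1 h3,
        formWord_eq_zero m c h2 (fun h' => h3 (isFWord_rotate.2 h'))]

theorem formWord_append_comm (h : ∀ a, 3 ≤ Q.wt m a) (l₁ l₂ : List A) :
    formWord m c (l₁ ++ l₂) = formWord m c (l₂ ++ l₁) := by
  induction l₁ generalizing l₂ with
  | nil => simp
  | cons x l₁ ih =>
    rw [List.cons_append, formWord_rotate m c h, List.append_assoc, ih, List.append_assoc]
    rfl

/-- The form respects the relations `a f(a) = c_ā A_ā`. -/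
theorem formWord_commutativity (h : ∀ a, 3 ≤ Q.wt m a) (a : A) (l₁ l₂ : List A) :
    formWord m c (l₁ ++ [a, Q.f a] ++ l₂) = (c (Q.orbit (Q.bar a)) : K) *
      formWord m c (l₁ ++ List.iterate Q.g (Q.bar a) (Q.wt m (Q.bar a) - 1) ++ l₂) := by
  -- Rotation moves `l₁` behind `l₂`, so only words beginning with the two sides of the relation
  -- have to be compared.
  rw [List.append_assoc, List.append_assoc, formWord_append_comm m c h l₁,
    formWord_append_comm m c h l₁, List.append_assoc, List.append_assoc]
  generalize l₂ ++ l₁ = l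
  obtain ⟨k, hk⟩ := Nat.exists_eq_add_of_le' (h (Q.bar a))
  have hfg : Q.f a ≠ Q.g a := (Q.g_ne_f a).symm
  have hw : List.iterate Q.g (Q.bar a) (Q.wt m (Q.bar a) - 1) =
      Q.bar a :: Q.g (Q.bar a) :: List.iterate Q.g (Q.g (Q.g (Q.bar a))) k := by
    rw [hk]; rfl
  -- The only continuation with nonzero value is `f²(a)`: it completes `a f(a)` to a triangle and
  -- `A_ā` to `B_ā`.
  by_cases hl : l = [Q.f (Q.f a)]
  · have h2 : List.iterate Q.g (Q.bar a) (Q.wt m (Q.bar a) - 1) ++ l =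
        List.iterate Q.g (Q.bar a) (Q.wt m (Q.bar a)) := by
      conv_rhs => rw [show Q.wt m (Q.bar a) = Q.wt m (Q.bar a) - 1 + 1 by omega, List.iterate_add]
      rw [iterate_wt_sub_one m _ (h _), hl, bar_bar]
      rfl
    rw [h2, formWord_iterate _ _ _ (by omega), hl]
    have := formWord_triangle m c a h
    simp only [List.cons_append, List.nil_append]
    rw [this]
    simp
  · rw [formWord_eq_zero, formWord_eq_zero, mul_zero]
    · rintro ⟨b, hb⟩
      have hb0 := h b
      have hba : Q.bar a = b := by
        obtain ⟨j, hj⟩ := Nat.exists_eq_add_of_le' hb0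
        rw [hw, hj] at hb
        exact (List.cons.inj hb).1
      subst hba
      rw [show Q.wt m (Q.bar a) = Q.wt m (Q.bar a) - 1 + 1 by omega, List.iterate_add,
        Nat.add_sub_cancel, iterate_wt_sub_one m _ (h _), bar_bar] at hb
      exact hl (List.append_cancel_left hb)
    · rw [hw]
      exact not_isFWord_of_step [] _ (Q.g_ne_f _)
    · exact not_isGWord_of_step m [] l hfg
    · rintro ⟨b, hb⟩
      simp only [List.cons_append, List.nil_append, List.cons.injEq] at hb
      obtain ⟨rfl, -, rfl⟩ := hb
      exact hl rfl

end TriangulationQuiver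

/-! ### Runs along `g`-orbits and the symmetrizing form of a weighted triangulation algebra -/

namespace PathAlgebra

variable {K : Type uK} [Field K] {V : Type uV} {A : Type uA} (Q : TriangulationQuiver V A)

theorem isWalk_iterate (a : A) (k : ℕ) : Q.IsWalk (Q.s a) (List.iterate Q.g a k) := by
  induction k generalizing a with
  | zero => trivial
  | succ k ih => exact ⟨rfl, Q.s_g a ▸ ih (Q.g a)⟩

/-- The path `a g(a) g²(a) ⋯` of length `k`. -/
noncomputable def runPath (a : A) (k : ℕ) : Q.toQuiverData.QPath :=
  ⟨Q.s a, List.iterate Q.g a k, isWalk_iterate Q a k⟩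

theorem tgt_runPath (a : A) (k : ℕ) : (runPath Q a k).tgt = Q.s (Q.g^[k] a) := by
  change Q.endpoint (Q.s a) (List.iterate Q.g a k) = _
  induction k generalizing a with
  | zero => rfl
  | succ k ih =>
    rw [Function.iterate_succ_apply, ← ih]
    change Q.endpoint (Q.t a) _ = _
    rw [← Q.s_g]

variable (K)

theorem prod_iterate [Fintype V] (a : A) (k : ℕ) :
    ((List.iterate Q.g a (k + 1)).map (arrow K Q.toQuiverData)).prod =
      ofPath K _ (runPath Q a (k + 1)) := by
  induction k generalizing a with
  | zero => simp only [List.iterate, List.map_cons, List.map_nil, List.prod_cons, List.prod_nil,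
      mul_one]; rfl
  | succ k ih =>
    rw [List.iterate, List.map_cons, List.prod_cons, ih]
    exact ofPath_mul_of_eq K _ (Q.arrowPath a) (runPath Q (Q.g a) (k + 1)) (Q.s_g a).symm

variable {Q} (m : Q.Orbits → ℕ+) (c : Q.Orbits → Kˣ)

/-- The symmetrizing form on the path algebra. -/
noncomputable def preForm : PathAlgebra K Q.toQuiverData →ₗ[K] K :=
  extend K _ fun p => TriangulationQuiver.formWord m c p.arrows

theorem preForm_ofPath (p : Q.toQuiverData.QPath) :
    preForm K m c (ofPath K _ p) = TriangulationQuiver.formWord m c p.arrows :=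
  extend_ofPath K _ _ p

/-- The form lives on closed walks. This settles the symmetry of the form when only one of the
products `pq`, `qp` of two paths exists. -/
theorem endpoint_eq_of_formWord_ne_zero [Finite A] {i : V} {l : List A}
    (hl : Q.IsWalk i l) (hne : TriangulationQuiver.formWord m c l ≠ 0) : Q.endpoint i l = i := by
  by_cases h1 : TriangulationQuiver.IsGWord m l
  · obtain ⟨a, rfl⟩ := h1
    generalize hk : Q.wt m a = k at *
    match k with
    | 0 => rfl
    | k + 1 =>
      obtain rfl := hl.1
      have := tgt_runPath Q a (Q.wt m a)
      rw [TriangulationQuiver.iterate_wt, hk] at this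
      exact this
  · by_cases h2 : TriangulationQuiver.IsFWord Q l
    · obtain ⟨a, rfl⟩ := h2
      obtain rfl := hl.1
      exact Q.t_f_f a
    · exact absurd (TriangulationQuiver.formWord_eq_zero m c h1 h2) hne

variable [Fintype V]

/-- Every defining relation has the shape `r - κ r'` with parallel paths, so vanishing on the
generated ideal reduces to an identity between words. -/
theorem preForm_eq_zero_of_parallel {r r' : Q.toQuiverData.QPath} (κ : K) (hs : r.src = r'.src)
    (ht : r.tgt = r'.tgt)
    (h : ∀ l₁ l₂, TriangulationQuiver.formWord m c (l₁ ++ r.arrows ++ l₂) =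
      κ * TriangulationQuiver.formWord m c (l₁ ++ r'.arrows ++ l₂))
    (u v : PathAlgebra K Q.toQuiverData) :
    preForm K m c (u * (ofPath K _ r - κ • ofPath K _ r') * v) = 0 := by
  induction u using path_induction with
  | zero => simp
  | add x y hx hy => rw [add_mul, add_mul, map_add, hx, hy, add_zero]
  | smul k x hx => rw [smul_mul_assoc, smul_mul_assoc, map_smul, hx, smul_zero]
  | ofPath p =>
    induction v using path_induction with
    | zero => simp
    | add x y hx hy => rw [mul_add, map_add, hx, hy, add_zero]
    | smul k x hx => rw [mul_smul_comm, map_smul, hx, smul_zero]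
    | ofPath q =>
      rw [mul_sub, sub_mul, mul_smul_comm, smul_mul_assoc, map_sub, map_smul, sub_eq_zero]
      by_cases h1 : p.tgt = r.src
      · by_cases h2 : r.tgt = q.src
        · rw [ofPath_mul_of_eq K _ p r h1, ofPath_mul_of_eq K _ p r' (h1.trans hs),
            ofPath_mul_of_eq K _ _ q ((p.tgt_comp r h1).trans h2),
            ofPath_mul_of_eq K _ _ q ((p.tgt_comp r' _).trans (ht.symm.trans h2)),
            preForm_ofPath, preForm_ofPath]
          exact h _ _
        · rw [mul_assoc, mul_assoc, ofPath_mul_of_ne K _ r q h2,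
            ofPath_mul_of_ne K _ r' q (fun h' => h2 (ht.trans h'))]
          simp
      · rw [ofPath_mul_of_ne K _ p r h1, ofPath_mul_of_ne K _ p r' (fun h' => h1 (h'.trans hs.symm))]
        simp

variable [Finite A]

theorem preForm_eq_zero_of_mem_relations (h : ∀ a, 3 ≤ Q.wt m a)
    {x : PathAlgebra K Q.toQuiverData} (hx : x ∈ relations Q m c)
    (u v : PathAlgebra K Q.toQuiverData) : preForm K m c (u * x * v) = 0 := by
  rcases hx with ⟨a, rfl⟩ | ⟨a, rfl⟩
  · obtain ⟨k, hk⟩ := Nat.exists_eq_add_of_le' (h (Q.bar a))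
    have h1 : arrow K Q.toQuiverData a * arrow K _ (Q.f a) =
        ofPath K _ ((Q.arrowPath a).comp (Q.arrowPath (Q.f a)) (Q.s_f a).symm) :=
      ofPath_mul_of_eq K _ _ _ _
    have h2 : pathA K Q m (Q.bar a) = ofPath K _ (runPath Q (Q.bar a) (Q.wt m (Q.bar a) - 1)) := by
      have := prod_iterate K Q (Q.bar a) (k + 1)
      rwa [show k + 1 + 1 = Q.wt m (Q.bar a) - 1 by omega] at this
    rw [h1, h2]
    refine preForm_eq_zero_of_parallel K m c _ (Q.s_bar a).symm ?_
      (fun l₁ l₂ => TriangulationQuiver.formWord_commutativity m c h a l₁ l₂) u v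
    refine (QuiverData.QPath.tgt_comp _ _ _).trans (Eq.trans ?_ (tgt_runPath Q _ _).symm)
    rw [TriangulationQuiver.iterate_wt_sub_one m _ (h _), Q.bar_bar, Q.s_f]
    rfl
  · have h1 : arrow K Q.toQuiverData a * arrow K _ (Q.f a) =
        ofPath K _ ((Q.arrowPath a).comp (Q.arrowPath (Q.f a)) (Q.s_f a).symm) :=
      ofPath_mul_of_eq K _ _ _ _
    have ht : ((Q.arrowPath a).comp (Q.arrowPath (Q.f a)) (Q.s_f a).symm).tgt =
        (Q.arrowPath (Q.g (Q.f a))).src :=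
      (QuiverData.QPath.tgt_comp _ _ _).trans (Q.s_g _).symm
    have h2 : arrow K Q.toQuiverData a * arrow K _ (Q.f a) * arrow K _ (Q.g (Q.f a)) =
        ofPath K _ (((Q.arrowPath a).comp (Q.arrowPath (Q.f a)) (Q.s_f a).symm).comp
          (Q.arrowPath (Q.g (Q.f a))) ht) := by
      rw [h1]
      exact ofPath_mul_of_eq K _ _ _ _
    -- A zero relation is the case `κ = 0`, with the path itself as its own partner.
    have h3 := preForm_eq_zero_of_parallel K m c 0 (r := ((Q.arrowPath a).comp
      (Q.arrowPath (Q.f a)) (Q.s_f a).symm).comp (Q.arrowPath (Q.g (Q.f a))) ht) rfl rfl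
      (fun l₁ l₂ => by
        rw [zero_mul]
        exact TriangulationQuiver.formWord_zero_relation m c a l₁ l₂) u v
    rwa [zero_smul, sub_zero, ← h2] at h3

theorem preForm_eq_zero_of_mem_span (h : ∀ a, 3 ≤ Q.wt m a)
    {x : PathAlgebra K Q.toQuiverData} (hx : x ∈ TwoSidedIdeal.span (relations Q m c)) :
    preForm K m c x = 0 := by
  -- The elements `x` with `preForm (u * x * v) = 0` for all `u`, `v` form a two-sided ideal, so it
  -- is enough that this ideal contains the generators.
  let J : TwoSidedIdeal (PathAlgebra K Q.toQuiverData) := TwoSidedIdeal.mk'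
    {x | ∀ u v, preForm K m c (u * x * v) = 0} (fun u v => by simp)
    (fun {x y} hx hy u v => by rw [mul_add, add_mul, map_add, hx, hy, add_zero])
    (fun {x} hx u v => by rw [mul_neg, neg_mul, map_neg, hx, neg_zero])
    (fun {x y} hy u v => by rw [← mul_assoc]; exact hy _ _)
    (fun {x y} hx u v => by rw [← mul_assoc, mul_assoc _ y]; exact hx _ _)
  have hJ : TwoSidedIdeal.span (relations Q m c) ≤ J := by
    rw [TwoSidedIdeal.span_le]
    intro y hy
    rw [SetLike.mem_coe, TwoSidedIdeal.mem_mk']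
    exact preForm_eq_zero_of_mem_relations K m c h hy
  have h1 := hJ hx
  rw [TwoSidedIdeal.mem_mk'] at h1
  simpa using h1 1 1

end PathAlgebra

/-! ### Residue classes of runs in `Λ`. -/

namespace WTAlgebra

open PathAlgebra TriangulationQuiver

variable {K : Type uK} [Field K] {V : Type uV} {A : Type uA} [Fintype V]
  {Q : TriangulationQuiver V A} (m : Q.Orbits → ℕ+) (c : Q.Orbits → Kˣ)

theorem mk_surjective : Function.Surjective (mk Q m c) :=
  RingCon.mk'_surjective _

theorem mk_eq_mk {x y : PathAlgebra K Q.toQuiverData} :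
    mk Q m c x = mk Q m c y ↔ x - y ∈ TwoSidedIdeal.span (relations Q m c) := by
  rw [← TwoSidedIdeal.rel_iff]
  exact RingCon.eq _

/-- The residue class of the path `a g(a) g²(a) ⋯` of length `k`. -/
noncomputable def run (a : A) (k : ℕ) : WTAlgebra Q m c := mk Q m c (ofPath K _ (runPath Q a k))

theorem run_zero (a : A) : run m c a 0 = e Q m c (Q.s a) := rfl

theorem run_mul_run (a : A) (j k : ℕ) :
    run m c a j * run m c (Q.g^[j] a) k = run m c a (j + k) := by
  rw [run, run, ← map_mul, ofPath_mul_of_eq K _ _ _ (tgt_runPath Q a j), run]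
  congr 2
  exact QuiverData.QPath.ext rfl (List.iterate_add _ _ _ _).symm

theorem run_mul_run_of_eq {a b : A} {j : ℕ} (k : ℕ) (h : b = Q.g^[j] a) :
    run m c a j * run m c b k = run m c a (j + k) := by
  rw [h, run_mul_run]

theorem run_one_mul_run (a : A) (k : ℕ) :
    run m c a 1 * run m c (Q.g a) k = run m c a (k + 1) := by
  rw [run_mul_run_of_eq m c k (show Q.g a = Q.g^[1] a from rfl), add_comm]

theorem run_mul_run_of_ne {a b : A} {j k : ℕ} (h : Q.s b ≠ Q.s (Q.g^[j] a)) :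
    run m c a j * run m c b k = 0 := by
  rw [run, run, ← map_mul, ofPath_mul_of_ne K _ _ _ (fun h' => h ?_), map_zero]
  rw [← tgt_runPath, h']; rfl

theorem e_mul_run (a : A) (k : ℕ) : e Q m c (Q.s a) * run m c a k = run m c a k := by
  rw [← run_zero, run_mul_run_of_eq m c k (show a = Q.g^[0] a from rfl), zero_add]

theorem e_mul_run_of_eq {a : A} {i : V} (h : Q.s a = i) (k : ℕ) :
    e Q m c i * run m c a k = run m c a k := by
  rw [← h, e_mul_run]

theorem run_mul_e_of_eq {a : A} {i : V} {k : ℕ} (h : Q.s (Q.g^[k] a) = i) :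
    run m c a k * e Q m c i = run m c a k := by
  rw [← h, ← run_zero, run_mul_run, add_zero]

theorem run_one_mul_e (a : A) : run m c a 1 * e Q m c (Q.t a) = run m c a 1 :=
  run_mul_e_of_eq m c (Q.s_g a)

theorem e_mul_e (i : V) : e Q m c i * e Q m c i = e Q m c i := by
  obtain ⟨a, rfl⟩ := Q.exists_source i
  rw [← run_zero, run_mul_run_of_eq m c 0 (show a = Q.g^[0] a from rfl)]

theorem sum_e : ∑ i, e Q m c i = 1 := by
  rw [← map_one (mk Q m c)]
  exact (map_sum (mk Q m c) _ _).symm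

/-- The relation `a f(a) = c_ā A_ā`. -/
theorem run_mul_f (h : ∀ a, 3 ≤ Q.wt m a) (a : A) : run m c a 1 * run m c (Q.f a) 1 =
    (c (Q.orbit (Q.bar a)) : K) • run m c (Q.bar a) (Q.wt m (Q.bar a) - 1) := by
  obtain ⟨k, hk⟩ := Nat.exists_eq_add_of_le' (h (Q.bar a))
  have h2 : pathA K Q m (Q.bar a) = ofPath K _ (runPath Q (Q.bar a) (Q.wt m (Q.bar a) - 1)) := by
    have := prod_iterate K Q (Q.bar a) (k + 1)
    rwa [show k + 1 + 1 = Q.wt m (Q.bar a) - 1 by omega] at this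
  rw [run, run, run, ← h2, ← map_mul, ← map_smul, mk_eq_mk]
  exact TwoSidedIdeal.subset_span (Or.inl ⟨a, rfl⟩)

theorem run_mul_f_mul_g (a : A) :
    run m c a 1 * run m c (Q.f a) 1 * run m c (Q.g (Q.f a)) 1 = 0 := by
  rw [run, run, run, ← map_mul, ← map_mul, ← map_zero (mk Q m c), mk_eq_mk, sub_zero]
  exact TwoSidedIdeal.subset_span (Or.inr ⟨a, rfl⟩)

end WTAlgebra

namespace WTAlgebra

open PathAlgebra TriangulationQuiver

variable {K : Type uK} [Field K] {V : Type uV} {A : Type uA} [Fintype V]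
  {Q : TriangulationQuiver V A} (m : Q.Orbits → ℕ+) (c : Q.Orbits → Kˣ)

/-! ### Multiplication of runs -/

theorem run_one_mul_run_f (a : A) (k : ℕ) : run m c a 1 * run m c (Q.f a) (k + 2) = 0 := by
  rw [← run_one_mul_run m c (Q.f a) (k + 1), ← run_one_mul_run m c (Q.g (Q.f a)) k, ← mul_assoc,
    ← mul_assoc, run_mul_f_mul_g, zero_mul]

/-- This is the mirror image `x g(x) f(g(x)) = 0` of the zero relations. The product `g(x) f(g(x))`
is a multiple of `A_{f(x)}`, whose length is at least two because the weights are at least three,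
and `x f(x) g(f(x)) = 0`. -/
theorem run_add_two_mul_f (h : ∀ a, 3 ≤ Q.wt m a) (a : A) (k : ℕ) :
    run m c a (k + 2) * run m c (Q.f (Q.g^[k + 1] a)) 1 = 0 := by
  obtain ⟨j, hj⟩ := Nat.exists_eq_add_of_le' (h (Q.f (Q.g^[k] a)))
  rw [← run_mul_run m c a k 2, ← run_one_mul_run m c _ 1, Function.iterate_succ_apply', mul_assoc,
    mul_assoc, run_mul_f m c h, bar_g, hj, show j + 3 - 1 = j + 2 by omega, mul_smul_comm,
    run_one_mul_run_f, smul_zero, mul_zero]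

theorem run_mul_f_eq_zero (h : ∀ a, 3 ≤ Q.wt m a) {a b : A} {k : ℕ} (hk : 2 ≤ k)
    (hb : b = Q.f (Q.g^[k - 1] a)) : run m c a k * run m c b 1 = 0 := by
  obtain ⟨k, rfl⟩ := Nat.exists_eq_add_of_le' hk
  rw [hb]
  exact run_add_two_mul_f m c h a k

/-- Both sides are `a f(a) f²(a)`, evaluated with the two possible bracketings. -/
theorem smul_run_wt [Finite A] (h : ∀ a, 3 ≤ Q.wt m a) (a : A) :
    (c (Q.orbit a) : K) • run m c a (Q.wt m a) =
      (c (Q.orbit (Q.bar a)) : K) • run m c (Q.bar a) (Q.wt m (Q.bar a)) := by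
  have h1 : run m c a 1 * run m c (Q.f a) 1 * run m c (Q.f (Q.f a)) 1 =
      (c (Q.orbit (Q.bar a)) : K) • run m c (Q.bar a) (Q.wt m (Q.bar a)) := by
    rw [run_mul_f m c h, smul_mul_assoc, run_mul_run_of_eq, Nat.sub_add_cancel]
    · linarith [h (Q.bar a)]
    · rw [iterate_wt_sub_one m _ (h _), bar_bar]
  rw [← h1, mul_assoc, run_mul_f m c h, ← g_apply, orbit_g, wt_g, mul_smul_comm, run_one_mul_run,
    Nat.sub_add_cancel]
  linarith [h a]

theorem run_wt_eq [Finite A] (h : ∀ a, 3 ≤ Q.wt m a) (a : A) :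
    run m c a (Q.wt m a) = (((c (Q.orbit a))⁻¹ : Kˣ) * c (Q.orbit (Q.bar a)) : K) •
      run m c (Q.bar a) (Q.wt m (Q.bar a)) := by
  rw [mul_smul, ← smul_run_wt m c h, smul_smul, Units.inv_mul, one_smul]

/-- The product `B_a a` is a multiple of `B_ā a`, and `B_ā` ends in `f²(a)`, so the last arrow `a`
is an `f`-step after a long run. -/
theorem run_eq_zero [Finite A] (h : ∀ a, 3 ≤ Q.wt m a) (a : A) {k : ℕ} (hk : Q.wt m a < k) :
    run m c a k = 0 := by
  obtain ⟨k, rfl⟩ := Nat.exists_eq_add_of_le hk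
  have h1 : run m c a (Q.wt m a) * run m c a 1 = 0 := by
    rw [run_wt_eq m c h, smul_mul_assoc, run_mul_f_eq_zero m c h, smul_zero]
    · linarith [h (Q.bar a)]
    · rw [iterate_wt_sub_one m _ (h _), bar_bar, f_cube]
  have h2 : run m c a (Q.wt m a) * run m c a 1 = run m c a (Q.wt m a + 1) :=
    run_mul_run_of_eq m c _ (iterate_wt m a).symm
  rw [Nat.succ_eq_add_one, ← run_mul_run, ← h2, h1, zero_mul]

/-- A `g`-step prolongs the run. An `f`-step after one arrow gives a multiple of `A_b̄`, of length
at least two, and after two or more arrows it gives zero. Hence the runs span `Λ` and length filters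
it multiplicatively. -/
theorem exists_run_mul_arrow (h : ∀ a, 3 ≤ Q.wt m a) (b : A) (k : ℕ) (d : A) :
    ∃ (b' : A) (k' : ℕ) (κ : K), Q.s b' = Q.s b ∧ k + 1 ≤ k' ∧
      run m c b k * run m c d 1 = κ • run m c b' k' := by
  by_cases hd : Q.s d = Q.s (Q.g^[k] b)
  · match k, hd with
    | 0, hd =>
      refine ⟨d, 1, 1, hd, le_rfl, ?_⟩
      rw [run_zero, one_smul]
      exact e_mul_run_of_eq m c hd 1
    | 1, hd =>
      rcases Q.eq_g_or_eq_f (hd.trans (Q.s_g b)) with rfl | rfl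
      · exact ⟨b, 2, 1, rfl, le_rfl, by rw [run_one_mul_run, one_smul]⟩
      · exact ⟨Q.bar b, Q.wt m (Q.bar b) - 1, c (Q.orbit (Q.bar b)), Q.s_bar b,
          by have := h (Q.bar b); omega, run_mul_f m c h b⟩
    | k + 2, hd =>
      rw [Function.iterate_succ_apply', s_g] at hd
      rcases Q.eq_g_or_eq_f hd with rfl | rfl
      · refine ⟨b, k + 2 + 1, 1, rfl, le_rfl, ?_⟩
        rw [← Function.iterate_succ_apply' (f := Q.g), run_mul_run, one_smul]
      · exact ⟨b, k + 3, 0, rfl, le_rfl, by rw [run_add_two_mul_f m c h, zero_smul]⟩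
  -- The product is zero, so any run of admissible length serves with coefficient `0`.
  · exact ⟨b, k + 1, 0, rfl, le_rfl, by rw [run_mul_run_of_ne m c hd, zero_smul]⟩

theorem exists_run_mul_run (h : ∀ a, 3 ≤ Q.wt m a) (b : A) (k : ℕ) (d : A) (l : ℕ) :
    ∃ (b' : A) (k' : ℕ) (κ : K), Q.s b' = Q.s b ∧ k + l ≤ k' ∧
      run m c b k * run m c d l = κ • run m c b' k' := by
  induction l with
  | zero =>
    by_cases hd : Q.s d = Q.s (Q.g^[k] b)
    · exact ⟨b, k, 1, rfl, le_rfl, by rw [run_zero, one_smul, run_mul_e_of_eq m c hd.symm]⟩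
    · exact ⟨b, k, 0, rfl, le_rfl, by rw [run_mul_run_of_ne m c hd, zero_smul]⟩
  | succ l ih =>
    obtain ⟨b', k', κ, hs, hk, he⟩ := ih
    obtain ⟨b'', k'', κ', hs', hk', he'⟩ := exists_run_mul_arrow m c h b' k' (Q.g^[l] d)
    refine ⟨b'', k'', κ * κ', hs'.trans hs, by omega, ?_⟩
    rw [← run_mul_run, ← mul_assoc, he, smul_mul_assoc, he', smul_smul]

/-! ### The arrow filtration -/

/-- The span of the runs of length at least `n`. -/
noncomputable def arrowFiltration (n : ℕ) : Submodule K (WTAlgebra Q m c) :=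
  Submodule.span K {x | ∃ b k, n ≤ k ∧ x = run m c b k}

variable {m c} in
theorem run_mem_arrowFiltration {n k : ℕ} (b : A) (hk : n ≤ k) :
    run m c b k ∈ arrowFiltration m c n :=
  Submodule.subset_span ⟨b, k, hk, rfl⟩

theorem arrowFiltration_antitone {n k : ℕ} (hk : n ≤ k) :
    arrowFiltration m c k ≤ arrowFiltration m c n :=
  Submodule.span_mono fun _ ⟨b, j, hj, hx⟩ => ⟨b, j, hk.trans hj, hx⟩

variable {m c} in
theorem mul_mem_arrowFiltration (h : ∀ a, 3 ≤ Q.wt m a) {n k : ℕ} {x y : WTAlgebra Q m c}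
    (hx : x ∈ arrowFiltration m c n) (hy : y ∈ arrowFiltration m c k) :
    x * y ∈ arrowFiltration m c (n + k) := by
  have h1 := Submodule.mul_mem_mul hx hy
  rw [arrowFiltration, arrowFiltration, Submodule.span_mul_span] at h1
  refine Submodule.span_le.2 ?_ h1
  rintro _ ⟨_, ⟨b, j, hj, rfl⟩, _, ⟨d, l, hl, rfl⟩, rfl⟩
  obtain ⟨b', k', κ, -, hk', he⟩ := exists_run_mul_run m c h b j d l
  change run m c b j * run m c d l ∈ _
  rw [he]
  exact Submodule.smul_mem _ _ (run_mem_arrowFiltration b' (by omega))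

theorem arrowFiltration_zero (h : ∀ a, 3 ≤ Q.wt m a) : arrowFiltration m c 0 = ⊤ := by
  rw [eq_top_iff]
  rintro x -
  obtain ⟨x, rfl⟩ := mk_surjective m c x
  induction x using path_induction with
  | zero => rw [map_zero]; exact zero_mem _
  | add x y hx hy => rw [map_add]; exact add_mem hx hy
  | smul r x hx => rw [map_smul]; exact Submodule.smul_mem _ _ hx
  | ofPath p =>
    obtain ⟨i, l, hl⟩ := p
    induction l generalizing i with
    | nil =>
      obtain ⟨a, rfl⟩ := Q.exists_source i
      exact run_mem_arrowFiltration a le_rfl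
    | cons a l ih =>
      obtain ⟨rfl, hl⟩ := hl
      have h1 : ofPath K Q.toQuiverData ⟨Q.s a, a :: l, rfl, hl⟩ =
          ofPath K _ (runPath Q a 1) * ofPath K _ ⟨Q.t a, l, hl⟩ :=
        (ofPath_mul_of_eq K _ (runPath Q a 1) ⟨Q.t a, l, hl⟩ rfl).symm
      rw [h1, map_mul]
      exact arrowFiltration_antitone m c (Nat.zero_le _)
        (mul_mem_arrowFiltration h (run_mem_arrowFiltration a le_rfl) (ih _ hl))

theorem mem_arrowFiltration_zero (h : ∀ a, 3 ≤ Q.wt m a) (x : WTAlgebra Q m c) :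
    x ∈ arrowFiltration m c 0 := by
  rw [arrowFiltration_zero m c h]; trivial

variable {m c} in
theorem mul_mem_arrowFiltration_left (h : ∀ a, 3 ≤ Q.wt m a) {n : ℕ} (x : WTAlgebra Q m c)
    {y : WTAlgebra Q m c} (hy : y ∈ arrowFiltration m c n) : x * y ∈ arrowFiltration m c n := by
  simpa using mul_mem_arrowFiltration h (mem_arrowFiltration_zero m c h x) hy

variable {m c} in
theorem mul_mem_arrowFiltration_right (h : ∀ a, 3 ≤ Q.wt m a) {n : ℕ} {x : WTAlgebra Q m c}
    (y : WTAlgebra Q m c) (hx : x ∈ arrowFiltration m c n) : x * y ∈ arrowFiltration m c n := by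
  simpa using mul_mem_arrowFiltration h hx (mem_arrowFiltration_zero m c h y)

theorem exists_arrowFiltration_eq_bot [Finite A] (h : ∀ a, 3 ≤ Q.wt m a) :
    ∃ n, arrowFiltration m c n = ⊥ := by
  obtain ⟨n, hn⟩ := (Set.finite_range (Q.wt m)).bddAbove
  refine ⟨n + 1, ?_⟩
  rw [arrowFiltration, Submodule.span_eq_bot]
  rintro _ ⟨b, k, hk, rfl⟩
  exact run_eq_zero m c h b (lt_of_le_of_lt (hn ⟨b, rfl⟩) hk)

theorem isNilpotent_of_mem_arrowFiltration [Finite A] (h : ∀ a, 3 ≤ Q.wt m a)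
    {x : WTAlgebra Q m c} (hx : x ∈ arrowFiltration m c 1) : IsNilpotent x := by
  obtain ⟨n, hn⟩ := exists_arrowFiltration_eq_bot m c h
  refine ⟨n, ?_⟩
  have h1 : ∀ k, x ^ k ∈ arrowFiltration m c k := by
    intro k
    induction k with
    | zero => exact mem_arrowFiltration_zero m c h _
    | succ k ih => rw [pow_succ]; exact mul_mem_arrowFiltration h ih hx
  have := h1 n
  rwa [hn, Submodule.mem_bot] at this

/-- Elements of `e_i Λ` in a layer of the filtration are combinations of runs starting at `i`. -/
theorem e_mul_mem_span {n : ℕ} (i : V) {x : WTAlgebra Q m c} (hx : x ∈ arrowFiltration m c n) :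
    e Q m c i * x ∈ Submodule.span K {y | ∃ b k, n ≤ k ∧ Q.s b = i ∧ y = run m c b k} := by
  induction hx using Submodule.span_induction with
  | mem x hx =>
    obtain ⟨b, k, hk, rfl⟩ := hx
    by_cases hb : Q.s b = i
    · rw [e_mul_run_of_eq m c hb]
      exact Submodule.subset_span ⟨b, k, hk, hb, rfl⟩
    · obtain ⟨a, rfl⟩ := Q.exists_source i
      rw [← run_zero, run_mul_run_of_ne m c (show Q.s b ≠ Q.s (Q.g^[0] a) from hb)]
      exact zero_mem _
  | zero => rw [mul_zero]; exact zero_mem _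
  | add x y _ _ hx hy => rw [mul_add]; exact add_mem hx hy
  | smul r x _ hx => rw [mul_smul_comm]; exact Submodule.smul_mem _ _ hx

/-- Elements of `e_i rad Λ` lie in `αΛ + ᾱΛ`. -/
theorem exists_eq_arrow_mul_add (a : A) {x : WTAlgebra Q m c} (hx : x ∈ arrowFiltration m c 1)
    (he : e Q m c (Q.s a) * x = x) :
    ∃ u v, x = run m c a 1 * u + run m c (Q.bar a) 1 * v := by
  have h1 := e_mul_mem_span m c (Q.s a) hx
  rw [he] at h1
  clear he hx
  induction h1 using Submodule.span_induction with
  | mem x hx =>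
    obtain ⟨b, k, hk, hb, rfl⟩ := hx
    obtain ⟨k, rfl⟩ := Nat.exists_eq_add_of_le' hk
    rcases Q.eq_or_eq_bar hb with rfl | rfl
    · exact ⟨run m c (Q.g b) k, 0, by rw [run_one_mul_run, mul_zero, add_zero]⟩
    · exact ⟨0, run m c (Q.g (Q.bar a)) k, by rw [run_one_mul_run, mul_zero, zero_add]⟩
  | zero => exact ⟨0, 0, by simp⟩
  | add x y _ _ hx hy =>
    obtain ⟨u, v, rfl⟩ := hx
    obtain ⟨u', v', rfl⟩ := hy
    exact ⟨u + u', v + v', by rw [mul_add, mul_add]; abel⟩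
  | smul r x _ hx =>
    obtain ⟨u, v, rfl⟩ := hx
    exact ⟨r • u, r • v, by rw [mul_smul_comm, mul_smul_comm, smul_add]⟩

theorem exists_eq_smul_e_add (h : ∀ a, 3 ≤ Q.wt m a) {i : V} {x : WTAlgebra Q m c}
    (he : e Q m c i * x = x) :
    ∃ r : K, ∃ y ∈ arrowFiltration m c 1, e Q m c i * y = y ∧ x = r • e Q m c i + y := by
  have h1 := e_mul_mem_span m c i (mem_arrowFiltration_zero m c h x)
  rw [he] at h1
  clear he
  induction h1 using Submodule.span_induction with
  | mem x hx =>
    obtain ⟨b, k, -, rfl, rfl⟩ := hx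
    rcases Nat.eq_zero_or_pos k with rfl | hk
    · exact ⟨1, 0, zero_mem _, mul_zero _, by rw [run_zero, one_smul, add_zero]⟩
    · exact ⟨0, _, run_mem_arrowFiltration b hk, e_mul_run m c b k, by rw [zero_smul, zero_add]⟩
  | zero => exact ⟨0, 0, zero_mem _, mul_zero _, by simp⟩
  | add x y _ _ hx hy =>
    obtain ⟨r, u, hu, hu', rfl⟩ := hx
    obtain ⟨r', u', hv, hv', rfl⟩ := hy
    exact ⟨r + r', u + u', add_mem hu hv, by rw [mul_add, hu', hv'], by rw [add_smul]; abel⟩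
  | smul s x _ hx =>
    obtain ⟨r, u, hu, hu', rfl⟩ := hx
    exact ⟨s * r, s • u, Submodule.smul_mem _ _ hu, by rw [mul_smul_comm, hu'],
      by rw [smul_add, mul_smul]⟩

/-! ### Coordinates -/

/-- The linear combination of the runs `a g(a) ⋯` of length `< m_a n_a` and the nontrivial runs
`ā g(ā) ⋯` of length `≤ m_ā n_ā` with given coefficients. -/
noncomputable def comb (a : A) : ((ℕ → K) × (ℕ → K)) →ₗ[K] WTAlgebra Q m c where
  -- The second index is shifted by one: `e_i` is counted among the runs of `a`, and the socle
  -- element among those of `ā`.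
  toFun X := ∑ k ∈ Finset.range (Q.wt m a), X.1 k • run m c a k +
    ∑ k ∈ Finset.range (Q.wt m (Q.bar a)), X.2 k • run m c (Q.bar a) (k + 1)
  map_add' X Y := by
    simp only [Prod.fst_add, Prod.snd_add, Pi.add_apply, add_smul, Finset.sum_add_distrib]
    abel
  map_smul' r X := by
    simp only [Prod.smul_fst, Prod.smul_snd, Pi.smul_apply, smul_eq_mul, mul_smul,
      Finset.smul_sum, smul_add, RingHom.id_apply]

theorem comb_apply (a : A) (X Y : ℕ → K) : comb m c a (X, Y) =
    ∑ k ∈ Finset.range (Q.wt m a), X k • run m c a k +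
    ∑ k ∈ Finset.range (Q.wt m (Q.bar a)), Y k • run m c (Q.bar a) (k + 1) := rfl

theorem e_mul_comb (a : A) (X : (ℕ → K) × (ℕ → K)) :
    e Q m c (Q.s a) * comb m c a X = comb m c a X := by
  obtain ⟨X, Y⟩ := X
  rw [comb_apply]
  simp only [mul_add, Finset.mul_sum, mul_smul_comm, e_mul_run, e_mul_run_of_eq m c (Q.s_bar a)]

theorem exists_comb [Finite A] (h : ∀ a, 3 ≤ Q.wt m a) (a : A) {x : WTAlgebra Q m c}
    (he : e Q m c (Q.s a) * x = x) : ∃ X Y : ℕ → K, comb m c a (X, Y) = x := by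
  classical
  have h1 := e_mul_mem_span m c (Q.s a) (mem_arrowFiltration_zero m c h x)
  rw [he] at h1
  have key : Submodule.span K {y | ∃ b k, 0 ≤ k ∧ Q.s b = Q.s a ∧ y = run m c b k} ≤
      LinearMap.range (comb m c a) := by
    have hbar : ∀ k < Q.wt m (Q.bar a), run m c (Q.bar a) (k + 1) ∈ LinearMap.range (comb m c a) :=
      fun k hk => ⟨(0, Pi.single k 1), by
        simp [comb_apply, Pi.single_apply, ite_smul, hk]⟩
    have hself : ∀ k < Q.wt m a, run m c a k ∈ LinearMap.range (comb m c a) :=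
      fun k hk => ⟨(Pi.single k 1, 0), by
        simp [comb_apply, Pi.single_apply, ite_smul, hk]⟩
    rw [Submodule.span_le]
    rintro _ ⟨b, k, -, hb, rfl⟩
    have ha3 := h a
    have hb3 := h (Q.bar a)
    rcases Q.eq_or_eq_bar hb with rfl | rfl
    · rcases lt_trichotomy k (Q.wt m b) with hk | rfl | hk
      · exact hself k hk
      · rw [run_wt_eq m c h]
        have := hbar (Q.wt m (Q.bar b) - 1) (by omega)
        rw [Nat.sub_add_cancel (by omega)] at this
        exact Submodule.smul_mem _ _ this
      · rw [run_eq_zero m c h _ hk]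
        exact zero_mem _
    · match k with
      | 0 =>
        have := hself 0 (by omega)
        rwa [run_zero, ← Q.s_bar a, ← run_zero] at this
      | k + 1 =>
        rcases lt_or_ge k (Q.wt m (Q.bar a)) with hk | hk
        · exact hbar k hk
        · rw [run_eq_zero m c h _ (Nat.lt_succ_of_le hk)]
          exact zero_mem _
  obtain ⟨⟨X, Y⟩, hX⟩ := key h1
  exact ⟨X, Y, hX⟩

/-! ### The symmetrizing form -/

theorem exists_form [Finite A] (h : ∀ a, 3 ≤ Q.wt m a) :
    ∃ φ : WTAlgebra Q m c →ₗ[K] K, ∀ x, φ (mk Q m c x) = preForm K m c x := by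
  let π := (mk Q m c).toLinearMap
  have hπ : LinearMap.range π = ⊤ := LinearMap.range_eq_top.2 (mk_surjective m c)
  have hker : LinearMap.ker π ≤ LinearMap.ker (preForm K m c) := by
    intro x hx
    have h1 : mk Q m c x = mk Q m c 0 := by rw [map_zero]; exact hx
    rw [mk_eq_mk, sub_zero] at h1
    exact preForm_eq_zero_of_mem_span K m c h h1
  -- Any linear section will do, because `preForm` vanishes on the kernel of the residue class map.
  obtain ⟨σ, hσ⟩ := π.exists_rightInverse_of_surjective hπ
  refine ⟨preForm K m c ∘ₗ σ, fun x => ?_⟩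
  have h2 : σ (π x) - x ∈ LinearMap.ker π := by
    rw [LinearMap.mem_ker, map_sub, sub_eq_zero]
    exact LinearMap.congr_fun hσ (π x)
  have h3 := hker h2
  rw [LinearMap.mem_ker, map_sub, sub_eq_zero] at h3
  exact h3

/-- The symmetrizing form of `Λ`. -/
noncomputable def form [Finite A] (h : ∀ a, 3 ≤ Q.wt m a) : WTAlgebra Q m c →ₗ[K] K :=
  (exists_form m c h).choose

theorem form_mk [Finite A] (h : ∀ a, 3 ≤ Q.wt m a) (x : PathAlgebra K Q.toQuiverData) :
    form m c h (mk Q m c x) = preForm K m c x := (exists_form m c h).choose_spec x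

theorem form_mul_comm [Finite A] (h : ∀ a, 3 ≤ Q.wt m a) (x y : WTAlgebra Q m c) :
    form m c h (x * y) = form m c h (y * x) := by
  obtain ⟨x, rfl⟩ := mk_surjective m c x
  obtain ⟨y, rfl⟩ := mk_surjective m c y
  induction x using path_induction with
  | zero => simp
  | add x x' hx hx' => rw [map_add, add_mul, mul_add, map_add, map_add, hx, hx']
  | smul r x hx => rw [map_smul, smul_mul_assoc, mul_smul_comm, map_smul, map_smul, hx]
  | ofPath p =>
    induction y using path_induction with
    | zero => simp
    | add x x' hx hx' => rw [map_add, add_mul, mul_add, map_add, map_add, hx, hx']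
    | smul r x hx => rw [map_smul, smul_mul_assoc, mul_smul_comm, map_smul, map_smul, hx]
    | ofPath q =>
      -- A product that exists in one order only is not a closed walk, so the form kills it.
      have key : ∀ p q : Q.toQuiverData.QPath, p.tgt = q.src → q.tgt ≠ p.src →
          form m c h (mk Q m c (ofPath K _ p) * mk Q m c (ofPath K _ q)) = 0 := by
        intro p q h1 h2
        rw [← map_mul, form_mk, ofPath_mul_of_eq K _ p q h1, preForm_ofPath]
        by_contra hne
        have := endpoint_eq_of_formWord_ne_zero K m c (p.comp q h1).isWalk hne
        exact h2 ((p.tgt_comp q h1).symm.trans this)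
      by_cases h1 : p.tgt = q.src
      · by_cases h2 : q.tgt = p.src
        · rw [← map_mul, ← map_mul, form_mk, form_mk, ofPath_mul_of_eq K _ p q h1,
            ofPath_mul_of_eq K _ q p h2, preForm_ofPath, preForm_ofPath]
          exact formWord_append_comm m c h _ _
        · rw [key p q h1 h2, ← map_mul (mk Q m c), ofPath_mul_of_ne K _ q p h2, map_zero, map_zero]
      · rw [← map_mul, ofPath_mul_of_ne K _ p q h1, map_zero, map_zero]
        by_cases h2 : q.tgt = p.src
        · rw [key q p h2 h1]
        · rw [← map_mul, ofPath_mul_of_ne K _ q p h2, map_zero, map_zero]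

theorem form_run_mul_run [Finite A] (h : ∀ a, 3 ≤ Q.wt m a) {a b : A} {j k : ℕ}
    (hs : Q.s b = Q.s (Q.g^[j] a)) :
    form m c h (run m c a j * run m c b k) =
      formWord m c (List.iterate Q.g a j ++ List.iterate Q.g b k) := by
  rw [run, run, ← map_mul, form_mk,
    ofPath_mul_of_eq K _ _ _ ((tgt_runPath Q a j).trans hs.symm), preForm_ofPath]
  rfl

theorem form_run_mul_run_self [Finite A] (h : ∀ a, 3 ≤ Q.wt m a) (a : A) {k : ℕ}
    (hk : k ≤ Q.wt m a) : form m c h (run m c a k * run m c (Q.g^[k] a) (Q.wt m a - k)) =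
      (((c (Q.orbit a))⁻¹ : Kˣ) : K) := by
  rw [form_run_mul_run m c h rfl, formWord_run_self m c a h hk]

theorem form_run_mul_run_eq_zero [Finite A] (h : ∀ a, 3 ≤ Q.wt m a) (a b : A) {j k : ℕ}
    (hk : k ≤ Q.wt m a) (hne : ¬ (a = b ∧ j = k)) (h0 : ¬ (j = 0 ∧ k = 0))
    (hjk : j < Q.wt m b ∨ k < Q.wt m a) :
    form m c h (run m c b j * run m c (Q.g^[k] a) (Q.wt m a - k)) = 0 := by
  by_cases hs : Q.s (Q.g^[k] a) = Q.s (Q.g^[j] b)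
  · rw [form_run_mul_run m c h hs, formWord_run_eq_zero m c a b h hk hne h0 hjk]
  · rw [run_mul_run_of_ne m c hs, map_zero]

/-- The run from `g^j(a)` to the end of `B_a` completes the run of length `j` of `a` to `B_a`, and
pairs to zero with the other runs used as coordinates. It thus reads off the coefficient `X j`. -/
theorem form_comb_mul_left [Finite A] (h : ∀ a, 3 ≤ Q.wt m a) (a : A) (X Y : ℕ → K) {j : ℕ}
    (hj : j < Q.wt m a) :
    form m c h (comb m c a (X, Y) * run m c (Q.g^[j] a) (Q.wt m a - j)) =
      X j * (((c (Q.orbit a))⁻¹ : Kˣ) : K) := by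
  rw [comb_apply, add_mul, Finset.sum_mul, Finset.sum_mul, map_add, map_sum, map_sum,
    Finset.sum_eq_single j, Finset.sum_eq_zero, add_zero, smul_mul_assoc, map_smul,
    form_run_mul_run_self m c h a hj.le, smul_eq_mul]
  · intro k hk
    rw [smul_mul_assoc, map_smul, form_run_mul_run_eq_zero m c h _ _ hj.le, smul_zero]
    · exact fun h' => Q.bar_ne a h'.1.symm
    · omega
    · exact Or.inr hj
  · intro k hk hkj
    rw [smul_mul_assoc, map_smul, form_run_mul_run_eq_zero m c h _ _ hj.le, smul_zero]
    · exact fun h' => hkj h'.2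
    · omega
    · exact Or.inr hj
  · intro h'
    exact absurd (Finset.mem_range.2 hj) h'

theorem form_comb_mul_right [Finite A] (h : ∀ a, 3 ≤ Q.wt m a) (a : A) (X Y : ℕ → K) {j : ℕ}
    (hj : j < Q.wt m (Q.bar a)) :
    form m c h (comb m c a (X, Y) *
      run m c (Q.g^[j + 1] (Q.bar a)) (Q.wt m (Q.bar a) - (j + 1))) =
      Y j * (((c (Q.orbit (Q.bar a)))⁻¹ : Kˣ) : K) := by
  rw [comb_apply, add_mul, Finset.sum_mul, Finset.sum_mul, map_add, map_sum, map_sum,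
    Finset.sum_eq_zero, Finset.sum_eq_single j, zero_add, smul_mul_assoc, map_smul,
    form_run_mul_run_self m c h _ hj, smul_eq_mul]
  · intro k hk hkj
    rw [Finset.mem_range] at hk
    rw [smul_mul_assoc, map_smul, form_run_mul_run_eq_zero m c h _ _ hj, smul_zero]
    · omega
    · omega
    · omega
  · intro h'
    exact absurd (Finset.mem_range.2 hj) h'
  · intro k hk
    rw [Finset.mem_range] at hk
    rw [smul_mul_assoc, map_smul, form_run_mul_run_eq_zero m c h _ _ hj, smul_zero]
    · exact fun h' => Q.bar_ne a h'.1
    · omega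
    · exact Or.inl hk

/-- Linear independence of the chosen runs, by pairing with the dual family. -/
theorem comb_eq_zero [Finite A] (h : ∀ a, 3 ≤ Q.wt m a) (a : A) {X Y : ℕ → K}
    (h0 : comb m c a (X, Y) = 0) :
    (∀ j < Q.wt m a, X j = 0) ∧ ∀ j < Q.wt m (Q.bar a), Y j = 0 := by
  constructor
  · intro j hj
    have := form_comb_mul_left m c h a X Y hj
    rw [h0, zero_mul, map_zero] at this
    simpa using this.symm
  · intro j hj
    have := form_comb_mul_right m c h a X Y hj
    rw [h0, zero_mul, map_zero] at this
    simpa using this.symm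

theorem run_ne_zero [Finite A] (h : ∀ a, 3 ≤ Q.wt m a) (a : A) {k : ℕ} (hk : k ≤ Q.wt m a) :
    run m c a k ≠ 0 := by
  intro h0
  have := form_run_mul_run_self m c h a hk
  rw [h0, zero_mul, map_zero] at this
  exact (Units.ne_zero _) this.symm

theorem e_ne_zero [Finite A] (h : ∀ a, 3 ≤ Q.wt m a) (i : V) : e Q m c i ≠ 0 := by
  obtain ⟨a, rfl⟩ := Q.exists_source i
  exact run_ne_zero m c h a (Nat.zero_le _)

end WTAlgebra

/-! ### Projective covers, syzygies and minimal projective resolutions -/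

section Homological

variable {R : Type u} [Ring R]

/-- Nakayama's argument: in a finitely generated module a proper submodule lies in a maximal one,
which also contains the Jacobson radical. -/
theorem IsSuperfluous.of_le_jacobson {M : Type*} [AddCommGroup M] [Module R M]
    [Module.Finite R M] {N : Submodule R M} (hN : N ≤ Module.jacobson R M) : IsSuperfluous N := by
  intro L hL
  rcases eq_top_or_exists_le_coatom L with h | ⟨L', hL', hle⟩
  · exact h
  · have h1 : N ≤ L' := hN.trans (sInf_le hL')
    exact absurd (top_le_iff.1 (hL ▸ sup_le h1 hle)) hL'.1

/-- Uniqueness of projective covers. Lift `e ∘ p` to `φ`; superfluity of `ker p'` makes `φ`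
surjective, so it has a section `s` by projectivity. Superfluity of `ker p` makes `s` surjective,
hence `φ` is bijective. -/
theorem IsProjectiveCover.nonempty_ker_equiv {P M P' M' : Type*}
    [AddCommGroup P] [Module R P] [AddCommGroup M] [Module R M]
    [AddCommGroup P'] [Module R P'] [AddCommGroup M'] [Module R M']
    {p : P →ₗ[R] M} {p' : P' →ₗ[R] M'} (hp : IsProjectiveCover p) (hp' : IsProjectiveCover p')
    (e : M ≃ₗ[R] M') : Nonempty (LinearMap.ker p ≃ₗ[R] LinearMap.ker p') := by
  have := hp.projective
  have := hp'.projective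
  obtain ⟨φ, hφ⟩ := Module.projective_lifting_property p' (e.toLinearMap ∘ₗ p) hp'.surjective
  have hφ' : ∀ x, p' (φ x) = e (p x) := fun x => LinearMap.congr_fun hφ x
  have hφs : LinearMap.range φ = ⊤ := by
    refine hp'.superfluous _ (top_le_iff.1 fun y _ => ?_)
    obtain ⟨x, hx⟩ := hp.surjective (e.symm (p' y))
    refine Submodule.mem_sup.2 ⟨y - φ x, ?_, φ x, ⟨x, rfl⟩, sub_add_cancel _ _⟩
    rw [LinearMap.mem_ker, map_sub, hφ', hx, e.apply_symm_apply, sub_self]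
  obtain ⟨s, hs⟩ := Module.projective_lifting_property φ LinearMap.id (LinearMap.range_eq_top.1 hφs)
  have hs' : ∀ y, φ (s y) = y := fun y => LinearMap.congr_fun hs y
  have hss : LinearMap.range s = ⊤ := by
    refine hp.superfluous _ (top_le_iff.1 fun x _ => ?_)
    refine Submodule.mem_sup.2 ⟨x - s (φ x), ?_, s (φ x), ⟨_, rfl⟩, sub_add_cancel _ _⟩
    rw [LinearMap.mem_ker]
    apply e.injective
    rw [← hφ', map_sub, hs', sub_self, map_zero, map_zero]
  have hinj : Function.Injective φ := by
    intro x y hxy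
    obtain ⟨x, rfl⟩ := LinearMap.range_eq_top.1 hss x
    obtain ⟨y, rfl⟩ := LinearMap.range_eq_top.1 hss y
    rw [hs', hs'] at hxy
    rw [hxy]
  let E := LinearEquiv.ofBijective φ ⟨hinj, LinearMap.range_eq_top.1 hφs⟩
  refine ⟨(E.submoduleMap (LinearMap.ker p)).trans (LinearEquiv.ofEq _ _ ?_)⟩
  ext y
  constructor
  · rintro ⟨x, hx, rfl⟩
    change p' (φ x) = 0
    rw [hφ', LinearMap.mem_ker.1 hx, map_zero]
  · intro hy
    refine ⟨s y, ?_, hs' y⟩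
    apply e.injective
    rw [← hφ', hs', map_zero, LinearMap.mem_ker.1 hy]

theorem IsProjectiveCover.equiv_comp {P M M' : Type*}
    [AddCommGroup P] [Module R P] [AddCommGroup M] [Module R M] [AddCommGroup M'] [Module R M']
    {p : P →ₗ[R] M} (hp : IsProjectiveCover p) (e : M ≃ₗ[R] M') :
    IsProjectiveCover (e.toLinearMap ∘ₗ p) where
  projective := hp.projective
  surjective := e.surjective.comp hp.surjective
  superfluous := by rw [LinearEquiv.ker_comp]; exact hp.superfluous

theorem IsSyzygy.congr {n : ℕ} {M M' N N' : ModuleCat.{v} R} (hM : M ≃ₗ[R] M') (hN : N ≃ₗ[R] N')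
    (h : IsSyzygy n M N) : IsSyzygy n M' N' := by
  induction n generalizing M M' with
  | zero =>
    obtain ⟨e⟩ := h
    exact ⟨(hM.symm.trans e).trans hN⟩
  | succ n ih =>
    obtain ⟨P, p, hp, h⟩ := h
    refine ⟨P, hM.toLinearMap ∘ₗ p, hp.equiv_comp hM, ih ?_ h⟩
    exact LinearEquiv.ofEq _ _ (LinearEquiv.ker_comp _ _).symm

/-- The cover quantified in `IsSyzygy` may be replaced by any given one, so that non-isomorphism of
syzygies can be tested on a single resolution. -/
theorem isSyzygy_succ_iff {n : ℕ} {M N P : ModuleCat.{v} R} {p : P →ₗ[R] M}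
    (hp : IsProjectiveCover p) :
    IsSyzygy (n + 1) M N ↔ IsSyzygy n (ModuleCat.of R (LinearMap.ker p)) N := by
  constructor
  · rintro ⟨P', p', hp', h⟩
    obtain ⟨e⟩ := hp'.nonempty_ker_equiv hp (LinearEquiv.refl R M)
    exact h.congr e (LinearEquiv.refl R N)
  · exact fun h => ⟨P, p, hp, h⟩

namespace IsMinimalProjectiveResolution

/-- By exactness, the kernel of the cover of the image of `d k` is the image of `d (k + 1)`;
iterate. -/
theorem isSyzygy_range_iff {M : ModuleCat.{v} R} {X : ℕ → ModuleCat.{v} R}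
    {d : ∀ n, X (n + 1) →ₗ[R] X n} {ε : X 0 →ₗ[R] M} (H : IsMinimalProjectiveResolution X d ε)
    (n k : ℕ) (N : ModuleCat.{v} R) :
    IsSyzygy n (ModuleCat.of R (LinearMap.range (d k))) N ↔
      Nonempty (LinearMap.range (d (n + k)) ≃ₗ[R] N) := by
  induction n generalizing k with
  | zero => rw [Nat.zero_add]; rfl
  | succ n ih =>
    rw [isSyzygy_succ_iff (M := ModuleCat.of R (LinearMap.range (d k))) (H.cover_succ k),
      show n + 1 + k = n + (k + 1) by omega, ← ih]
    have h1 : LinearMap.ker (d k).rangeRestrict = LinearMap.range (d (k + 1)) := by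
      rw [LinearMap.ker_rangeRestrict, (H.exact_succ k).linearMap_ker_eq]
    exact ⟨fun h => h.congr (LinearEquiv.ofEq _ _ h1) (LinearEquiv.refl R N),
      fun h => h.congr (LinearEquiv.ofEq _ _ h1.symm) (LinearEquiv.refl R N)⟩

theorem isSyzygy_succ_iff {M : ModuleCat.{v} R} {X : ℕ → ModuleCat.{v} R}
    {d : ∀ n, X (n + 1) →ₗ[R] X n} {ε : X 0 →ₗ[R] M} (H : IsMinimalProjectiveResolution X d ε)
    (n : ℕ) (N : ModuleCat.{v} R) :
    IsSyzygy (n + 1) M N ↔ Nonempty (LinearMap.range (d n) ≃ₗ[R] N) := by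
  rw [_root_.isSyzygy_succ_iff H.cover_zero]
  have h2 : _ ↔ Nonempty (LinearMap.range (d n) ≃ₗ[R] N) := H.isSyzygy_range_iff n 0 N
  rw [← h2]
  have h1 : LinearMap.ker ε = LinearMap.range (d 0) := H.exact_zero.linearMap_ker_eq
  exact ⟨fun h => h.congr (LinearEquiv.ofEq _ _ h1) (LinearEquiv.refl R N),
    fun h => h.congr (LinearEquiv.ofEq _ _ h1.symm) (LinearEquiv.refl R N)⟩

end IsMinimalProjectiveResolution

theorem IsPeriodicOfPeriod.congr {M M' : ModuleCat.{v} R} {n : ℕ} (e : M ≃ₗ[R] M')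
    (h : IsPeriodicOfPeriod M n) : IsPeriodicOfPeriod M' n :=
  ⟨h.1, h.2.1.congr e e, fun j h0 hj h' => h.2.2 j h0 hj (h'.congr e.symm e.symm)⟩

end Homological

/-! ### Recognition of the tetrahedral triangulation quiver -/

/-- The involution `a ↦ ā` of the tetrahedral triangulation quiver. -/
def tetrahedralBar : Fin 12 → Fin 12 := ![3, 10, 8, 0, 7, 11, 9, 4, 2, 6, 1, 5]

/-- The action on the arrows of the tetrahedral triangulation quiver of a word in `f` (`true`)
and `a ↦ ā` (`false`); the last letter acts first. -/
def tetrahedralAct (w : List Bool) (x : Fin 12) : Fin 12 :=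
  w.foldr (fun b y => if b then tetrahedralF y else tetrahedralBar y) x

/-- A word that takes the arrow `0` of the tetrahedral triangulation quiver to a given arrow. -/
def tetrahedralWord : Fin 12 → List Bool :=
  ![[], [true], [true, true], [false], [true, false], [true, true, false],
    [true, true, false, true, false], [false, true, false], [true, false, true, false],
    [true, true, false, true], [false, true], [true, false, true]]

/-- The permutation of the arrows of the tetrahedral triangulation quiver that commutes with `f` and
with `a ↦ ā` and takes `0` to `y`. -/
def tetrahedralDeck (y x : Fin 12) : Fin 12 := tetrahedralAct (tetrahedralWord x) y

theorem tetrahedralAct_word (x : Fin 12) : tetrahedralAct (tetrahedralWord x) 0 = x := by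
  revert x; decide

/-- The least arrow among those that are identified with `x` up to `a ↦ ā` and deck transformations
of order three. -/
def tetrahedralRep (y x : Fin 12) : Fin 12 :=
  min (min (min x (tetrahedralDeck y x)) (tetrahedralDeck y (tetrahedralDeck y x)))
    (min (min (tetrahedralBar x) (tetrahedralDeck y (tetrahedralBar x)))
      (tetrahedralDeck y (tetrahedralDeck y (tetrahedralBar x))))

/-- The deck group is `A₄`, the rotation group of a tetrahedron whose edges are the six vertices of
the quiver, each carrying two arrows. A rotation of order two preserves an edge and swaps its two
arrows; one of order three has just two orbits on the edges. -/
theorem tetrahedralDeck_cases : ∀ y : Fin 12, y ≠ 0 →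
    (∃ x, tetrahedralDeck y x = tetrahedralBar x) ∨
      (Finset.univ.image (tetrahedralRep y)).card ≤ 2 := by
  decide

/-! ### Maps from the tetrahedral quiver to a triangulation quiver. -/

namespace TriangulationQuiver

variable {V : Type uV} {A : Type uA} {Q : TriangulationQuiver V A}

theorem map_tetrahedralAct {ψ : Fin 12 → A} (hf : ∀ x, ψ (tetrahedralF x) = Q.f (ψ x))
    (hb : ∀ x, ψ (tetrahedralBar x) = Q.bar (ψ x)) {x y : Fin 12} (h : ψ x = ψ y) (w : List Bool) :
    ψ (tetrahedralAct w x) = ψ (tetrahedralAct w y) := by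
  induction w with
  | nil => exact h
  | cons b w ih =>
    change ψ (if b then tetrahedralF (tetrahedralAct w x) else
      tetrahedralBar (tetrahedralAct w x)) = ψ (if b then tetrahedralF (tetrahedralAct w y) else
      tetrahedralBar (tetrahedralAct w y))
    cases b
    · simpa [hb] using ih
    · simpa [hf] using ih

/-- The image is closed under `f` and the bar, so it contains all arrows at each vertex where it has
one, and reaches the neighbours of that vertex; `Q` is connected. -/
theorem surjective_of_tetrahedral {ψ : Fin 12 → A} (hf : ∀ x, ψ (tetrahedralF x) = Q.f (ψ x))
    (hb : ∀ x, ψ (tetrahedralBar x) = Q.bar (ψ x)) : Function.Surjective ψ := by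
  have hF : ∀ b, b ∈ Set.range ψ → Q.f b ∈ Set.range ψ := by
    rintro _ ⟨x, rfl⟩; exact ⟨_, hf x⟩
  have hB : ∀ b, b ∈ Set.range ψ → ∀ d, Q.s d = Q.s b → d ∈ Set.range ψ := by
    rintro _ ⟨x, rfl⟩ d hd
    rcases Q.eq_or_eq_bar hd with rfl | rfl
    · exact ⟨x, rfl⟩
    · exact ⟨_, hb x⟩
  have key : ∀ i j, Relation.EqvGen (fun x y => ∃ a, Q.s a = x ∧ Q.t a = y) i j →
      ((∃ x, Q.s (ψ x) = i) ↔ ∃ x, Q.s (ψ x) = j) := by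
    intro i j hij
    induction hij with
    | rel i j h =>
      obtain ⟨a, rfl, rfl⟩ := h
      constructor
      · rintro ⟨x, hx⟩
        obtain ⟨z, hz⟩ := hF _ (hB _ ⟨x, rfl⟩ a hx.symm)
        exact ⟨z, by rw [hz, Q.s_f]⟩
      · rintro ⟨x, hx⟩
        -- To go back along `a`, start from `f(a)`, which leaves `t(a)`, and use `f²(f(a)) = a`.
        have h1 : Q.f a ∈ Set.range ψ := hB _ ⟨x, rfl⟩ _ (by rw [Q.s_f, hx])
        obtain ⟨z, hz⟩ := hF _ (hF _ h1)
        exact ⟨z, by rw [hz, Q.f_cube]⟩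
    | refl => rfl
    | symm _ _ _ ih => exact ih.symm
    | trans _ _ _ _ _ ih1 ih2 => exact ih1.trans ih2
  intro a
  obtain ⟨x, hx⟩ := (key _ _ (Q.connected (Q.s (ψ 0)) (Q.s a))).1 ⟨0, rfl⟩
  exact hB _ ⟨x, rfl⟩ a hx.symm

/-- If `ψ` takes the same value at `0` and at `y ≠ 0`, it is invariant under the deck transformation
taking `0` to `y`. Order two would give the bar a fixed point; order three would leave at most two
vertices. -/
theorem injective_of_tetrahedral [Fintype V] (hV : 3 ≤ Fintype.card V) {ψ : Fin 12 → A}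
    (hf : ∀ x, ψ (tetrahedralF x) = Q.f (ψ x))
    (hb : ∀ x, ψ (tetrahedralBar x) = Q.bar (ψ x)) : Function.Injective ψ := by
  classical
  have h0 : ∀ y, ψ 0 = ψ y → y = 0 := by
    intro y hy
    by_contra hne
    have hD : ∀ x, ψ (tetrahedralDeck y x) = ψ x := by
      intro x
      have := map_tetrahedralAct hf hb hy (tetrahedralWord x)
      rw [tetrahedralAct_word] at this
      exact this.symm
    rcases tetrahedralDeck_cases y hne with ⟨x, hx⟩ | hcard
    · have := hD x
      rw [hx, hb] at this
      exact Q.bar_ne _ this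
    · have hrep : ∀ x, Q.s (ψ (tetrahedralRep y x)) = Q.s (ψ x) := by
        intro x
        have hmin : ∀ u v : Fin 12, Q.s (ψ u) = Q.s (ψ x) → Q.s (ψ v) = Q.s (ψ x) →
            Q.s (ψ (min u v)) = Q.s (ψ x) := by
          intro u v hu hv
          rcases min_choice u v with h | h <;> rw [h] <;> assumption
        have hbx : Q.s (ψ (tetrahedralBar x)) = Q.s (ψ x) := by rw [hb, Q.s_bar]
        refine hmin _ _ (hmin _ _ (hmin _ _ rfl ?_) ?_) (hmin _ _ (hmin _ _ hbx ?_) ?_) <;>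
          simp only [hD, hbx]
      have hle : (Finset.univ : Finset V) ⊆
          (Finset.univ.image (tetrahedralRep y)).image fun x => Q.s (ψ x) := by
        intro i _
        obtain ⟨a, rfl⟩ := Q.exists_source i
        obtain ⟨x, rfl⟩ := surjective_of_tetrahedral hf hb a
        rw [Finset.image_image]
        exact Finset.mem_image.2 ⟨x, Finset.mem_univ _, hrep x⟩
      have h1 := (Finset.card_le_card hle).trans Finset.card_image_le
      rw [Finset.card_univ] at h1
      omega
  -- A word in `f` and the bar carries any coincidence `ψ x = ψ y` to one involving the arrow `0`,
  -- without identifying distinct arrows.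
  have hinv : ∀ x y : Fin 12, ∃ w, tetrahedralAct w x = 0 ∧ (tetrahedralAct w y = 0 → x = y) := by
    have : ∀ x : Fin 12, ∃ z : Fin 12, tetrahedralAct (tetrahedralWord z) x = 0 ∧
        ∀ y, tetrahedralAct (tetrahedralWord z) y = 0 → x = y := by decide
    intro x y
    obtain ⟨z, hz, hz'⟩ := this x
    exact ⟨_, hz, hz' y⟩
  intro x y hxy
  obtain ⟨w, hw, hw'⟩ := hinv x y
  refine hw' (h0 _ ?_)
  rw [← hw]
  exact map_tetrahedralAct hf hb hxy w

/-- Once `ψ` is bijective, `f` and the bar determine the quiver: vertices are the bar classes of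
arrows, and the target of an arrow is the source of its image under `f`. -/
theorem isTetrahedral_of_map [Fintype V] (hV : 3 ≤ Fintype.card V) {ψ : Fin 12 → A}
    (hf : ∀ x, ψ (tetrahedralF x) = Q.f (ψ x))
    (hb : ∀ x, ψ (tetrahedralBar x) = Q.bar (ψ x)) : Q.IsTetrahedral := by
  have hinj := injective_of_tetrahedral hV hf hb
  have hsurj := surjective_of_tetrahedral hf hb
  let v := Equiv.ofBijective ψ ⟨hinj, hsurj⟩
  have hv : ∀ x, v x = ψ x := fun _ => rfl
  have hs : ∀ x y, tetrahedralSource x = tetrahedralSource y ↔ Q.s (ψ x) = Q.s (ψ y) := by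
    have h1 : ∀ x y, tetrahedralSource x = tetrahedralSource y ↔
        (x = y ∨ x = tetrahedralBar y) := by decide
    intro x y
    rw [h1]
    constructor
    · rintro (rfl | rfl)
      · rfl
      · rw [hb, Q.s_bar]
    · intro h
      rcases Q.eq_or_eq_bar h with h | h
      · exact Or.inl (hinj h)
      · exact Or.inr (hinj (h.trans (hb y).symm))
  have hsec : ∀ i : Fin 6, ∃ x, tetrahedralSource x = i := by decide
  choose σ hσ using hsec
  let u : Fin 6 ≃ V := Equiv.ofBijective (fun i => Q.s (ψ (σ i))) ⟨fun i j hij => by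
      rw [← hσ i, ← hσ j, hs]; exact hij, fun i => by
      obtain ⟨a, rfl⟩ := Q.exists_source i
      obtain ⟨x, rfl⟩ := hsurj a
      exact ⟨tetrahedralSource x, (hs _ _).1 (hσ _)⟩⟩
  have hu : ∀ x, u.symm (Q.s (ψ x)) = tetrahedralSource x := by
    intro x
    rw [Equiv.symm_apply_eq]
    exact (hs _ _).1 (hσ _).symm
  refine ⟨u.symm, v.symm, fun a => ?_⟩
  obtain ⟨x, rfl⟩ := hsurj a
  have h1 : v.symm (ψ x) = x := v.symm_apply_apply x
  have h2 : ∀ x, tetrahedralTarget x = tetrahedralSource (tetrahedralF x) := by decide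
  refine ⟨by rw [h1, hu], by rw [h1, ← Q.s_f, ← hf, hu, h2], ?_⟩
  rw [h1, ← hf]
  exact v.symm_apply_apply _

/-- If four suitable `g`-orbits have weight `m n = 3`, the algebra is tetrahedral. -/
theorem isTetrahedralData_of_wt_eq_three [Fintype V] (hV : 3 ≤ Fintype.card V)
    (m : Q.Orbits → ℕ+) (a : A) (h1 : Q.wt m a = 3) (h2 : Q.wt m (Q.bar a) = 3)
    (h3 : Q.wt m (Q.f a) = 3) (h4 : Q.wt m (Q.f (Q.bar a)) = 3) : IsTetrahedralData Q m := by
  have := finite_arrows Q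
  -- Weight three at `ā`, `a` and `f(a)` yields the three identities `e1`, `e2`, `e3` below, which
  -- determine the bar on the arrows at hand.
  have g3 : ∀ b, Q.wt m b = 3 → Q.g (Q.g b) = Q.f (Q.f (Q.bar b)) := by
    intro b hb
    have := iterate_wt_sub_one m b hb.ge
    rwa [hb] at this
  have e1 : Q.bar (Q.f (Q.f a)) = Q.f (Q.g (Q.bar a)) := by
    have := g3 _ h2
    rw [Q.bar_bar, g_apply] at this
    rw [← this, Q.bar_bar]
  have e2 : Q.bar (Q.f (Q.f (Q.bar a))) = Q.f (Q.g a) := by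
    have := g3 _ h1
    rw [g_apply] at this
    rw [← this, Q.bar_bar]
  have e3 : Q.bar (Q.f (Q.f (Q.g (Q.bar a)))) = Q.f (Q.f (Q.g a)) := by
    rw [← e1, Q.bar_f_f, ← g_apply, g3 _ h3]
    rfl
  -- The four triangles are the `f`-orbits of `a`, `ā`, `g(ā)` and `g(a)`, listed in the numbering
  -- of the tetrahedral quiver.
  let ψ : Fin 12 → A := ![a, Q.f a, Q.f (Q.f a), Q.bar a, Q.f (Q.bar a), Q.f (Q.f (Q.bar a)),
    Q.f (Q.f (Q.g (Q.bar a))), Q.g (Q.bar a), Q.f (Q.g (Q.bar a)), Q.f (Q.f (Q.g a)),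
    Q.g a, Q.f (Q.g a)]
  have hf : ∀ x, ψ (tetrahedralF x) = Q.f (ψ x) := by
    intro x
    fin_cases x <;> simp [ψ, tetrahedralF, Q.f_cube]
  have hb : ∀ x, ψ (tetrahedralBar x) = Q.bar (ψ x) := by
    intro x
    have e4 : Q.bar (Q.f (Q.g (Q.bar a))) = Q.f (Q.f a) := by rw [← e1, Q.bar_bar]
    have e5 : Q.bar (Q.f (Q.g a)) = Q.f (Q.f (Q.bar a)) := by rw [← e2, Q.bar_bar]
    have e6 : Q.bar (Q.f (Q.f (Q.g a))) = Q.f (Q.f (Q.g (Q.bar a))) := by rw [← e3, Q.bar_bar]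
    fin_cases x <;>
      simp [ψ, tetrahedralBar, e1, e2, e3, e4, e5, e6, Q.bar_g, ← Q.g_apply a,
        ← Q.g_apply (Q.bar a)]
  refine ⟨isTetrahedral_of_map hV hf hb, fun o => ?_⟩
  obtain ⟨b, rfl⟩ := Quotient.exists_rep o
  change m (Q.orbit b) = 1
  obtain ⟨x, rfl⟩ := surjective_of_tetrahedral hf hb b
  have hinj := injective_of_tetrahedral hV hf hb
  have hg : ∀ x, Q.g (ψ x) = ψ (tetrahedralBar (tetrahedralF x)) := by
    intro x; rw [hb, hf]; rfl
  -- The arrows `0, 3, 1, 4`, that is `a`, `ā`, `f(a)`, `f(ā)`, represent all `g`-orbits of the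
  -- tetrahedral quiver.
  have hwt : Q.wt m (ψ x) = 3 := by
    have h : ∀ x : Fin 12, ∃ y ∈ ({0, 3, 1, 4} : Finset (Fin 12)), ∃ k < 3,
        (fun x => tetrahedralBar (tetrahedralF x))^[k] y = x := by decide
    obtain ⟨y, hy, k, -, rfl⟩ := h x
    have h5 : ψ ((fun x => tetrahedralBar (tetrahedralF x))^[k] y) = Q.g^[k] (ψ y) := by
      induction k with
      | zero => rfl
      | succ k ih => rw [Function.iterate_succ_apply', Function.iterate_succ_apply', ← hg, ih]
    rw [h5, wt_iterate]
    fin_cases hy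
    exacts [h1, h2, h3, h4]
  -- Since `m n = 3` is prime and `g` has no fixed arrow, `m = 1` is the only possibility.
  have hn : Q.n (ψ x) ≠ 1 := by
    intro h
    have h6 := Q.g_eq_self_of_n_eq_one h
    rw [hg] at h6
    have h7 : ∀ x, tetrahedralBar (tetrahedralF x) ≠ x := by decide
    exact h7 x (hinj h6)
  rw [wt] at hwt
  rcases (Nat.dvd_prime Nat.prime_three).1 (Dvd.intro _ hwt) with h | h
  · exact PNat.coe_eq_one_iff.1 h
  · rw [h] at hwt
    omega

end TriangulationQuiver

namespace WTAlgebra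

open PathAlgebra TriangulationQuiver MulOpposite

variable {K : Type uK} [Field K] {V : Type uV} {A : Type uA} [Fintype V]
  {Q : TriangulationQuiver V A} (m : Q.Orbits → ℕ+) (c : Q.Orbits → Kˣ)

/-! ### The projective modules `P_i` -/

variable {m c} in
theorem mem_P {i : V} {x : WTAlgebra Q m c} : x ∈ P Q m c i ↔ e Q m c i * x = x := by
  rw [P, Submodule.mem_span_singleton]
  constructor
  · rintro ⟨r, rfl⟩
    change e Q m c i * (e Q m c i * r.unop) = e Q m c i * r.unop
    rw [← mul_assoc, e_mul_e]
  · exact fun hx => ⟨op x, hx⟩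

theorem e_mem_P (i : V) : e Q m c i ∈ P Q m c i := mem_P.2 (e_mul_e m c i)

variable {m c} in
theorem e_mul_coe {i : V} (x : P Q m c i) : e Q m c i * (x : WTAlgebra Q m c) = x := mem_P.1 x.2

/-- Left multiplication by an element of `e_i Λ`, as a homomorphism to `P_i`. -/
noncomputable def toP {i : V} (y : WTAlgebra Q m c) (hy : e Q m c i * y = y) :
    WTAlgebra Q m c →ₗ[(WTAlgebra Q m c)ᵐᵒᵖ] P Q m c i :=
  (LinearMap.mulLeft (WTAlgebra Q m c)ᵐᵒᵖ y).codRestrict (P Q m c i) fun x => by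
    rw [mem_P, LinearMap.mulLeft_apply, ← mul_assoc, hy]

@[simp] theorem coe_toP {i : V} (y : WTAlgebra Q m c) (hy : e Q m c i * y = y)
    (x : WTAlgebra Q m c) : (toP m c y hy x : WTAlgebra Q m c) = y * x := rfl

theorem projective_self : Module.Projective (WTAlgebra Q m c)ᵐᵒᵖ (WTAlgebra Q m c) := by
  let E : (WTAlgebra Q m c)ᵐᵒᵖ ≃ₗ[(WTAlgebra Q m c)ᵐᵒᵖ] WTAlgebra Q m c :=
    { toFun := unop
      invFun := op
      map_add' := fun _ _ => rfl
      map_smul' := fun _ _ => rfl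
      left_inv := fun _ => rfl
      right_inv := fun _ => rfl }
  exact Module.Projective.of_equiv E

instance finite_self : Module.Finite (WTAlgebra Q m c)ᵐᵒᵖ (WTAlgebra Q m c) := by
  refine ⟨⟨{1}, ?_⟩⟩
  rw [eq_top_iff]
  rintro x -
  rw [Finset.coe_singleton, Submodule.mem_span_singleton]
  exact ⟨op x, one_mul x⟩

instance projective_P (i : V) : Module.Projective (WTAlgebra Q m c)ᵐᵒᵖ (P Q m c i) := by
  have := projective_self m c
  refine Module.Projective.of_split (P Q m c i).subtype (toP m c (e Q m c i) (e_mul_e m c i)) ?_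
  ext x
  exact e_mul_coe x

instance finite_P (i : V) : Module.Finite (WTAlgebra Q m c)ᵐᵒᵖ (P Q m c i) :=
  Module.Finite.iff_fg.2 ⟨{e Q m c i}, by rw [Finset.coe_singleton]; rfl⟩

/-- The coordinates of elements of `P_i`. -/
noncomputable def coordMap (a : A) :
    ((Fin (Q.wt m a) → K) × (Fin (Q.wt m (Q.bar a)) → K)) →ₗ[K] P Q m c (Q.s a) where
  toFun X := ⟨comb m c a (Function.ExtendByZero.linearMap K Fin.val X.1,
    Function.ExtendByZero.linearMap K Fin.val X.2), mem_P.2 (e_mul_comb m c a _)⟩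
  map_add' X Y := by
    ext
    simp only [Prod.fst_add, Prod.snd_add, map_add, Submodule.coe_add, ← Prod.mk_add_mk]
  map_smul' r X := by
    ext
    simp only [Prod.smul_fst, Prod.smul_snd, map_smul, RingHom.id_apply, ← Prod.smul_mk]
    rfl

theorem bijective_coordMap [Finite A] (h : ∀ a, 3 ≤ Q.wt m a) (a : A) :
    Function.Bijective (coordMap m c a) := by
  have hext : ∀ {n : ℕ} (X : Fin n → K) (k : Fin n),
      Function.ExtendByZero.linearMap K Fin.val X (k : ℕ) = X k :=
    fun X k => Fin.val_injective.extend_apply X 0 k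
  constructor
  · rw [← LinearMap.ker_eq_bot, LinearMap.ker_eq_bot']
    rintro ⟨X, Y⟩ hX
    obtain ⟨h1, h2⟩ := comb_eq_zero m c h a (congrArg Subtype.val hX)
    ext k
    · exact (hext X k).symm.trans (h1 k k.2)
    · exact (hext Y k).symm.trans (h2 k k.2)
  · rintro ⟨x, hx⟩
    obtain ⟨X, Y, rfl⟩ := exists_comb m c h a (mem_P.1 hx)
    refine ⟨(fun k => X k, fun k => Y k), Subtype.ext ?_⟩
    change comb m c a (_, _) = comb m c a (X, Y)
    rw [comb_apply, comb_apply]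
    congr 1 <;> refine Finset.sum_congr rfl fun k hk => ?_
    · rw [hext (fun k => X k) ⟨k, Finset.mem_range.1 hk⟩]
    · rw [hext (fun k => Y k) ⟨k, Finset.mem_range.1 hk⟩]

theorem finiteDimensional_P [Finite A] (h : ∀ a, 3 ≤ Q.wt m a) (i : V) :
    FiniteDimensional K (P Q m c i) := by
  obtain ⟨a, rfl⟩ := Q.exists_source i
  exact Module.Finite.of_surjective _ (bijective_coordMap m c h a).2

theorem finrank_P [Finite A] (h : ∀ a, 3 ≤ Q.wt m a) (a : A) :
    Module.finrank K (P Q m c (Q.s a)) = Q.wt m a + Q.wt m (Q.bar a) := by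
  rw [← (LinearEquiv.ofBijective _ (bijective_coordMap m c h a)).finrank_eq, Module.finrank_prod,
    Module.finrank_fin_fun, Module.finrank_fin_fun]

/-! ### The radical and the simple modules -/

/-- If a maximal submodule `N` missed `x`, then `1 = μ + x w` with `μ ∈ N`. But `x w` is nilpotent,
so `μ` is a unit and `N` is everything. -/
theorem mem_jacobson_of_mem_arrowFiltration [Finite A] (h : ∀ a, 3 ≤ Q.wt m a)
    {x : WTAlgebra Q m c} (hx : x ∈ arrowFiltration m c 1) :
    x ∈ Module.jacobson (WTAlgebra Q m c)ᵐᵒᵖ (WTAlgebra Q m c) := by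
  rw [Module.jacobson, Submodule.mem_sInf]
  intro N hN
  by_contra hxN
  have h1 : N ⊔ Submodule.span _ {x} = ⊤ :=
    hN.2 _ (left_lt_sup.2 fun h' => hxN (h' (Submodule.mem_span_singleton_self x)))
  obtain ⟨μ, hμ, y, hy, h2⟩ := Submodule.mem_sup.1
    (h1 ▸ Submodule.mem_top : (1 : WTAlgebra Q m c) ∈ N ⊔ Submodule.span _ {x})
  obtain ⟨w, rfl⟩ := Submodule.mem_span_singleton.1 hy
  have h3 : IsUnit (1 - x * w.unop) :=
    (isNilpotent_of_mem_arrowFiltration m c h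
      (mul_mem_arrowFiltration_right h _ hx)).isUnit_one_sub
  have h4 : μ = 1 - x * w.unop := by rw [← h2]; exact (add_sub_cancel_right _ _).symm
  rw [← h4] at h3
  obtain ⟨u, hu⟩ := h3
  apply hN.1
  rw [eq_top_iff]
  rintro z -
  have h5 := N.smul_mem (op ((↑u⁻¹ : WTAlgebra Q m c) * z)) hμ
  rwa [← hu, op_smul_eq_mul, ← mul_assoc, Units.mul_inv, one_mul] at h5

/-- A maximal submodule containing `1 - e_i` would also contain `e_i`, hence `1`. So `(1 - e_i)Λ =
Λ`, which forces `e_i = 0`. -/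
theorem e_notMem_jacobson [Finite A] (h : ∀ a, 3 ≤ Q.wt m a) (i : V) :
    e Q m c i ∉ Module.jacobson (WTAlgebra Q m c)ᵐᵒᵖ (WTAlgebra Q m c) := by
  intro he
  rcases eq_top_or_exists_le_coatom
    (Submodule.span (WTAlgebra Q m c)ᵐᵒᵖ {1 - e Q m c i}) with h1 | ⟨N, hN, hle⟩
  · obtain ⟨w, hw⟩ := Submodule.mem_span_singleton.1
      (h1 ▸ Submodule.mem_top : (1 : WTAlgebra Q m c) ∈ Submodule.span _ {1 - e Q m c i})
    have h2 : (1 - e Q m c i) * w.unop = 1 := hw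
    apply e_ne_zero m c h i
    rw [← mul_one (e Q m c i), ← h2, ← mul_assoc, mul_sub, e_mul_e, mul_one, sub_self, zero_mul]
  · apply hN.1
    have h3 : (1 : WTAlgebra Q m c) ∈ N := by
      have := N.add_mem (hle (Submodule.mem_span_singleton_self _))
        ((Submodule.mem_sInf.1 he) N hN)
      rwa [sub_add_cancel] at this
    rw [eq_top_iff]
    rintro z -
    simpa using N.smul_mem (op z) h3

/-- Modulo the runs of positive length, `e_i Λ` is the line `K e_i`. A nonzero coefficient there
would put `e_i` into the radical. -/
theorem mem_jacobson_iff [Finite A] (h : ∀ a, 3 ≤ Q.wt m a) {x : WTAlgebra Q m c} :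
    x ∈ Module.jacobson (WTAlgebra Q m c)ᵐᵒᵖ (WTAlgebra Q m c) ↔ x ∈ arrowFiltration m c 1 := by
  refine ⟨fun hx => ?_, mem_jacobson_of_mem_arrowFiltration m c h⟩
  rw [← one_mul x, ← sum_e, Finset.sum_mul]
  refine sum_mem fun i _ => ?_
  obtain ⟨r, y, hy, -, hxy⟩ := exists_eq_smul_e_add m c h
    (show e Q m c i * (e Q m c i * x) = e Q m c i * x by rw [← mul_assoc, e_mul_e])
  rw [hxy]
  suffices hr : r = 0 by
    rw [hr, zero_smul, zero_add]; exact hy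
  by_contra hr
  apply e_notMem_jacobson m c h i
  have h1 : e Q m c i * x ∈ Module.jacobson (WTAlgebra Q m c)ᵐᵒᵖ (WTAlgebra Q m c) :=
    Module.le_comap_jacobson (LinearMap.mulLeft (WTAlgebra Q m c)ᵐᵒᵖ (e Q m c i)) hx
  have h2 := sub_mem h1 (mem_jacobson_of_mem_arrowFiltration m c h hy)
  rw [hxy, add_sub_cancel_right] at h2
  have h3 := Submodule.smul_mem _ (algebraMap K (WTAlgebra Q m c)ᵐᵒᵖ r⁻¹) h2
  rwa [algebraMap_smul, smul_smul, inv_mul_cancel₀ hr, one_smul] at h3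

theorem mem_radP_iff [Finite A] (h : ∀ a, 3 ≤ Q.wt m a) {i : V} {x : P Q m c i} :
    x ∈ radP Q m c i ↔ (x : WTAlgebra Q m c) ∈ arrowFiltration m c 1 := by
  rw [radP, Submodule.mem_comap, Submodule.mem_map]
  constructor
  · rintro ⟨y, hy, hyx⟩
    rw [← Submodule.coe_subtype, ← hyx]
    exact mul_mem_arrowFiltration_left h _ ((mem_jacobson_iff m c h).1 hy)
  · exact fun hx => ⟨x, (mem_jacobson_iff m c h).2 hx, e_mul_coe x⟩

theorem mem_jacobson_P [Finite A] (h : ∀ a, 3 ≤ Q.wt m a) {i : V} {x : P Q m c i}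
    (hx : (x : WTAlgebra Q m c) ∈ arrowFiltration m c 1) :
    x ∈ Module.jacobson (WTAlgebra Q m c)ᵐᵒᵖ (P Q m c i) := by
  have h1 := Module.le_comap_jacobson (toP m c (e Q m c i) (e_mul_e m c i))
    (mem_jacobson_of_mem_arrowFiltration m c h hx)
  rw [Submodule.mem_comap] at h1
  rwa [show toP m c (e Q m c i) (e_mul_e m c i) (x : WTAlgebra Q m c) = x from
    Subtype.ext (e_mul_coe x)] at h1

theorem mem_jacobson_P_prod [Finite A] (h : ∀ a, 3 ≤ Q.wt m a) {i j : V}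
    {x : P Q m c i × P Q m c j} (h1 : (x.1 : WTAlgebra Q m c) ∈ arrowFiltration m c 1)
    (h2 : (x.2 : WTAlgebra Q m c) ∈ arrowFiltration m c 1) :
    x ∈ Module.jacobson (WTAlgebra Q m c)ᵐᵒᵖ (P Q m c i × P Q m c j) := by
  have h3 := Module.le_comap_jacobson
    (LinearMap.inl (WTAlgebra Q m c)ᵐᵒᵖ (P Q m c i) (P Q m c j)) (mem_jacobson_P m c h h1)
  have h4 := Module.le_comap_jacobson
    (LinearMap.inr (WTAlgebra Q m c)ᵐᵒᵖ (P Q m c i) (P Q m c j)) (mem_jacobson_P m c h h2)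
  have h5 := add_mem (Submodule.mem_comap.1 h3) (Submodule.mem_comap.1 h4)
  rwa [LinearMap.inl_apply, LinearMap.inr_apply, Prod.mk_add_mk, add_zero, zero_add] at h5

theorem isCoatom_radP [Finite A] (h : ∀ a, 3 ≤ Q.wt m a) (i : V) : IsCoatom (radP Q m c i) := by
  constructor
  · intro htop
    have h1 : (⟨e Q m c i, e_mem_P m c i⟩ : P Q m c i) ∈ radP Q m c i := htop ▸ Submodule.mem_top
    rw [mem_radP_iff m c h] at h1
    exact e_notMem_jacobson m c h i ((mem_jacobson_iff m c h).2 h1)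
  · intro N hN
    obtain ⟨x, hxN, hx⟩ := SetLike.exists_of_lt hN
    obtain ⟨r, y, hy, hy', hxy⟩ := exists_eq_smul_e_add m c h (e_mul_coe x)
    have hr : r ≠ 0 := by
      rintro rfl
      rw [zero_smul, zero_add] at hxy
      exact hx ((mem_radP_iff m c h).2 (hxy ▸ hy))
    have hyN : (⟨y, mem_P.2 hy'⟩ : P Q m c i) ∈ N := hN.le ((mem_radP_iff m c h).2 hy)
    have h2 := N.smul_mem (algebraMap K (WTAlgebra Q m c)ᵐᵒᵖ r⁻¹) (sub_mem hxN hyN)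
    have h3 : algebraMap K (WTAlgebra Q m c)ᵐᵒᵖ r⁻¹ • (x - (⟨y, mem_P.2 hy'⟩ : P Q m c i)) =
        ⟨e Q m c i, e_mem_P m c i⟩ := by
      apply Subtype.ext
      change algebraMap K (WTAlgebra Q m c)ᵐᵒᵖ r⁻¹ • ((x : WTAlgebra Q m c) - y) = e Q m c i
      rw [algebraMap_smul, hxy, add_sub_cancel_right, smul_smul, inv_mul_cancel₀ hr, one_smul]
    rw [h3] at h2
    rw [eq_top_iff]
    rintro z -
    have h4 := N.smul_mem (op (z : WTAlgebra Q m c)) h2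
    rwa [show op (z : WTAlgebra Q m c) • (⟨e Q m c i, e_mem_P m c i⟩ : P Q m c i) = z from
      Subtype.ext (e_mul_coe z)] at h4

theorem isSimpleModule_S [Finite A] (h : ∀ a, 3 ≤ Q.wt m a) (i : V) :
    IsSimpleModule (WTAlgebra Q m c)ᵐᵒᵖ (S Q m c i) :=
  isSimpleModule_iff_isCoatom.2 (isCoatom_radP m c h i)

/-- As the `e_i` sum to `1`, one of them moves a given `v ≠ 0` to a nonzero vector. This defines a
surjection `P_i → M` whose kernel is maximal and contains the maximal submodule `radP`. -/
theorem exists_equiv_S [Finite A] (h : ∀ a, 3 ≤ Q.wt m a) (M : Type*) [AddCommGroup M]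
    [Module (WTAlgebra Q m c)ᵐᵒᵖ M] [IsSimpleModule (WTAlgebra Q m c)ᵐᵒᵖ M] :
    ∃ i, Nonempty (S Q m c i ≃ₗ[(WTAlgebra Q m c)ᵐᵒᵖ] M) := by
  have := IsSimpleModule.nontrivial (WTAlgebra Q m c)ᵐᵒᵖ M
  obtain ⟨v, hv⟩ := exists_ne (0 : M)
  have h1 : ∃ i, op (e Q m c i) • v ≠ 0 := by
    by_contra! h0
    apply hv
    rw [← one_smul (WTAlgebra Q m c)ᵐᵒᵖ v, ← op_one, ← sum_e, Finset.op_sum, Finset.sum_smul]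
    exact Finset.sum_eq_zero fun i _ => h0 i
  obtain ⟨i, hi⟩ := h1
  let φ : P Q m c i →ₗ[(WTAlgebra Q m c)ᵐᵒᵖ] M :=
    { toFun := fun x => op (x : WTAlgebra Q m c) • v
      map_add' := fun x y => by rw [← add_smul]; rfl
      map_smul' := fun r x => by rw [RingHom.id_apply, ← mul_smul]; rfl }
  have hφ : Function.Surjective φ := by
    refine LinearMap.range_eq_top.1 ((IsSimpleOrder.eq_bot_or_eq_top _).resolve_left fun hb => hi ?_)
    have h2 : φ ⟨e Q m c i, e_mem_P m c i⟩ ∈ LinearMap.range φ := ⟨_, rfl⟩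
    rwa [hb, Submodule.mem_bot] at h2
  have hco : IsCoatom (LinearMap.ker φ) := by
    rw [← isSimpleModule_iff_isCoatom]
    exact IsSimpleModule.congr (φ.quotKerEquivOfSurjective hφ)
  have hle : radP Q m c i ≤ LinearMap.ker φ := fun x hx =>
    (Submodule.mem_sInf.1 (mem_jacobson_P m c h ((mem_radP_iff m c h).1 hx))) _ hco
  have heq : radP Q m c i = LinearMap.ker φ :=
    ((isCoatom_radP m c h i).le_iff.1 hle).resolve_left hco.1 |>.symm
  exact ⟨i, ⟨(Submodule.quotEquivOfEq _ _ heq).trans (φ.quotKerEquivOfSurjective hφ)⟩⟩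

/-- The arrows annihilate the simple modules. -/
theorem arrow_smul_S [Finite A] (h : ∀ a, 3 ≤ Q.wt m a) {i : V} (x : S Q m c i)
    {y : WTAlgebra Q m c} (hy : y ∈ arrowFiltration m c 1) : op y • x = 0 := by
  obtain ⟨x, rfl⟩ := Submodule.Quotient.mk_surjective _ x
  rw [← Submodule.Quotient.mk_smul, Submodule.Quotient.mk_eq_zero, mem_radP_iff m c h]
  exact mul_mem_arrowFiltration_left h _ hy

end WTAlgebra

/-! ### Splicing -/

section Homological

variable {R : Type u} [Ring R]

theorem IsProjectiveCover.of_ker_le_jacobson {P M : Type*} [AddCommGroup P] [Module R P]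
    [AddCommGroup M] [Module R M] [Module.Projective R P] [Module.Finite R P] {p : P →ₗ[R] M}
    (hp : Function.Surjective p) (hk : LinearMap.ker p ≤ Module.jacobson R P) :
    IsProjectiveCover p :=
  ⟨inferInstance, hp, IsSuperfluous.of_le_jacobson hk⟩

theorem IsProjectiveCover.rangeRestrict_of_ker_le_jacobson {P M : Type*} [AddCommGroup P]
    [Module R P] [AddCommGroup M] [Module R M] [Module.Projective R P] [Module.Finite R P]
    {p : P →ₗ[R] M} (hk : LinearMap.ker p ≤ Module.jacobson R P) :
    IsProjectiveCover p.rangeRestrict :=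
  .of_ker_le_jacobson p.surjective_rangeRestrict (by rwa [LinearMap.ker_rangeRestrict])

theorem IsMinimalProjectiveResolution.splice {P₀ P₁ P₂ P₃ : ModuleCat.{v} R} {S : Type*}
    [AddCommGroup S] [Module R S]
    {ι : S →ₗ[R] P₃} {π₃ : P₃ →ₗ[R] P₂} {π₂ : P₂ →ₗ[R] P₁} {π₁ : P₁ →ₗ[R] P₀} {ε : P₀ →ₗ[R] S}
    (hι : Function.Injective ι) (h₃ : Function.Exact ι π₃) (h₂ : Function.Exact π₃ π₂)
    (h₁ : Function.Exact π₂ π₁) (h₀ : Function.Exact π₁ ε) (hε : Function.Surjective ε)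
    (cε : IsProjectiveCover ε) (c₁ : IsProjectiveCover π₁.rangeRestrict)
    (c₂ : IsProjectiveCover π₂.rangeRestrict) (c₃ : IsProjectiveCover π₃.rangeRestrict)
    (cι : IsProjectiveCover (ι ∘ₗ ε).rangeRestrict) :
    IsMinimalProjectiveResolution (spliceObj P₀ P₁ P₂ P₃) (spliceMap ι π₃ π₂ π₁ ε) ε where
  cover_zero := cε
  cover_succ := by
    -- A window of four consecutive differentials is shifted one place at a time; the differential
    -- entering it is, by definition, the one leaving it.
    have key : ∀ n, IsProjectiveCover (spliceMap ι π₃ π₂ π₁ ε n).rangeRestrict ∧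
        IsProjectiveCover (spliceMap ι π₃ π₂ π₁ ε (n + 1)).rangeRestrict ∧
        IsProjectiveCover (spliceMap ι π₃ π₂ π₁ ε (n + 2)).rangeRestrict ∧
        IsProjectiveCover (spliceMap ι π₃ π₂ π₁ ε (n + 3)).rangeRestrict := by
      intro n
      induction n with
      | zero => exact ⟨c₁, c₂, c₃, cι⟩
      | succ n ih => exact ⟨ih.2.1, ih.2.2.1, ih.2.2.2, ih.1⟩
    exact fun n => (key n).1
  exact_zero := h₀
  exact_succ := by
    have e₃ : Function.Exact (ι ∘ₗ ε) π₃ := by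
      intro y
      rw [h₃ y]
      constructor
      · rintro ⟨x, rfl⟩
        obtain ⟨z, rfl⟩ := hε x
        exact ⟨z, rfl⟩
      · rintro ⟨z, rfl⟩
        exact ⟨ε z, rfl⟩
    have e₄ : Function.Exact π₁ (ι ∘ₗ ε) := by
      intro y
      rw [← h₀ y, LinearMap.comp_apply, map_eq_zero_iff ι hι]
    have key : ∀ n,
        Function.Exact (spliceMap ι π₃ π₂ π₁ ε (n + 1)) (spliceMap ι π₃ π₂ π₁ ε n) ∧
        Function.Exact (spliceMap ι π₃ π₂ π₁ ε (n + 2)) (spliceMap ι π₃ π₂ π₁ ε (n + 1)) ∧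
        Function.Exact (spliceMap ι π₃ π₂ π₁ ε (n + 3)) (spliceMap ι π₃ π₂ π₁ ε (n + 2)) ∧
        Function.Exact (spliceMap ι π₃ π₂ π₁ ε (n + 4)) (spliceMap ι π₃ π₂ π₁ ε (n + 3)) := by
      intro n
      induction n with
      | zero => exact ⟨h₁, h₂, e₃, e₄⟩
      | succ n ih => exact ⟨ih.2.1, ih.2.2.1, ih.2.2.2, ih.1⟩
    exact fun n => (key n).1

end Homological

/-! ### Exactness by counting dimensions. -/

/-- In a sequence `0 → S → P₃ → P₂ → P₁ → P₀ → S → 0` of vector spaces of suitable dimensions,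
exactness at `P₂` follows from exactness at the other places. -/
theorem Function.Exact.of_finrank_eq {K : Type*} [Field K] {S P₃ P₂ P₁ P₀ : Type*}
    [AddCommGroup S] [Module K S] [AddCommGroup P₃] [Module K P₃] [AddCommGroup P₂] [Module K P₂]
    [AddCommGroup P₁] [Module K P₁] [AddCommGroup P₀] [Module K P₀]
    [FiniteDimensional K P₃] [FiniteDimensional K P₂] [FiniteDimensional K P₁]
    [FiniteDimensional K P₀]
    {ι : S →ₗ[K] P₃} {π₃ : P₃ →ₗ[K] P₂} {π₂ : P₂ →ₗ[K] P₁} {π₁ : P₁ →ₗ[K] P₀} {ε : P₀ →ₗ[K] S}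
    (hι : Function.Injective ι) (h₃ : Function.Exact ι π₃) (h₂ : ∀ x, π₂ (π₃ x) = 0)
    (h₁ : Function.Exact π₂ π₁) (h₀ : Function.Exact π₁ ε) (hε : Function.Surjective ε)
    (d₀₃ : Module.finrank K P₀ = Module.finrank K P₃)
    (d₁₂ : Module.finrank K P₁ = Module.finrank K P₂) : Function.Exact π₃ π₂ := by
  have := FiniteDimensional.of_injective ι hι
  rw [LinearMap.exact_iff]
  have n₃ := π₃.finrank_range_add_finrank_ker
  have n₂ := π₂.finrank_range_add_finrank_ker
  have n₁ := π₁.finrank_range_add_finrank_ker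
  have n₀ := ε.finrank_range_add_finrank_ker
  rw [LinearMap.exact_iff.1 h₃, LinearMap.finrank_range_of_inj hι] at n₃
  rw [LinearMap.exact_iff.1 h₁] at n₁
  rw [LinearMap.exact_iff.1 h₀, LinearMap.range_eq_top.2 hε, finrank_top] at n₀
  refine (Submodule.eq_of_le_of_finrank_eq ?_ ?_).symm
  · rintro _ ⟨x, rfl⟩
    exact h₂ x
  -- Both dimensions are `dim P₀ - dim S`: the rank of `π₃` because `dim P₃ = dim P₀`, the kernel of
  -- `π₂` because `dim P₂ = dim P₁`.
  · omega

/-- The variant of `Function.Exact.of_finrank_eq` for modules over a `K`-algebra. -/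
theorem Function.Exact.of_finrank_eq_of_algebra (K : Type*) [Field K] {R : Type*} [Ring R]
    [Algebra K R] {S P₃ P₂ P₁ P₀ : Type*}
    [AddCommGroup S] [Module K S] [Module R S] [IsScalarTower K R S]
    [AddCommGroup P₃] [Module K P₃] [Module R P₃] [IsScalarTower K R P₃]
    [AddCommGroup P₂] [Module K P₂] [Module R P₂] [IsScalarTower K R P₂]
    [AddCommGroup P₁] [Module K P₁] [Module R P₁] [IsScalarTower K R P₁]
    [AddCommGroup P₀] [Module K P₀] [Module R P₀] [IsScalarTower K R P₀]
    [FiniteDimensional K P₃] [FiniteDimensional K P₂] [FiniteDimensional K P₁]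
    [FiniteDimensional K P₀]
    {ι : S →ₗ[R] P₃} {π₃ : P₃ →ₗ[R] P₂} {π₂ : P₂ →ₗ[R] P₁} {π₁ : P₁ →ₗ[R] P₀} {ε : P₀ →ₗ[R] S}
    (hι : Function.Injective ι) (h₃ : Function.Exact ι π₃) (h₂ : ∀ x, π₂ (π₃ x) = 0)
    (h₁ : Function.Exact π₂ π₁) (h₀ : Function.Exact π₁ ε) (hε : Function.Surjective ε)
    (d₀₃ : Module.finrank K P₀ = Module.finrank K P₃)
    (d₁₂ : Module.finrank K P₁ = Module.finrank K P₂) : Function.Exact π₃ π₂ :=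
  Function.Exact.of_finrank_eq (K := K) (ι := ι.restrictScalars K) (π₃ := π₃.restrictScalars K)
    (π₂ := π₂.restrictScalars K) (π₁ := π₁.restrictScalars K) (ε := ε.restrictScalars K)
    hι h₃ h₂ h₁ h₀ hε d₀₃ d₁₂

namespace WTAlgebra

open PathAlgebra TriangulationQuiver MulOpposite

variable {K : Type uK} [Field K] {V : Type uV} {A : Type uA} [Fintype V]
  {Q : TriangulationQuiver V A} (m : Q.Orbits → ℕ+) (c : Q.Orbits → Kˣ)

/-! ### The middle of the resolution -/

/-- The path `A_a` without its first arrow `a`. -/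
noncomputable def tail (a : A) : WTAlgebra Q m c := run m c (Q.g a) (Q.wt m a - 2)

theorem run_one_mul_tail (h : ∀ a, 3 ≤ Q.wt m a) (a : A) :
    run m c a 1 * tail m c a = run m c a (Q.wt m a - 1) := by
  rw [tail, run_one_mul_run]
  congr 1
  have := h a
  omega

theorem tail_mul_f_f [Finite A] (h : ∀ a, 3 ≤ Q.wt m a) (a : A) :
    tail m c a * run m c (Q.f (Q.f (Q.bar a))) 1 = run m c (Q.g a) (Q.wt m a - 1) := by
  rw [tail, run_mul_run_of_eq m c 1 (iterate_g_eq m h a).symm]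
  congr 1
  have := h a
  omega

theorem run_f_mul_f_f (h : ∀ a, 3 ≤ Q.wt m a) (a : A) :
    run m c (Q.f a) 1 * run m c (Q.f (Q.f a)) 1 =
      (c (Q.orbit a) : K) • run m c (Q.g a) (Q.wt m a - 1) := by
  rw [run_mul_f m c h, ← g_apply, orbit_g, wt_g]

theorem e_mul_tail (a : A) : e Q m c (Q.t a) * tail m c a = tail m c a :=
  e_mul_run_of_eq m c (Q.s_g a) _

theorem tail_mul_e [Finite A] (h : ∀ a, 3 ≤ Q.wt m a) (a : A) :
    tail m c a * e Q m c (Q.t (Q.f (Q.bar a))) = tail m c a :=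
  run_mul_e_of_eq m c (by rw [iterate_g_eq m h, Q.s_f])

/-- The tail has length at least two, and `g(f(ā))` is an `f`-step after its last arrow. -/
theorem tail_mul_g_f_of_four_le [Finite A] (h : ∀ a, 3 ≤ Q.wt m a) {a : A}
    (ha : 4 ≤ Q.wt m a) : tail m c a * run m c (Q.g (Q.f (Q.bar a))) 1 = 0 := by
  refine run_mul_f_eq_zero m c h (by omega) ?_
  have h1 := iterate_g_eq m h a
  rw [show Q.wt m a - 2 = Q.wt m a - 2 - 1 + 1 by omega, Function.iterate_succ_apply'] at h1
  rw [← Q.bar_f_f, ← h1, Q.bar_g]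

/-- Here the tail is the single arrow `g(a)`, so the `f`-step gives a multiple of `A_{f(a)}` instead
of zero. This is the origin of the exceptional case. -/
theorem tail_mul_g_f_of_eq_three [Finite A] (h : ∀ a, 3 ≤ Q.wt m a) {a : A}
    (ha : Q.wt m a = 3) : tail m c a * run m c (Q.g (Q.f (Q.bar a))) 1 =
      (c (Q.orbit (Q.f a)) : K) • run m c (Q.f a) (Q.wt m (Q.f a) - 1) := by
  rw [tail, ha, g_f_bar_eq m ha, run_mul_f m c h, Q.bar_g]

theorem tail_mul_run_two [Finite A] (h : ∀ a, 3 ≤ Q.wt m a) (a : A) :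
    tail m c a * run m c (Q.g (Q.f (Q.bar a))) 2 = 0 := by
  rcases (h a).eq_or_lt with ha | ha
  · rw [tail, ← ha, g_f_bar_eq m ha.symm]
    exact run_one_mul_run_f m c (Q.g a) 0
  · rw [← run_one_mul_run, ← mul_assoc, tail_mul_g_f_of_four_le m c h ha, zero_mul]

/-- The matrix of `π₂`, as an endomorphism of `Λ ⊕ Λ`. -/
noncomputable def middle (a : A) : WTAlgebra Q m c × WTAlgebra Q m c →ₗ[(WTAlgebra Q m c)ᵐᵒᵖ]
    WTAlgebra Q m c × WTAlgebra Q m c where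
  toFun p := (run m c (Q.f a) 1 * p.1 - (c (Q.orbit a) : K) • (tail m c a * p.2),
    run m c (Q.f (Q.bar a)) 1 * p.2 - (c (Q.orbit (Q.bar a)) : K) • (tail m c (Q.bar a) * p.1))
  map_add' p q := by
    ext
    · simp only [Prod.fst_add, Prod.snd_add, mul_add, smul_add]; abel
    · simp only [Prod.fst_add, Prod.snd_add, mul_add, smul_add]; abel
  map_smul' r p := by
    ext
    · simp only [Prod.smul_fst, Prod.smul_snd, mul_smul_comm, smul_sub, RingHom.id_apply,
        smul_comm r]
    · simp only [Prod.smul_fst, Prod.smul_snd, mul_smul_comm, smul_sub, RingHom.id_apply,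
        smul_comm r]

theorem middle_apply (a : A) (u v : WTAlgebra Q m c) : middle m c a (u, v) =
    (run m c (Q.f a) 1 * u - (c (Q.orbit a) : K) • (tail m c a * v),
      run m c (Q.f (Q.bar a)) 1 * v - (c (Q.orbit (Q.bar a)) : K) • (tail m c (Q.bar a) * u)) :=
  rfl

/-- Exchanging `a` and `ā` swaps the rows and the columns of the matrix, so statements about one
component transfer to the other. -/
theorem mem_range_middle_swap {a : A} {x y : WTAlgebra Q m c}
    (hx : (x, y) ∈ LinearMap.range (middle m c (Q.bar a))) :
    (y, x) ∈ LinearMap.range (middle m c a) := by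
  obtain ⟨⟨u, v⟩, huv⟩ := hx
  refine ⟨(v, u), ?_⟩
  rw [middle_apply, Q.bar_bar] at huv
  rw [middle_apply, ← (Prod.mk.inj huv).1, ← (Prod.mk.inj huv).2]

/-- Each column of the matrix is a relation `a f(a) = c_ā ā tail(ā)` with the first arrows removed,
so multiplying them back gives zero. -/
theorem arrow_mul_middle (h : ∀ a, 3 ≤ Q.wt m a) (a : A) (p : WTAlgebra Q m c × WTAlgebra Q m c) :
    run m c a 1 * (middle m c a p).1 + run m c (Q.bar a) 1 * (middle m c a p).2 = 0 := by
  obtain ⟨u, v⟩ := p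
  rw [middle_apply]
  simp only [mul_sub, mul_smul_comm, ← mul_assoc]
  rw [run_mul_f m c h, run_mul_f m c h, run_one_mul_tail m c h, run_one_mul_tail m c h, Q.bar_bar,
    smul_mul_assoc, smul_mul_assoc]
  abel

/-- Each row is a relation with the last arrows removed: `f(a) f²(a) = c_a A_{g(a)} = c_a tail(a)
f²(ā)`. -/
theorem middle_mul_arrow [Finite A] (h : ∀ a, 3 ≤ Q.wt m a) (a : A) (z : WTAlgebra Q m c) :
    middle m c a (run m c (Q.f (Q.f a)) 1 * z, run m c (Q.f (Q.f (Q.bar a))) 1 * z) = 0 := by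
  have h1 := tail_mul_f_f m c h (Q.bar a)
  rw [Q.bar_bar] at h1
  rw [middle_apply]
  simp only [← mul_assoc]
  rw [run_f_mul_f_f m c h, run_f_mul_f_f m c h, h1, tail_mul_f_f m c h, smul_mul_assoc,
    smul_mul_assoc, sub_self, sub_self]
  rfl

theorem smul_mem_range_middle {a : A} {x y : WTAlgebra Q m c}
    (hx : (x, y) ∈ LinearMap.range (middle m c a)) (w : WTAlgebra Q m c) :
    (x * w, y * w) ∈ LinearMap.range (middle m c a) :=
  Submodule.smul_mem _ (op w) hx

theorem middle_g_f (a : A) : middle m c a (run m c (Q.g (Q.f a)) 1, 0) =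
    (run m c (Q.f a) 2, -((c (Q.orbit (Q.bar a)) : K) •
      (tail m c (Q.bar a) * run m c (Q.g (Q.f a)) 1))) := by
  rw [middle_apply, run_one_mul_run, mul_zero, mul_zero, smul_zero, sub_zero, zero_sub]

theorem run_three_mem_range_middle [Finite A] (h : ∀ a, 3 ≤ Q.wt m a) (a : A) {k : ℕ}
    (hk : 3 ≤ k) : (run m c (Q.f a) k, 0) ∈ LinearMap.range (middle m c a) := by
  obtain ⟨k, rfl⟩ := Nat.exists_eq_add_of_le hk
  have h1 := tail_mul_run_two m c h (Q.bar a)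
  rw [Q.bar_bar] at h1
  have h2 : (run m c (Q.f a) 3, 0) ∈ LinearMap.range (middle m c a) := by
    refine ⟨(run m c (Q.g (Q.f a)) 2, 0), ?_⟩
    rw [middle_apply, run_one_mul_run, h1, mul_zero, mul_zero, smul_zero, smul_zero, sub_zero,
      sub_zero]
  have h3 := smul_mem_range_middle m c h2 (run m c (Q.g^[3] (Q.f a)) k)
  rwa [run_mul_run, zero_mul] at h3

theorem run_two_mem_of_four_le [Finite A] (h : ∀ a, 3 ≤ Q.wt m a) {a : A}
    (ha : 4 ≤ Q.wt m (Q.bar a)) : (run m c (Q.f a) 2, 0) ∈ LinearMap.range (middle m c a) := by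
  refine ⟨(run m c (Q.g (Q.f a)) 1, 0), ?_⟩
  have h1 := tail_mul_g_f_of_four_le m c h ha
  rw [Q.bar_bar] at h1
  rw [middle_g_f, h1, smul_zero, neg_zero]

/-- The image of `(g(f(a)), 0)` is the desired element up to a multiple of `(0, A_{f(ā)})`, which
may be subtracted when it lies in the image. -/
theorem run_two_mem_of_eq_three [Finite A] (h : ∀ a, 3 ≤ Q.wt m a) {a : A}
    (ha : Q.wt m (Q.bar a) = 3)
    (hmem : (0, run m c (Q.f (Q.bar a)) (Q.wt m (Q.f (Q.bar a)) - 1)) ∈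
      LinearMap.range (middle m c a)) :
    (run m c (Q.f a) 2, 0) ∈ LinearMap.range (middle m c a) := by
  have h1 := tail_mul_g_f_of_eq_three m c h ha
  rw [Q.bar_bar] at h1
  have h2 := middle_g_f m c a
  rw [h1, smul_smul] at h2
  have h3 := smul_mem_range_middle m c hmem (algebraMap K _
    ((c (Q.orbit (Q.bar a)) : K) * (c (Q.orbit (Q.f (Q.bar a))) : K)))
  rw [zero_mul, ← Algebra.commutes, ← Algebra.smul_def] at h3
  have h4 := add_mem (⟨_, h2⟩ : _ ∈ LinearMap.range (middle m c a)) h3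
  rwa [Prod.mk_add_mk, add_zero, neg_add_cancel] at h4

/-- The weights are examined in the order `ā`, `f(ā)`, `a`, `f(a)`. A weight three passes the
question on, either to `A_{f(ā)}` or to `A_{f(a)}`. A weight at least four answers it: for `ā` or
`a` the disturbing term vanishes, and for `f(ā)` or `f(a)` the disturbing run has length at least
three. So the chain fails only if all four are three. -/
theorem run_two_mem_range_middle [Finite A] (h : ∀ a, 3 ≤ Q.wt m a) (a : A)
    (hne : ¬ (Q.wt m a = 3 ∧ Q.wt m (Q.bar a) = 3 ∧ Q.wt m (Q.f a) = 3 ∧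
      Q.wt m (Q.f (Q.bar a)) = 3)) :
    (run m c (Q.f a) 2, 0) ∈ LinearMap.range (middle m c a) := by
  rcases (h (Q.bar a)).eq_or_lt with h1 | h1
  · refine run_two_mem_of_eq_three m c h h1.symm (mem_range_middle_swap m c ?_)
    rcases (h (Q.f (Q.bar a))).eq_or_lt with h2 | h2
    · rw [← h2]
      rcases (h a).eq_or_lt with h3 | h3
      · refine run_two_mem_of_eq_three m c h (by rw [Q.bar_bar, h3])
          (mem_range_middle_swap m c ?_)
        rw [Q.bar_bar]
        refine run_three_mem_range_middle m c h a ?_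
        rcases (h (Q.f a)).eq_or_lt with h4 | h4
        · exact absurd ⟨h3.symm, h1.symm, h4.symm, h2.symm⟩ hne
        · omega
      · exact run_two_mem_of_four_le m c h (by rw [Q.bar_bar]; exact h3)
    · exact run_three_mem_range_middle m c h (Q.bar a) (by omega)
  · exact run_two_mem_of_four_le m c h h1

theorem exists_sum_run_eq (b : A) (n : ℕ) (Y : ℕ → K) :
    ∃ (ν : K) (w : WTAlgebra Q m c), ∑ k ∈ Finset.range n, Y k • run m c b (k + 1) =
      ν • run m c b 1 + run m c b 2 * w := by
  induction n with
  | zero => exact ⟨0, 0, by simp⟩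
  | succ n ih =>
    obtain ⟨ν, w, hw⟩ := ih
    rw [Finset.sum_range_succ, hw]
    rcases Nat.eq_zero_or_pos n with rfl | hn
    · exact ⟨ν + Y 0, w, by rw [add_smul]; abel⟩
    · obtain ⟨n, rfl⟩ := Nat.exists_eq_add_of_le' hn
      refine ⟨ν, w + Y (n + 1) • run m c (Q.g^[2] b) n, ?_⟩
      rw [mul_add, mul_smul_comm, run_mul_run, add_assoc, add_comm 2 n]

/-- Elements of `e_{t(a)} Λ` modulo `f(a) g(f(a)) Λ`. -/
theorem exists_eq_sum_add [Finite A] (h : ∀ a, 3 ≤ Q.wt m a) (a : A) {x : WTAlgebra Q m c}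
    (hx : e Q m c (Q.t a) * x = x) : ∃ (X : ℕ → K) (ν : K) (w : WTAlgebra Q m c),
      x = ∑ k ∈ Finset.range (Q.wt m a), X k • run m c (Q.g a) k + ν • run m c (Q.f a) 1 +
        run m c (Q.f a) 2 * w := by
  rw [← Q.s_g] at hx
  obtain ⟨X, Y, rfl⟩ := exists_comb m c h (Q.g a) hx
  obtain ⟨ν, w, hw⟩ := exists_sum_run_eq m c (Q.f a) (Q.wt m (Q.f a)) Y
  refine ⟨X, ν, w, ?_⟩
  rw [comb_apply, Q.bar_g, hw, wt_g, add_assoc]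

/-- Multiplying by `a` and `ā` lengthens each run by one. By independence only the longest runs can
cancel, through the proportionality of `B_a` and `B_ā`, and the resulting one-parameter family is
the image of the multiples of `(f²(a), 0)`. -/
theorem mem_range_middle_of_sum [Finite A] (h : ∀ a, 3 ≤ Q.wt m a) (a : A) (X Y : ℕ → K)
    (h0 : run m c a 1 * ∑ k ∈ Finset.range (Q.wt m a), X k • run m c (Q.g a) k +
      run m c (Q.bar a) 1 * ∑ k ∈ Finset.range (Q.wt m (Q.bar a)),
        Y k • run m c (Q.g (Q.bar a)) k = 0) :
    (∑ k ∈ Finset.range (Q.wt m a), X k • run m c (Q.g a) k,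
      ∑ k ∈ Finset.range (Q.wt m (Q.bar a)), Y k • run m c (Q.g (Q.bar a)) k) ∈
        LinearMap.range (middle m c a) := by
  simp only [Finset.mul_sum, mul_smul_comm, run_one_mul_run] at h0
  obtain ⟨n, hn⟩ := Nat.exists_eq_add_of_le' (show 1 ≤ Q.wt m a from by linarith [h a])
  obtain ⟨l, hl⟩ := Nat.exists_eq_add_of_le'
    (show 1 ≤ Q.wt m (Q.bar a) from by linarith [h (Q.bar a)])
  have hwt := run_wt_eq m c h a
  rw [hn, hl] at hwt
  set κ : K := (((c (Q.orbit a))⁻¹ : Kˣ) * c (Q.orbit (Q.bar a)) : K) with hκ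
  -- Coordinates of the given relation: indices shift by one, and the term at `B_a` is moved to the
  -- last coordinate through `B_a = κ B_ā`.
  have h1 : comb m c a (fun k => if k = 0 then 0 else X (k - 1),
      fun k => Y k + if k = l then X n * κ else 0) = 0 := by
    rw [← h0, comb_apply, hn, hl, Finset.sum_range_succ', Finset.sum_range_succ,
      Finset.sum_range_succ (fun k => X k • run m c a (k + 1)),
      Finset.sum_range_succ (fun k => Y k • run m c (Q.bar a) (k + 1)), hwt]
    have h2 : ∑ k ∈ Finset.range l, (Y k + if k = l then X n * κ else 0) •
        run m c (Q.bar a) (k + 1) = ∑ k ∈ Finset.range l, Y k • run m c (Q.bar a) (k + 1) :=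
      Finset.sum_congr rfl fun k hk => by
        rw [if_neg (Finset.mem_range.1 hk).ne, add_zero]
    rw [h2]
    simp only [Nat.succ_ne_zero, if_false, if_true, Nat.add_sub_cancel, zero_smul, add_zero,
      add_smul, smul_smul]
    abel
  obtain ⟨h3, h4⟩ := comb_eq_zero m c h a h1
  have hX : ∀ k < n, X k = 0 := fun k hk => by
    simpa using h3 (k + 1) (by omega)
  have hY : ∀ k < l, Y k = 0 := fun k hk => by
    simpa [hk.ne] using h4 k (by omega)
  have hYl : Y l = - (X n * κ) := by
    have := h4 l (by omega)
    rw [if_pos rfl] at this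
    exact eq_neg_of_add_eq_zero_left this
  have hXs : ∑ k ∈ Finset.range (Q.wt m a), X k • run m c (Q.g a) k = X n • run m c (Q.g a) n := by
    rw [hn, Finset.sum_range_succ, Finset.sum_eq_zero, zero_add]
    exact fun k hk => by rw [hX k (Finset.mem_range.1 hk), zero_smul]
  have hYs : ∑ k ∈ Finset.range (Q.wt m (Q.bar a)), Y k • run m c (Q.g (Q.bar a)) k =
      Y l • run m c (Q.g (Q.bar a)) l := by
    rw [hl, Finset.sum_range_succ, Finset.sum_eq_zero, zero_add]
    exact fun k hk => by rw [hY k (Finset.mem_range.1 hk), zero_smul]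
  rw [hXs, hYs, hYl]
  -- As `f(a) f²(a)` is `c_a` times the longest run of `g(a)`, dividing by `c_a` produces `X n` in
  -- the first component and `-X n κ` in the second.
  refine ⟨((X n * ((c (Q.orbit a))⁻¹ : Kˣ) : K) • run m c (Q.f (Q.f a)) 1, 0), ?_⟩
  have h5 := tail_mul_f_f m c h (Q.bar a)
  rw [Q.bar_bar] at h5
  rw [middle_apply, mul_smul_comm, mul_smul_comm, run_f_mul_f_f m c h, h5, hn, hl,
    Nat.add_sub_cancel, Nat.add_sub_cancel, mul_zero, mul_zero, smul_zero, sub_zero, zero_sub,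
    smul_smul, smul_smul, mul_assoc, Units.inv_mul, mul_one, ← neg_smul]
  congr 3
  rw [hκ]
  ring

/-- Exactness at `P_{t(a)} ⊕ P_{t(ā)}`. -/
theorem mem_range_middle [Finite A] (h : ∀ a, 3 ≤ Q.wt m a) (a : A)
    (hne : ¬ (Q.wt m a = 3 ∧ Q.wt m (Q.bar a) = 3 ∧ Q.wt m (Q.f a) = 3 ∧
      Q.wt m (Q.f (Q.bar a)) = 3)) {x y : WTAlgebra Q m c}
    (hx : e Q m c (Q.t a) * x = x) (hy : e Q m c (Q.t (Q.bar a)) * y = y)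
    (hxy : run m c a 1 * x + run m c (Q.bar a) 1 * y = 0) :
    (x, y) ∈ LinearMap.range (middle m c a) := by
  obtain ⟨X, ν, w, rfl⟩ := exists_eq_sum_add m c h a hx
  obtain ⟨Y, ν', w', rfl⟩ := exists_eq_sum_add m c h (Q.bar a) hy
  -- Subtracting `t1` and `t2` removes all runs of `f(a)`, `f(ā)` of length at least two.
  -- Subtracting `t3` then removes these arrows themselves, at the cost of multiples of the two
  -- tails.
  have t1 := smul_mem_range_middle m c (run_two_mem_range_middle m c h a hne) w
  have t2 := smul_mem_range_middle m c (mem_range_middle_swap m c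
    (run_two_mem_range_middle m c h (Q.bar a) (by rw [Q.bar_bar]; tauto))) w'
  have t3 : middle m c a (ν • 1, ν' • 1) ∈ LinearMap.range (middle m c a) := ⟨_, rfl⟩
  have ha := h a
  have hb := h (Q.bar a)
  -- A tail is the run of `g(b)` of length `m_b n_b - 2`, so it only changes that coefficient.
  have sumX : ∀ (b : A) (Z : ℕ → K) (μ : K), 3 ≤ Q.wt m b →
      ∑ k ∈ Finset.range (Q.wt m b), (Z k + if k = Q.wt m b - 2 then μ else 0) •
        run m c (Q.g b) k =
      ∑ k ∈ Finset.range (Q.wt m b), Z k • run m c (Q.g b) k + μ • tail m c b := by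
    intro b Z μ hb
    simp only [add_smul, Finset.sum_add_distrib, ite_smul, zero_smul]
    rw [Finset.sum_ite_eq', if_pos (Finset.mem_range.2 (by omega)), tail]
  have key : (∑ k ∈ Finset.range (Q.wt m a), X k • run m c (Q.g a) k + ν • run m c (Q.f a) 1 +
        run m c (Q.f a) 2 * w,
      ∑ k ∈ Finset.range (Q.wt m (Q.bar a)), Y k • run m c (Q.g (Q.bar a)) k +
        ν' • run m c (Q.f (Q.bar a)) 1 + run m c (Q.f (Q.bar a)) 2 * w') =
      (∑ k ∈ Finset.range (Q.wt m a),
        (X k + if k = Q.wt m a - 2 then ν' * c (Q.orbit a) else 0) • run m c (Q.g a) k,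
      ∑ k ∈ Finset.range (Q.wt m (Q.bar a)),
        (Y k + if k = Q.wt m (Q.bar a) - 2 then ν * c (Q.orbit (Q.bar a)) else 0) •
          run m c (Q.g (Q.bar a)) k) +
      (middle m c a (ν • 1, ν' • 1) + ((run m c (Q.f a) 2 * w, 0 * w) +
        (0 * w', run m c (Q.f (Q.bar a)) 2 * w'))) := by
    rw [sumX a X _ ha, sumX _ Y _ hb, middle_apply]
    simp only [mul_smul_comm, mul_one, zero_mul, Prod.mk_add_mk, smul_smul,
      mul_comm (c (Q.orbit a) : K), mul_comm (c (Q.orbit (Q.bar a)) : K)]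
    congr 1 <;> abel
  have hT := add_mem t3 (add_mem t1 t2)
  rw [key]
  refine add_mem ?_ hT
  apply mem_range_middle_of_sum m c h
  obtain ⟨p, hp⟩ := hT
  have h1 := arrow_mul_middle m c h a p
  rw [hp] at h1
  have h2 := congrArg Prod.fst key
  have h3 := congrArg Prod.snd key
  rw [Prod.fst_add] at h2
  rw [Prod.snd_add] at h3
  simp only at h2 h3
  rw [h2, h3] at hxy
  rw [mul_add, mul_add, add_add_add_comm, h1, add_zero] at hxy
  exact hxy

/-! ### The socle -/

theorem run_wt_mul [Finite A] (h : ∀ a, 3 ≤ Q.wt m a) (a : A) {x : WTAlgebra Q m c}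
    (hx : x ∈ arrowFiltration m c 1) : run m c a (Q.wt m a) * x = 0 := by
  have h0 : ∀ b k, run m c b (Q.wt m b) * run m c b (k + 1) = 0 := fun b k => by
    rw [run_mul_run_of_eq m c _ (iterate_wt m b).symm, run_eq_zero m c h b (by omega)]
  induction hx using Submodule.span_induction with
  | mem x hx =>
    obtain ⟨b, k, hk, rfl⟩ := hx
    obtain ⟨k, rfl⟩ := Nat.exists_eq_add_of_le' hk
    by_cases hs : Q.s b = Q.s a
    · rcases Q.eq_or_eq_bar hs with rfl | rfl
      · exact h0 b k
      · rw [run_wt_eq m c h, smul_mul_assoc, h0, smul_zero]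
    · exact run_mul_run_of_ne m c (by rwa [iterate_wt])
  | zero => exact mul_zero _
  | add x y _ _ hx hy => rw [mul_add, hx, hy, add_zero]
  | smul r x _ hx => rw [mul_smul_comm, hx, smul_zero]

theorem run_f_f_mul_run_wt [Finite A] (h : ∀ a, 3 ≤ Q.wt m a) (a : A) :
    run m c (Q.f (Q.f a)) 1 * run m c (Q.bar a) (Q.wt m (Q.bar a)) = 0 := by
  have h1 := run_one_mul_run m c (Q.f (Q.f a)) (Q.wt m (Q.bar a))
  rw [Q.g_f_f] at h1
  rw [h1, run_eq_zero m c h]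
  rw [wt_f_f]
  exact Nat.lt_succ_self _

theorem run_f_f_bar_mul_run_wt [Finite A] (h : ∀ a, 3 ≤ Q.wt m a) (a : A) :
    run m c (Q.f (Q.f (Q.bar a))) 1 * run m c (Q.bar a) (Q.wt m (Q.bar a)) = 0 := by
  have h1 := run_f_f_mul_run_wt m c h (Q.bar a)
  rw [Q.bar_bar] at h1
  rw [run_wt_eq m c h, Q.bar_bar, mul_smul_comm, h1, smul_zero]

/-- Exactness at the last `P_i`. -/
theorem eq_smul_run_wt [Finite A] (h : ∀ a, 3 ≤ Q.wt m a) (a : A) {z : WTAlgebra Q m c}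
    (hz : e Q m c (Q.s a) * z = z) (h1 : run m c (Q.f (Q.f a)) 1 * z = 0)
    (h2 : run m c (Q.f (Q.f (Q.bar a))) 1 * z = 0) :
    ∃ r : K, z = r • run m c (Q.bar a) (Q.wt m (Q.bar a)) := by
  obtain ⟨X, Y, rfl⟩ := exists_comb m c h a hz
  -- The complementary run ends in `f²(b̄)`, which annihilates the element from the left; symmetry
  -- of the form brings the two together. Every coordinate except that of `B_ā` is obtained in this
  -- way.
  have key : ∀ b j, j < Q.wt m b → run m c (Q.f (Q.f (Q.bar b))) 1 * comb m c a (X, Y) = 0 →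
      form m c h (comb m c a (X, Y) * run m c (Q.g^[j] b) (Q.wt m b - j)) = 0 := by
    intro b j hj hb
    have h3 : Q.f (Q.f (Q.bar b)) = Q.g^[Q.wt m b - j - 1] (Q.g^[j] b) := by
      rw [← Function.iterate_add_apply, ← iterate_wt_sub_one m b (h b)]
      congr 2
      omega
    rw [form_mul_comm, show Q.wt m b - j = Q.wt m b - j - 1 + 1 by omega,
      ← run_mul_run_of_eq m c 1 h3, mul_assoc, hb, mul_zero, map_zero]
  have hX : ∀ j < Q.wt m a, X j = 0 := by
    intro j hj
    have h3 := form_comb_mul_left m c h a X Y hj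
    rw [key a j hj h2] at h3
    simpa using h3.symm
  have hY : ∀ j, j + 1 < Q.wt m (Q.bar a) → Y j = 0 := by
    intro j hj
    have h3 := form_comb_mul_right m c h a X Y (show j < Q.wt m (Q.bar a) by omega)
    rw [key (Q.bar a) (j + 1) hj (by rwa [Q.bar_bar])] at h3
    simpa using h3.symm
  obtain ⟨l, hl⟩ := Nat.exists_eq_add_of_le'
    (show 1 ≤ Q.wt m (Q.bar a) from by linarith [h (Q.bar a)])
  refine ⟨Y l, ?_⟩
  rw [comb_apply, hl, Finset.sum_range_succ, Finset.sum_eq_zero, Finset.sum_eq_zero, zero_add,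
    zero_add]
  · intro k hk
    rw [hY k (by have := Finset.mem_range.1 hk; omega), zero_smul]
  · intro k hk
    rw [hX k (Finset.mem_range.1 hk), zero_smul]

end WTAlgebra

namespace WTAlgebra

open PathAlgebra TriangulationQuiver MulOpposite

variable {K : Type uK} [Field K] {V : Type uV} {A : Type uA} [Fintype V]
  {Q : TriangulationQuiver V A} (m : Q.Orbits → ℕ+) (c : Q.Orbits → Kˣ)

/-! ### The exact sequence -/

/-- Left multiplication by an element of `e_i Λ`, as a homomorphism `P_j → P_i`. -/
noncomputable def mulP {i : V} (j : V) (y : WTAlgebra Q m c) (hy : e Q m c i * y = y) :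
    P Q m c j →ₗ[(WTAlgebra Q m c)ᵐᵒᵖ] P Q m c i :=
  toP m c y hy ∘ₗ (P Q m c j).subtype

/-- The map `π₁ (x, y) = a x + ā y`. -/
noncomputable def map₁ (a : A) : P Q m c (Q.t a) × P Q m c (Q.t (Q.bar a))
    →ₗ[(WTAlgebra Q m c)ᵐᵒᵖ] P Q m c (Q.s a) :=
  (mulP m c _ (run m c a 1) (e_mul_run m c a 1)).coprod
    (mulP m c _ (run m c (Q.bar a) 1) (e_mul_run_of_eq m c (Q.s_bar a) 1))

theorem coe_map₁ (a : A) (p : P Q m c (Q.t a) × P Q m c (Q.t (Q.bar a))) :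
    (map₁ m c a p : WTAlgebra Q m c) =
      run m c a 1 * (p.1 : WTAlgebra Q m c) + run m c (Q.bar a) 1 * (p.2 : WTAlgebra Q m c) := rfl

theorem e_mul_smul_tail (a : A) (r : K) :
    e Q m c (Q.t a) * (r • tail m c a) = r • tail m c a := by
  rw [mul_smul_comm, e_mul_tail]

/-- The map `π₂` whose matrix is `middle`. -/
noncomputable def map₂ (a : A) : P Q m c (Q.t (Q.f a)) × P Q m c (Q.t (Q.f (Q.bar a)))
    →ₗ[(WTAlgebra Q m c)ᵐᵒᵖ] P Q m c (Q.t a) × P Q m c (Q.t (Q.bar a)) :=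
  ((mulP m c _ (run m c (Q.f a) 1) (e_mul_run_of_eq m c (Q.s_f a) 1)).coprod
    (-mulP m c _ _ (e_mul_smul_tail m c a (c (Q.orbit a))))).prod
  ((-mulP m c _ _ (e_mul_smul_tail m c (Q.bar a) (c (Q.orbit (Q.bar a))))).coprod
    (mulP m c _ (run m c (Q.f (Q.bar a)) 1) (e_mul_run_of_eq m c (Q.s_f (Q.bar a)) 1)))

theorem coe_map₂ (a : A) (p : P Q m c (Q.t (Q.f a)) × P Q m c (Q.t (Q.f (Q.bar a)))) :
    (((map₂ m c a p).1 : WTAlgebra Q m c), ((map₂ m c a p).2 : WTAlgebra Q m c)) =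
      middle m c a (p.1, p.2) := by
  rw [middle_apply]
  refine Prod.ext ?_ ?_
  · change run m c (Q.f a) 1 * (p.1 : WTAlgebra Q m c) +
      -((c (Q.orbit a) : K) • tail m c a * (p.2 : WTAlgebra Q m c)) = _
    rw [smul_mul_assoc, sub_eq_add_neg]
  · change -((c (Q.orbit (Q.bar a)) : K) • tail m c (Q.bar a) * (p.1 : WTAlgebra Q m c)) +
      run m c (Q.f (Q.bar a)) 1 * (p.2 : WTAlgebra Q m c) = _
    rw [smul_mul_assoc, neg_add_eq_sub]

/-- The map `π₃ z = (f²(a) z, f²(ā) z)`. -/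
noncomputable def map₃ (a : A) : P Q m c (Q.s a)
    →ₗ[(WTAlgebra Q m c)ᵐᵒᵖ] P Q m c (Q.t (Q.f a)) × P Q m c (Q.t (Q.f (Q.bar a))) :=
  (mulP m c _ (run m c (Q.f (Q.f a)) 1) (e_mul_run_of_eq m c (Q.s_f _) 1)).prod
    (mulP m c _ (run m c (Q.f (Q.f (Q.bar a))) 1) (e_mul_run_of_eq m c (Q.s_f _) 1))

theorem coe_map₃_fst (a : A) (z : P Q m c (Q.s a)) :
    ((map₃ m c a z).1 : WTAlgebra Q m c) = run m c (Q.f (Q.f a)) 1 * (z : WTAlgebra Q m c) := rfl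

theorem coe_map₃_snd (a : A) (z : P Q m c (Q.s a)) : ((map₃ m c a z).2 : WTAlgebra Q m c) =
    run m c (Q.f (Q.f (Q.bar a))) 1 * (z : WTAlgebra Q m c) := rfl

theorem tail_mem (h : ∀ a, 3 ≤ Q.wt m a) (a : A) : tail m c a ∈ arrowFiltration m c 1 :=
  run_mem_arrowFiltration _ (by have := h a; omega)

variable [Finite A]

/-- The inclusion of the socle `S_i → P_i`. -/
noncomputable def socleMap (h : ∀ a, 3 ≤ Q.wt m a) (a : A) :
    S Q m c (Q.s a) →ₗ[(WTAlgebra Q m c)ᵐᵒᵖ] P Q m c (Q.s a) :=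
  (radP Q m c (Q.s a)).liftQ (mulP m c _ (run m c (Q.bar a) (Q.wt m (Q.bar a)))
    (e_mul_run_of_eq m c (Q.s_bar a) _)) fun _ hx =>
      Subtype.ext (run_wt_mul m c h _ ((mem_radP_iff m c h).1 hx))

theorem coe_socleMap_mk (h : ∀ a, 3 ≤ Q.wt m a) (a : A) (x : P Q m c (Q.s a)) :
    (socleMap m c h a (Submodule.Quotient.mk x) : WTAlgebra Q m c) =
      run m c (Q.bar a) (Q.wt m (Q.bar a)) * (x : WTAlgebra Q m c) := rfl

theorem run_wt_mul_e (a : A) : run m c (Q.bar a) (Q.wt m (Q.bar a)) * e Q m c (Q.s a) =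
    run m c (Q.bar a) (Q.wt m (Q.bar a)) :=
  run_mul_e_of_eq m c (by rw [iterate_wt, Q.s_bar])

theorem injective_socleMap (h : ∀ a, 3 ≤ Q.wt m a) (a : A) :
    Function.Injective (socleMap m c h a) := by
  rw [← LinearMap.ker_eq_bot, LinearMap.ker_eq_bot']
  intro x hx
  obtain ⟨x, rfl⟩ := Submodule.Quotient.mk_surjective _ x
  rw [Submodule.Quotient.mk_eq_zero, mem_radP_iff m c h]
  have h1 : run m c (Q.bar a) (Q.wt m (Q.bar a)) * (x : WTAlgebra Q m c) = 0 :=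
    congrArg Subtype.val hx
  obtain ⟨r, y, hy, -, hxy⟩ := exists_eq_smul_e_add m c h (e_mul_coe x)
  rw [hxy, mul_add, run_wt_mul m c h _ hy, mul_smul_comm, run_wt_mul_e, add_zero, smul_eq_zero] at h1
  rw [hxy, h1.resolve_right (run_ne_zero m c h _ le_rfl), zero_smul, zero_add]
  exact hy

theorem exact_socleMap_map₃ (h : ∀ a, 3 ≤ Q.wt m a) (a : A) :
    Function.Exact (socleMap m c h a) (map₃ m c a) := by
  intro z
  constructor
  · intro hz
    have h1 : run m c (Q.f (Q.f a)) 1 * (z : WTAlgebra Q m c) = 0 :=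
      congrArg (fun p => (p.1 : WTAlgebra Q m c)) hz
    have h2 : run m c (Q.f (Q.f (Q.bar a))) 1 * (z : WTAlgebra Q m c) = 0 :=
      congrArg (fun p => (p.2 : WTAlgebra Q m c)) hz
    obtain ⟨r, hr⟩ := eq_smul_run_wt m c h a (e_mul_coe z) h1 h2
    refine ⟨Submodule.Quotient.mk (r • ⟨e Q m c (Q.s a), e_mem_P m c _⟩), Subtype.ext ?_⟩
    rw [coe_socleMap_mk, hr]
    change _ * (r • e Q m c (Q.s a)) = _
    rw [mul_smul_comm, run_wt_mul_e]
  · rintro ⟨x, rfl⟩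
    obtain ⟨x, rfl⟩ := Submodule.Quotient.mk_surjective _ x
    refine Prod.ext (Subtype.ext ?_) (Subtype.ext ?_)
    · rw [coe_map₃_fst, coe_socleMap_mk, ← mul_assoc, run_f_f_mul_run_wt m c h, zero_mul]
      rfl
    · rw [coe_map₃_snd, coe_socleMap_mk, ← mul_assoc, run_f_f_bar_mul_run_wt m c h, zero_mul]
      rfl

theorem exact_map₂_map₁ (h : ∀ a, 3 ≤ Q.wt m a) (a : A)
    (hne : ¬ (Q.wt m a = 3 ∧ Q.wt m (Q.bar a) = 3 ∧ Q.wt m (Q.f a) = 3 ∧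
      Q.wt m (Q.f (Q.bar a)) = 3)) : Function.Exact (map₂ m c a) (map₁ m c a) := by
  rintro ⟨x, y⟩
  constructor
  · intro hxy
    obtain ⟨⟨u, v⟩, huv⟩ := mem_range_middle m c h a hne (e_mul_coe x) (e_mul_coe y)
      (congrArg Subtype.val hxy)
    -- A preimage in `Λ ⊕ Λ` is projected to the `P`'s by idempotents, which the matrix entries
    -- absorb on their right.
    refine ⟨(toP m c _ (e_mul_e m c _) u, toP m c _ (e_mul_e m c _) v), ?_⟩
    have h1 : ∀ {p q : P Q m c (Q.t a) × P Q m c (Q.t (Q.bar a))},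
        ((p.1 : WTAlgebra Q m c), (p.2 : WTAlgebra Q m c)) = (↑q.1, ↑q.2) → p = q :=
      fun hpq => Prod.ext (Subtype.ext (Prod.mk.inj hpq).1) (Subtype.ext (Prod.mk.inj hpq).2)
    apply h1
    rw [coe_map₂, ← huv, middle_apply, middle_apply]
    have h2 := tail_mul_e m c h (Q.bar a)
    rw [Q.bar_bar] at h2
    simp only [coe_toP, ← mul_assoc]
    rw [run_one_mul_e, run_one_mul_e, tail_mul_e m c h, h2]
  · rintro ⟨p, hp⟩
    apply Subtype.ext
    have h1 := arrow_mul_middle m c h a (p.1, p.2)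
    rw [← coe_map₂, hp] at h1
    exact h1

theorem exact_map₁_mkQ (h : ∀ a, 3 ≤ Q.wt m a) (a : A) :
    Function.Exact (map₁ m c a) (radP Q m c (Q.s a)).mkQ := by
  intro z
  rw [Submodule.mkQ_apply, Submodule.Quotient.mk_eq_zero, mem_radP_iff m c h]
  constructor
  · intro hz
    obtain ⟨u, v, huv⟩ := exists_eq_arrow_mul_add m c a hz (e_mul_coe z)
    refine ⟨(toP m c _ (e_mul_e m c _) u, toP m c _ (e_mul_e m c _) v), Subtype.ext ?_⟩
    rw [coe_map₁, huv, coe_toP, coe_toP, ← mul_assoc, ← mul_assoc, run_one_mul_e, run_one_mul_e]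
  · rintro ⟨p, rfl⟩
    rw [coe_map₁]
    exact add_mem (mul_mem_arrowFiltration_right h _ (run_mem_arrowFiltration a le_rfl))
      (mul_mem_arrowFiltration_right h _ (run_mem_arrowFiltration _ le_rfl))

theorem map₂_map₃ (h : ∀ a, 3 ≤ Q.wt m a) (a : A) (z : P Q m c (Q.s a)) :
    map₂ m c a (map₃ m c a z) = 0 := by
  have h1 := coe_map₂ m c a (map₃ m c a z)
  rw [coe_map₃_fst, coe_map₃_snd, middle_mul_arrow m c h] at h1
  exact Prod.ext (Subtype.ext (Prod.mk.inj h1).1) (Subtype.ext (Prod.mk.inj h1).2)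

/-- Only `π₂ π₃ = 0` is checked by hand. Both middle terms have as dimension the sum of the weights
of `a`, `ā`, `f(a)`, `f(ā)`, so the dimension count applies. -/
theorem exact_map₃_map₂ (h : ∀ a, 3 ≤ Q.wt m a) (a : A)
    (hne : ¬ (Q.wt m a = 3 ∧ Q.wt m (Q.bar a) = 3 ∧ Q.wt m (Q.f a) = 3 ∧
      Q.wt m (Q.f (Q.bar a)) = 3)) : Function.Exact (map₃ m c a) (map₂ m c a) := by
  have := finiteDimensional_P m c h
  have dt : ∀ b, Module.finrank K (P Q m c (Q.t b)) = Q.wt m b + Q.wt m (Q.f b) := by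
    intro b
    rw [← Q.s_g, finrank_P m c h, wt_g, Q.bar_g]
  have dtf : ∀ b, Module.finrank K (P Q m c (Q.t (Q.f b))) =
      Q.wt m (Q.bar b) + Q.wt m (Q.f b) := by
    intro b
    rw [← Q.s_f, finrank_P m c h, wt_f_f, Q.bar_f_f, wt_g]
  have hd : Module.finrank K (P Q m c (Q.t a) × P Q m c (Q.t (Q.bar a))) =
      Module.finrank K (P Q m c (Q.t (Q.f a)) × P Q m c (Q.t (Q.f (Q.bar a)))) := by
    rw [Module.finrank_prod, Module.finrank_prod, dt, dt, dtf, dtf, Q.bar_bar]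
    omega
  exact Function.Exact.of_finrank_eq_of_algebra K (injective_socleMap m c h a)
    (exact_socleMap_map₃ m c h a) (map₂_map₃ m c h a) (exact_map₂_map₁ m c h a hne)
    (exact_map₁_mkQ m c h a) (Submodule.mkQ_surjective _) rfl hd

/-! ### Minimality -/

theorem isProjectiveCover_mkQ (h : ∀ a, 3 ≤ Q.wt m a) (i : V) :
    IsProjectiveCover (radP Q m c i).mkQ :=
  .of_ker_le_jacobson (Submodule.mkQ_surjective _) fun x hx => by
    rw [Submodule.ker_mkQ, mem_radP_iff m c h] at hx
    exact mem_jacobson_P m c h hx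

/-- By exactness the kernel is the image of a matrix whose entries are combinations of runs of
positive length; the other minimality statements for `π₂` and `π₃` follow the same pattern. -/
theorem ker_map₁_le_jacobson (h : ∀ a, 3 ≤ Q.wt m a) (a : A)
    (he : Function.Exact (map₂ m c a) (map₁ m c a)) :
    LinearMap.ker (map₁ m c a) ≤
      Module.jacobson (WTAlgebra Q m c)ᵐᵒᵖ (P Q m c (Q.t a) × P Q m c (Q.t (Q.bar a))) := by
  intro x hx
  obtain ⟨p, rfl⟩ := (he x).1 hx
  have h1 := coe_map₂ m c a p
  rw [middle_apply] at h1
  refine mem_jacobson_P_prod m c h ?_ ?_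
  · rw [(Prod.mk.inj h1).1]
    exact sub_mem (mul_mem_arrowFiltration_right h _ (run_mem_arrowFiltration _ le_rfl))
      (Submodule.smul_mem _ _ (mul_mem_arrowFiltration_right h _ (tail_mem m c h a)))
  · rw [(Prod.mk.inj h1).2]
    exact sub_mem (mul_mem_arrowFiltration_right h _ (run_mem_arrowFiltration _ le_rfl))
      (Submodule.smul_mem _ _ (mul_mem_arrowFiltration_right h _ (tail_mem m c h _)))

theorem ker_map₂_le_jacobson (h : ∀ a, 3 ≤ Q.wt m a) (a : A)
    (he : Function.Exact (map₃ m c a) (map₂ m c a)) :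
    LinearMap.ker (map₂ m c a) ≤
      Module.jacobson (WTAlgebra Q m c)ᵐᵒᵖ (P Q m c (Q.t (Q.f a)) × P Q m c (Q.t (Q.f (Q.bar a)))) := by
  intro x hx
  obtain ⟨z, rfl⟩ := (he x).1 hx
  exact mem_jacobson_P_prod m c h
    (mul_mem_arrowFiltration_right h _ (run_mem_arrowFiltration _ le_rfl))
    (mul_mem_arrowFiltration_right h _ (run_mem_arrowFiltration _ le_rfl))

theorem ker_map₃_le_jacobson (h : ∀ a, 3 ≤ Q.wt m a) (a : A) :
    LinearMap.ker (map₃ m c a) ≤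
      Module.jacobson (WTAlgebra Q m c)ᵐᵒᵖ (P Q m c (Q.s a)) := by
  intro x hx
  obtain ⟨z, rfl⟩ := (exact_socleMap_map₃ m c h a x).1 hx
  obtain ⟨z, rfl⟩ := Submodule.Quotient.mk_surjective _ z
  refine mem_jacobson_P m c h ?_
  rw [coe_socleMap_mk]
  exact mul_mem_arrowFiltration_right h _
    (run_mem_arrowFiltration _ (by have := h (Q.bar a); omega))

theorem ker_socleMap_comp_le_jacobson (h : ∀ a, 3 ≤ Q.wt m a) (a : A) :
    LinearMap.ker (socleMap m c h a ∘ₗ (radP Q m c (Q.s a)).mkQ) ≤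
      Module.jacobson (WTAlgebra Q m c)ᵐᵒᵖ (P Q m c (Q.s a)) := by
  intro x hx
  rw [LinearMap.ker_comp_of_ker_eq_bot _ (LinearMap.ker_eq_bot.2 (injective_socleMap m c h a)),
    Submodule.ker_mkQ, mem_radP_iff m c h] at hx
  exact mem_jacobson_P m c h hx

theorem isMinimalProjectiveResolution (h : ∀ a, 3 ≤ Q.wt m a) (a : A)
    (hne : ¬ (Q.wt m a = 3 ∧ Q.wt m (Q.bar a) = 3 ∧ Q.wt m (Q.f a) = 3 ∧
      Q.wt m (Q.f (Q.bar a)) = 3)) :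
    IsMinimalProjectiveResolution (M := S Q m c (Q.s a))
      (spliceObj
        (ModuleCat.of (WTAlgebra Q m c)ᵐᵒᵖ (P Q m c (Q.s a)))
        (ModuleCat.of (WTAlgebra Q m c)ᵐᵒᵖ (P Q m c (Q.t a) × P Q m c (Q.t (Q.bar a))))
        (ModuleCat.of (WTAlgebra Q m c)ᵐᵒᵖ
          (P Q m c (Q.t (Q.f a)) × P Q m c (Q.t (Q.f (Q.bar a)))))
        (ModuleCat.of (WTAlgebra Q m c)ᵐᵒᵖ (P Q m c (Q.s a))))
      (spliceMap (socleMap m c h a) (map₃ m c a) (map₂ m c a) (map₁ m c a)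
        (radP Q m c (Q.s a)).mkQ) (radP Q m c (Q.s a)).mkQ :=
  .splice (injective_socleMap m c h a) (exact_socleMap_map₃ m c h a)
    (exact_map₃_map₂ m c h a hne) (exact_map₂_map₁ m c h a hne) (exact_map₁_mkQ m c h a)
    (Submodule.mkQ_surjective _) (isProjectiveCover_mkQ m c h _)
    (.rangeRestrict_of_ker_le_jacobson
      (ker_map₁_le_jacobson m c h a (exact_map₂_map₁ m c h a hne)))
    (.rangeRestrict_of_ker_le_jacobson
      (ker_map₂_le_jacobson m c h a (exact_map₃_map₂ m c h a hne)))
    (.rangeRestrict_of_ker_le_jacobson (ker_map₃_le_jacobson m c h a))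
    (.rangeRestrict_of_ker_le_jacobson (ker_socleMap_comp_le_jacobson m c h a))

/-! ### Periodicity -/

/-- Runs of positive length annihilate `S_i`, so one element not killed by an arrow rules out an
isomorphism. The witnesses used below are the nonzero products `a g(a)`, `f(a) f²(a)` and `f²(a) a`.
-/
theorem not_nonempty_equiv_S (h : ∀ a, 3 ≤ Q.wt m a) {i : V} {M : Type*} [AddCommGroup M]
    [Module (WTAlgebra Q m c)ᵐᵒᵖ M] {N : Submodule (WTAlgebra Q m c)ᵐᵒᵖ M} {x : M} (hx : x ∈ N)
    {y : WTAlgebra Q m c} (hy : y ∈ arrowFiltration m c 1) (hxy : op y • x ≠ 0) :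
    ¬ Nonempty (N ≃ₗ[(WTAlgebra Q m c)ᵐᵒᵖ] S Q m c i) := by
  rintro ⟨E⟩
  have h1 : E (op y • ⟨x, hx⟩) = 0 := by
    rw [map_smul]
    exact arrow_smul_S m c h _ hy
  exact hxy (congrArg Subtype.val ((LinearEquiv.map_eq_zero_iff E).1 h1))

theorem not_nonempty_range_map₁_equiv (h : ∀ a, 3 ≤ Q.wt m a) (a : A) (i : V) :
    ¬ Nonempty (LinearMap.range (map₁ m c a) ≃ₗ[(WTAlgebra Q m c)ᵐᵒᵖ] S Q m c i) := by
  refine not_nonempty_equiv_S m c h ⟨(⟨e Q m c _, e_mem_P m c _⟩, 0), rfl⟩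
    (run_mem_arrowFiltration (Q.g a) le_rfl) fun h0 => ?_
  have h1 : (run m c a 1 * e Q m c (Q.t a) + run m c (Q.bar a) 1 * 0) * run m c (Q.g a) 1 = 0 :=
    congrArg Subtype.val h0
  rw [mul_zero, add_zero, run_one_mul_e, run_one_mul_run] at h1
  exact run_ne_zero m c h a (by have := h a; omega) h1

theorem not_nonempty_range_map₂_equiv (h : ∀ a, 3 ≤ Q.wt m a) (a : A) (i : V) :
    ¬ Nonempty (LinearMap.range (map₂ m c a) ≃ₗ[(WTAlgebra Q m c)ᵐᵒᵖ] S Q m c i) := by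
  refine not_nonempty_equiv_S m c h ⟨(⟨e Q m c _, e_mem_P m c _⟩, 0), rfl⟩
    (run_mem_arrowFiltration (Q.f (Q.f a)) le_rfl) fun h0 => ?_
  have h1 : ((map₂ m c a (⟨e Q m c _, e_mem_P m c _⟩, 0)).1 : WTAlgebra Q m c) *
      run m c (Q.f (Q.f a)) 1 = 0 := congrArg (fun p => (p.1 : WTAlgebra Q m c)) h0
  have h2 := (Prod.mk.inj (coe_map₂ m c a (⟨e Q m c _, e_mem_P m c _⟩, 0))).1
  rw [h2] at h1
  simp only [ZeroMemClass.coe_zero, mul_zero, smul_zero, sub_zero] at h1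
  rw [run_one_mul_e, run_f_mul_f_f m c h, smul_eq_zero] at h1
  refine run_ne_zero m c h (Q.g a) (by rw [wt_g]; omega) (h1.resolve_left (Units.ne_zero _))

theorem not_nonempty_range_map₃_equiv (h : ∀ a, 3 ≤ Q.wt m a) (a : A) (i : V) :
    ¬ Nonempty (LinearMap.range (map₃ m c a) ≃ₗ[(WTAlgebra Q m c)ᵐᵒᵖ] S Q m c i) := by
  refine not_nonempty_equiv_S m c h ⟨⟨e Q m c _, e_mem_P m c _⟩, rfl⟩
    (run_mem_arrowFiltration a le_rfl) fun h0 => ?_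
  have h1 : run m c (Q.f (Q.f a)) 1 * e Q m c (Q.s a) * run m c a 1 = 0 :=
    congrArg (fun p => (p.1 : WTAlgebra Q m c)) h0
  have h2 := run_mul_f m c h (Q.f (Q.f a))
  rw [Q.f_cube] at h2
  rw [← Q.t_f_f a, run_one_mul_e, h2, smul_eq_zero] at h1
  exact run_ne_zero m c h _ (by omega) (h1.resolve_left (Units.ne_zero _))

theorem isPeriodicOfPeriod_S (h : ∀ a, 3 ≤ Q.wt m a) (a : A)
    (hne : ¬ (Q.wt m a = 3 ∧ Q.wt m (Q.bar a) = 3 ∧ Q.wt m (Q.f a) = 3 ∧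
      Q.wt m (Q.f (Q.bar a)) = 3)) :
    IsPeriodicOfPeriod (ModuleCat.of (WTAlgebra Q m c)ᵐᵒᵖ (S Q m c (Q.s a))) 4 := by
  have H := IsMinimalProjectiveResolution.isSyzygy_succ_iff
    (M := ModuleCat.of (WTAlgebra Q m c)ᵐᵒᵖ (S Q m c (Q.s a)))
    (isMinimalProjectiveResolution m c h a hne)
  refine ⟨by norm_num, ?_, ?_⟩
  · rw [H]
    -- The fourth syzygy is the image of the differential with index three, the splicing map `P_i →
    -- S_i → P_i`; its image is that of the injection `S_i → P_i`.
    have h1 : LinearMap.range (socleMap m c h a ∘ₗ (radP Q m c (Q.s a)).mkQ) =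
        LinearMap.range (socleMap m c h a) :=
      LinearMap.range_comp_of_range_eq_top _ (Submodule.range_mkQ _)
    exact ⟨(LinearEquiv.ofEq _ _ h1).trans
      (LinearEquiv.ofInjective _ (injective_socleMap m c h a)).symm⟩
  · intro j h0 hj
    obtain ⟨j, rfl⟩ := Nat.exists_eq_add_of_le' h0
    have hj' : j < 3 := by omega
    rw [H]
    interval_cases j
    · exact not_nonempty_range_map₁_equiv m c h a _
    · exact not_nonempty_range_map₂_equiv m c h a _
    · exact not_nonempty_range_map₃_equiv m c h a _

end WTAlgebra

/-! ### Assembly of the proposition. -/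

theorem proposition7p1 {K : Type uK} {V : Type uV} {A : Type uA} [Field K] [IsAlgClosed K] [Fintype V]
    (Q : TriangulationQuiver V A) (hV : 3 ≤ Fintype.card V)
    (m : Q.Orbits → ℕ+) (c : Q.Orbits → Kˣ)
    (hmn : ∀ a, 3 ≤ (m (Q.orbit a) : ℕ) * Q.n a)
    (htet : ¬ IsTetrahedralData Q m) :
    (∀ (i : V) (a : A), Q.s a = i →
      ∃ (ι : WTAlgebra.S Q m c i →ₗ[(WTAlgebra Q m c)ᵐᵒᵖ] WTAlgebra.P Q m c i)
        (π₃ : WTAlgebra.P Q m c i →ₗ[(WTAlgebra Q m c)ᵐᵒᵖ]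
          WTAlgebra.P Q m c (Q.t (Q.f a)) × WTAlgebra.P Q m c (Q.t (Q.f (Q.bar a))))
        (π₂ : WTAlgebra.P Q m c (Q.t (Q.f a)) × WTAlgebra.P Q m c (Q.t (Q.f (Q.bar a)))
          →ₗ[(WTAlgebra Q m c)ᵐᵒᵖ]
            WTAlgebra.P Q m c (Q.t a) × WTAlgebra.P Q m c (Q.t (Q.bar a)))
        (π₁ : WTAlgebra.P Q m c (Q.t a) × WTAlgebra.P Q m c (Q.t (Q.bar a))
          →ₗ[(WTAlgebra Q m c)ᵐᵒᵖ] WTAlgebra.P Q m c i)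
        (ε : WTAlgebra.P Q m c i →ₗ[(WTAlgebra Q m c)ᵐᵒᵖ] WTAlgebra.S Q m c i),
        (Function.Injective ι ∧ Function.Exact ι π₃ ∧ Function.Exact π₃ π₂ ∧
          Function.Exact π₂ π₁ ∧ Function.Exact π₁ ε ∧ Function.Surjective ε) ∧
        IsMinimalProjectiveResolution
          (spliceObj
            (ModuleCat.of (WTAlgebra Q m c)ᵐᵒᵖ (WTAlgebra.P Q m c i))
            (ModuleCat.of (WTAlgebra Q m c)ᵐᵒᵖ
              (WTAlgebra.P Q m c (Q.t a) × WTAlgebra.P Q m c (Q.t (Q.bar a))))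
            (ModuleCat.of (WTAlgebra Q m c)ᵐᵒᵖ
              (WTAlgebra.P Q m c (Q.t (Q.f a)) × WTAlgebra.P Q m c (Q.t (Q.f (Q.bar a)))))
            (ModuleCat.of (WTAlgebra Q m c)ᵐᵒᵖ (WTAlgebra.P Q m c i)))
          (spliceMap ι π₃ π₂ π₁ ε) ε) ∧
    (∀ i : V, IsSimpleModule (WTAlgebra Q m c)ᵐᵒᵖ (WTAlgebra.S Q m c i) ∧
      IsPeriodicOfPeriod (ModuleCat.of (WTAlgebra Q m c)ᵐᵒᵖ (WTAlgebra.S Q m c i)) 4) ∧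
    (∀ M : ModuleCat.{max uK uV uA} (WTAlgebra Q m c)ᵐᵒᵖ,
      IsSimpleModule (WTAlgebra Q m c)ᵐᵒᵖ M → IsPeriodicOfPeriod M 4) := by

  have := TriangulationQuiver.finite_arrows Q
  have h : ∀ a, 3 ≤ Q.wt m a := hmn
  -- The non-tetrahedral assumption and the bound on the number of vertices enter only here, to
  -- exclude four weights equal to three.
  have hne : ∀ a, ¬ (Q.wt m a = 3 ∧ Q.wt m (Q.bar a) = 3 ∧ Q.wt m (Q.f a) = 3 ∧
      Q.wt m (Q.f (Q.bar a)) = 3) := fun a ha =>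
    htet (TriangulationQuiver.isTetrahedralData_of_wt_eq_three hV m a ha.1 ha.2.1 ha.2.2.1 ha.2.2.2)
  have hper : ∀ i, IsPeriodicOfPeriod
      (ModuleCat.of (WTAlgebra Q m c)ᵐᵒᵖ (WTAlgebra.S Q m c i)) 4 := by
    intro i
    obtain ⟨a, rfl⟩ := Q.exists_source i
    exact WTAlgebra.isPeriodicOfPeriod_S m c h a (hne a)
  refine ⟨?_, fun i => ⟨WTAlgebra.isSimpleModule_S m c h i, hper i⟩, ?_⟩
  · rintro _ a rfl
    exact ⟨WTAlgebra.socleMap m c h a, WTAlgebra.map₃ m c a, WTAlgebra.map₂ m c a,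
      WTAlgebra.map₁ m c a, (WTAlgebra.radP Q m c (Q.s a)).mkQ,
      ⟨WTAlgebra.injective_socleMap m c h a, WTAlgebra.exact_socleMap_map₃ m c h a,
        WTAlgebra.exact_map₃_map₂ m c h a (hne a), WTAlgebra.exact_map₂_map₁ m c h a (hne a),
        WTAlgebra.exact_map₁_mkQ m c h a, Submodule.mkQ_surjective _⟩,
      WTAlgebra.isMinimalProjectiveResolution m c h a (hne a)⟩
  · intro M hM
    obtain ⟨i, ⟨E⟩⟩ := WTAlgebra.exists_equiv_S m c h M
    exact (hper i).congr E
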